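/- Let $\mathfrak A^{CAR}$ be the CAR algebra over $\mathbb Z$, i.e. the $C^*$-algebra generated by elements $c_j$ ($j\in\mathbb Z$) with $\{c_j,c_k\}=0$ and $\{c_j,c_k^*\}=\delta_{jk}1$. Let $\tau_n(c_j)=c_{j+n}$ ($n\in\mathbb Z$) be the translations, $\gamma_\theta(c_j)=e^{-i\theta}c_j$ ($\theta\in\mathbb R$) the $U(1)$ gauge action, $\Theta(c_j)=-c_j$ the parity, and let $\mathfrak A^{CAR}_L$ be the $C^*$-subalgebra generated by the $c_j$ with $j\le 0$. Adjoin to $\mathfrak A^{CAR}$ a self-adjoint unitary $T$ with $Tc_jT=-c_j$ for $j\le 0$ and $Tc_jT=c_j$ for $j>0$, and put $\Theta(T)=T$. Put $$\sigma_z^{(j)}=2c_j^*c_j-1,\qquad \sigma_x^{(j)}=TS_j(c_j+c_j^*),\qquad \sigma_y^{(j)}=iTS_j(c_j-c_j^*),$$ where $S_j=\sigma_z^{(1)}\cdots\sigma_z^{(j-1)}$ for $j>1$, $S_1=1$, and $S_j=\sigma_z^{(0)}\cdots\sigma_z^{(j)}$ for $j<1$. The $C^*$-algebra $\mathfrak A$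 generated by the $\sigma_\alpha^{(j)}$ is the algebra $\overline{\bigotimes_{\mathbb Z}M_2(\mathbb C)}$ of the spin-$\frac12$ chain, with translations $\tau_n(\sigma_\alpha^{(j)})=\sigma_\alpha^{(j+n)}$; $\mathfrak A$ and $\mathfrak A^{CAR}$ have the same $\Theta$-even elements. For a $\Theta$-invariant state $\psi$ of $\mathfrak A^{CAR}$ let $\psi_+$ be its restriction to the even part; the $\Theta$-invariant extension of $\psi_+$ to $\mathfrak A$ is $\varphi(Q)=\psi\big(\tfrac12(Q+\Theta(Q))\big)$. Let $\psi$ be a pure state of $\mathfrak A^{CAR}$ with $\psi\circ\tau_n=\psi$ for all $n\in\mathbb Z$ and $\psi\circ\gamma_\theta=\psi$ for all $\theta\in\mathbb R$. (i) The $\Theta$-invariant extension of $\psi_+$ to $\mathfrak A$ is a translationally invariant pure state of $\mathfrak A$. (ii) If moreover the von Neumann algebra $\pi_\psi(\mathfrak A^{CAR}_L)''$ in the GNS representation $\pi_\psi$ of $\psi$ is of type I, then $\psi$ is either the Fock state $\psi_F$, the unique state with $\psi_F(c_j^*c_j)=0$ for all $j$, or the anti-Fock state $\psi_{AF}$, the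 unique state with $\psi_{AF}(c_jc_j^*)=0$ for all $j$. -/

import Mathlib

open scoped ComplexOrder InnerProductSpace symmDiff ComplexConjugate

noncomputable section

namespace FermionChain

/-! ### Fock space and weighted permutation operators -/

/-- The fermionic Fock space over `ℓ²(ℤ)` in the occupation number basis: square summable
functions of the finite set `S` of occupied sites. -/
abbrev Fock : Type := lp (fun _ : Finset ℤ => ℂ) 2

/-- Bounded operators on Fock space. -/
abbrev Op : Type := Fock →L[ℂ] Fock

lemma memlp_weighted (p : Equiv.Perm (Finset ℤ)) (w : Finset ℤ → ℂ) (hw : ∀ S, ‖w S‖ ≤ 1)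
    (f : Fock) : Summable fun S => ‖w S * f (p S)‖ ^ (2 : ℕ) := by
  have hf : Summable fun S => ‖f S‖ ^ (2 : ℕ) := by
    have := (lp.memℓp f).summable (by norm_num)
    simpa using this
  refine Summable.of_nonneg_of_le (fun _ => by positivity) (fun S => ?_)
    ((Equiv.summable_iff p).2 hf)
  rw [norm_mul]
  have h1 := hw S
  have : ‖w S‖ * ‖f (p S)‖ ≤ ‖f (p S)‖ := mul_le_of_le_one_left (norm_nonneg _) h1
  exact pow_le_pow_left₀ (by positivity) this 2

/-- The bounded operator `(M f)(S) = w S * f (p S)`, for a permutation `p` of the occupation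
number basis and weights `w` of modulus at most one. -/
def weighted (p : Equiv.Perm (Finset ℤ)) (w : Finset ℤ → ℂ) (hw : ∀ S, ‖w S‖ ≤ 1) : Op :=
  LinearMap.mkContinuous
    { toFun := fun f => ⟨fun S => w S * f (p S), by
        refine memℓp_gen ?_
        simpa using memlp_weighted p w hw f⟩
      map_add' := fun f g => by
        ext S
        exact mul_add _ _ _
      map_smul' := fun a f => by
        ext S
        simp [mul_left_comm] }
    1 (fun f => by
      have hf : Summable fun S => ‖f S‖ ^ (2 : ℕ) := by
        have := (lp.memℓp f).summable (by norm_num)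
        simpa using this
      rw [one_mul, ← sq_le_sq₀ (norm_nonneg _) (norm_nonneg _)]
      have e : ∀ g : Fock, ‖g‖ ^ 2 = ∑' S, ‖g S‖ ^ (2 : ℕ) := fun g => by
        have := lp.norm_rpow_eq_tsum (p := 2) (by norm_num) g
        simpa using this
      rw [e, e, ← Equiv.tsum_eq p (fun S => ‖f S‖ ^ (2 : ℕ))]
      refine Summable.tsum_le_tsum (fun S => ?_) (memlp_weighted p w hw f)
        ((Equiv.summable_iff p).2 hf)
      change ‖w S * f (p S)‖ ^ 2 ≤ ‖f (p S)‖ ^ 2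
      rw [norm_mul]
      exact pow_le_pow_left₀ (by positivity)
        (mul_le_of_le_one_left (norm_nonneg _) (hw S)) 2)

@[simp] lemma weighted_apply (p : Equiv.Perm (Finset ℤ)) (w : Finset ℤ → ℂ)
    (hw : ∀ S, ‖w S‖ ≤ 1) (f : Fock) (S : Finset ℤ) :
    weighted p w hw f S = w S * f (p S) := rfl

lemma op_ext {A B : Op} (h : ∀ f S, A f S = B f S) : A = B :=
  ContinuousLinearMap.ext fun f => lp.ext (funext fun S => h f S)

lemma star_weighted (p : Equiv.Perm (Finset ℤ)) (w : Finset ℤ → ℂ) (hw : ∀ S, ‖w S‖ ≤ 1) :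
    star (weighted p w hw) =
      weighted p.symm (fun S => conj (w (p.symm S))) (fun S => by simpa using hw _) := by
  rw [ContinuousLinearMap.star_eq_adjoint, eq_comm, ContinuousLinearMap.eq_adjoint_iff]
  intro f g
  rw [lp.inner_eq_tsum, lp.inner_eq_tsum, ← Equiv.tsum_eq p]
  refine tsum_congr fun S => ?_
  simp [mul_comm, mul_left_comm, mul_assoc]

/-- The unitary operator `(M f)(S) = u S * f (p S)`, for phases `u`. -/
def monomialUnitary (p : Equiv.Perm (Finset ℤ)) (u : Finset ℤ → ℂ) (hu : ∀ S, ‖u S‖ = 1) :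
    unitary Op :=
  ⟨weighted p u (fun S => (hu S).le), by
    have h : ∀ S, conj (u S) * u S = 1 := fun S => by
      rw [← Complex.normSq_eq_conj_mul_self, Complex.normSq_eq_norm_sq, hu]; simp
    rw [Unitary.mem_iff, star_weighted]
    constructor <;> refine op_ext fun f S => ?_
    · simp [← mul_assoc, h]
    · simp [← mul_assoc, mul_comm (u S) (conj (u S)), h]⟩

/-! ### Creation and annihilation operators -/

/-- Change the occupation of the site `j`. -/
def flipSite (j : ℤ) : Equiv.Perm (Finset ℤ) where
  toFun S := S ∆ {j}
  invFun S := S ∆ {j}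
  left_inv S := by simp
  right_inv S := by simp

/-- Translate a configuration by `n`. -/
def translate (n : ℤ) : Equiv.Perm (Finset ℤ) := Equiv.finsetCongr (Equiv.addRight n)

/-- The sign `(-1) ^ #{i ∈ S : i < j}`. -/
def sgn (j : ℤ) (S : Finset ℤ) : ℂ := (-1) ^ (S.filter (· < j)).card

/-- The annihilation operator `c_j`: it maps the basis vector `e_S` to `sgn j S • e_{S \ {j}}` if
`j ∈ S`, and to `0` otherwise; equivalently `(c_j f)(S) = sgn j S * f (S ∪ {j})` for `j ∉ S`. -/
def annih (j : ℤ) : Op :=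
  weighted (flipSite j) (fun S => if j ∈ S then 0 else sgn j S)
    (fun S => by split_ifs <;> simp [sgn])

/-- The unitary `(-1) ^ N`, where `N` is the particle number. -/
def parityU : unitary Op :=
  monomialUnitary (Equiv.refl _) (fun S => (-1) ^ S.card) (by simp)

/-- The unitary `exp (i θ N)`. -/
def gaugeU (θ : ℝ) : unitary Op :=
  monomialUnitary (Equiv.refl _) (fun S => Complex.exp (θ * Complex.I) ^ S.card)
    (by simp [Complex.norm_exp_ofReal_mul_I])

/-- The unitary mapping `e_S` to `e_{S + n}`. -/
def shiftU (n : ℤ) : unitary Op :=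
  monomialUnitary (translate (-n)) (fun _ => 1) (by simp)

/-- The self-adjoint unitary `T` with `T c_j T = -c_j` for `j ≤ 0` and `T c_j T = c_j` for
`j > 0`: multiplication by `(-1) ^ #{i ∈ S : i ≤ 0}`. -/
def tU : unitary Op :=
  monomialUnitary (Equiv.refl _) (fun S => (-1) ^ (S.filter (· ≤ 0)).card) (by simp)

/-- The *-automorphism `Q ↦ u Q u*` of the bounded operators. -/
abbrev Ad (u : unitary Op) : Op ≃⋆ₐ[ℂ] Op := Unitary.conjStarAlgAut ℂ Op u

lemma Ad_continuous (u : unitary Op) : Continuous (Ad u) := by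
  change Continuous fun x : Op => (u : Op) * x * (star u : Op)
  fun_prop

lemma mem_flip (j i : ℤ) (S : Finset ℤ) : i ∈ flipSite j S ↔ (i ∈ S ↔ i ≠ j) := by
  simp [flipSite, Finset.mem_symmDiff]; tauto

lemma flip_of_notMem {j : ℤ} {S : Finset ℤ} (h : j ∉ S) : flipSite j S = insert j S := by
  ext i; simp only [mem_flip, Finset.mem_insert]
  by_cases hi : i = j <;> simp_all

lemma flip_of_mem {j : ℤ} {S : Finset ℤ} (h : j ∈ S) : flipSite j S = S.erase j := by
  ext i; simp only [mem_flip, Finset.mem_erase]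
  by_cases hi : i = j <;> simp_all

@[simp] lemma flip_symm (j : ℤ) : (flipSite j).symm = flipSite j := rfl
@[simp] lemma flip_flip (j : ℤ) (S : Finset ℤ) : flipSite j (flipSite j S) = S := (flipSite j).left_inv S

lemma sgn_insert {j k : ℤ} {S : Finset ℤ} (h : j ∉ S) :
    sgn k (insert j S) = (if j < k then -1 else 1) * sgn k S := by
  unfold sgn
  rw [Finset.filter_insert]
  split_ifs with hk
  · rw [Finset.card_insert_of_notMem (by simp [h]), pow_succ]; ring
  · simp

lemma sgn_flip (j k : ℤ) (S : Finset ℤ) :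
    sgn k (flipSite j S) = (if j < k then -1 else 1) * sgn k S := by
  by_cases h : j ∈ S
  · rw [flip_of_mem h]
    conv_rhs => rw [← Finset.insert_erase h, sgn_insert (Finset.notMem_erase j S)]
    split_ifs <;> simp
  · rw [flip_of_notMem h, sgn_insert h]

@[simp] lemma conj_sgn (j : ℤ) (S : Finset ℤ) : conj (sgn j S) = sgn j S := by simp [sgn]
@[simp] lemma sgn_mul_self (j : ℤ) (S : Finset ℤ) : sgn j S * sgn j S = 1 := by
  simp [sgn, ← mul_pow]

lemma annih_apply (j : ℤ) (f : Fock) (S : Finset ℤ) :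
    annih j f S = (if j ∈ S then 0 else sgn j S) * f (flipSite j S) := rfl

lemma star_annih_apply (j : ℤ) (f : Fock) (S : Finset ℤ) :
    star (annih j) f S = (if j ∈ S then sgn j S else 0) * f (flipSite j S) := by
  rw [annih, star_weighted, weighted_apply]
  simp only [flip_symm, mem_flip, sgn_flip, lt_irrefl]
  by_cases h : j ∈ S <;> simp [h]

lemma flip_comm (j k : ℤ) (S : Finset ℤ) : flipSite j (flipSite k S) = flipSite k (flipSite j S) := by
  change (S ∆ {k}) ∆ {j} = (S ∆ {j}) ∆ {k}
  rw [symmDiff_right_comm]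

/-- The canonical anticommutation relations. -/
theorem annih_anticomm (j k : ℤ) : annih j * annih k + annih k * annih j = 0 := by
  refine op_ext fun f S => ?_
  simp only [add_apply, mul_apply_eq_comp, lp.coeFn_add,
    Pi.add_apply, annih_apply, mem_flip, sgn_flip, flip_comm j k]
  rcases lt_trichotomy j k with h | h | h
  · by_cases h1 : j ∈ S <;> by_cases h2 : k ∈ S <;>
      simp [h1, h2, h, h.ne, h.ne', h.not_gt]; ring
  · subst h; by_cases h1 : j ∈ S <;> simp [h1]
  · by_cases h1 : j ∈ S <;> by_cases h2 : k ∈ S <;>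
      simp [h1, h2, h, h.ne, h.ne', h.not_gt]; ring

theorem annih_anticomm_star (j k : ℤ) :
    annih j * star (annih k) + star (annih k) * annih j = if j = k then 1 else 0 := by
  refine op_ext fun f S => ?_
  simp only [add_apply, mul_apply_eq_comp, lp.coeFn_add,
    Pi.add_apply, annih_apply, star_annih_apply, mem_flip, sgn_flip, flip_comm j k]
  rcases lt_trichotomy j k with h | h | h
  · by_cases h1 : j ∈ S <;> by_cases h2 : k ∈ S <;>
      simp [h1, h2, h, h.ne, h.ne', h.not_gt]; ring
  · subst h; by_cases h1 : j ∈ S <;> simp [h1, ← mul_assoc]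
  · by_cases h1 : j ∈ S <;> by_cases h2 : k ∈ S <;>
      simp [h1, h2, h, h.ne, h.ne', h.not_gt]; ring


lemma Ad_eq_iff {u : unitary Op} {A B : Op} : Ad u A = B ↔ (u : Op) * A = B * (u : Op) := by
  rw [Unitary.conjStarAlgAut_apply]
  constructor
  · rintro rfl; simp [mul_assoc]
  · intro h; rw [h]; simp [mul_assoc]

@[simp] lemma monomialUnitary_apply (p : Equiv.Perm (Finset ℤ)) (u : Finset ℤ → ℂ)
    (hu : ∀ S, ‖u S‖ = 1) (f : Fock) (S : Finset ℤ) :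
    (monomialUnitary p u hu : Op) f S = u S * f (p S) := rfl

lemma Ad_diag_annih {u : Finset ℤ → ℂ} (hu : ∀ S, ‖u S‖ = 1) (j : ℤ) (a : ℂ)
    (h : ∀ S, j ∉ S → u S = a * u (insert j S)) :
    Ad (monomialUnitary (Equiv.refl _) u hu) (annih j) = a • annih j := by
  rw [Ad_eq_iff]
  refine op_ext fun f S => ?_
  simp only [mul_apply_eq_comp, monomialUnitary_apply, annih_apply, Equiv.refl_apply,
    smul_mul_assoc, smul_apply, lp.coeFn_smul, Pi.smul_apply, smul_eq_mul]
  by_cases hj : j ∈ S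
  · simp [hj]
  · rw [h S hj, flip_of_notMem hj]; simp [hj]; ring

/-- `Θ(c_j) = -c_j`. -/
theorem Ad_parityU_annih (j : ℤ) : Ad parityU (annih j) = -annih j := by
  have := Ad_diag_annih (u := fun S => (-1) ^ S.card) (by simp) j (-1) (fun S hS => by
    simp [Finset.card_insert_of_notMem hS, pow_succ])
  simpa [parityU] using this

/-- `γ_θ(c_j) = exp (-i θ) c_j`. -/
theorem Ad_gaugeU_annih (θ : ℝ) (j : ℤ) :
    Ad (gaugeU θ) (annih j) = Complex.exp (-(θ * Complex.I)) • annih j :=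
  Ad_diag_annih _ j _ (fun S hS => by
    rw [Finset.card_insert_of_notMem hS, pow_succ', ← mul_assoc, ← Complex.exp_add]; simp)

/-- `T c_j T* = -c_j` for `j ≤ 0` and `T c_j T* = c_j` for `j > 0`. -/
theorem Ad_tU_annih (j : ℤ) : Ad tU (annih j) = (if j ≤ 0 then (-1 : ℂ) else 1) • annih j :=
  Ad_diag_annih _ j _ (fun S hS => by
    rw [Finset.filter_insert]
    split_ifs with h
    · rw [Finset.card_insert_of_notMem (by simp [hS]), pow_succ]; ring
    · simp)

lemma mem_translate (n i : ℤ) (S : Finset ℤ) : i ∈ translate n S ↔ i - n ∈ S := by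
  simp only [translate, Equiv.finsetCongr_apply, Finset.mem_map_equiv]
  rfl

lemma sgn_translate (n j : ℤ) (S : Finset ℤ) : sgn j (translate n S) = sgn (j - n) S := by
  unfold sgn
  congr 1
  refine Finset.card_nbij' (fun i => i - n) (fun i => i + n) ?_ ?_ ?_ ?_
  · intro i hi; simp [mem_translate] at hi ⊢; exact hi
  · intro i hi; simp [mem_translate] at hi ⊢; exact ⟨hi.1, by omega⟩
  · intro i _; simp
  · intro i _; simp

lemma translate_flip (n j : ℤ) (S : Finset ℤ) :
    translate n (flipSite j S) = flipSite (j + n) (translate n S) := by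
  ext i
  simp only [mem_translate, mem_flip, ne_eq, sub_eq_iff_eq_add]

/-- `τ_n(c_j) = c_{j+n}`. -/
theorem Ad_shiftU_annih (n j : ℤ) : Ad (shiftU n) (annih j) = annih (j + n) := by
  rw [Ad_eq_iff]
  refine op_ext fun f S => ?_
  simp only [mul_apply_eq_comp, shiftU, monomialUnitary_apply, annih_apply, one_mul,
    mem_translate, sgn_translate, translate_flip, sub_neg_eq_add, add_neg_cancel_right]

/-! ### The CAR algebra -/

/-- The CAR algebra: the C*-algebra generated by the `c_j`, `j ∈ ℤ`. -/
def carAlgebra : StarSubalgebra ℂ Op :=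
  (StarAlgebra.adjoin ℂ (Set.range annih)).topologicalClosure

instance carAlgebra_isClosed : IsClosed (carAlgebra : Set Op) :=
  StarSubalgebra.isClosed_topologicalClosure _

lemma annih_mem (j : ℤ) : annih j ∈ carAlgebra :=
  StarSubalgebra.le_topologicalClosure _ (StarAlgebra.subset_adjoin ℂ _ ⟨j, rfl⟩)

/-- `c_j` as an element of the CAR algebra. -/
def c (j : ℤ) : carAlgebra := ⟨annih j, annih_mem j⟩

/-- The C*-subalgebra of the CAR algebra generated by the `c_j`, `j ∈ Λ`. -/
def carLocal (Λ : Set ℤ) : StarSubalgebra ℂ carAlgebra :=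
  (StarAlgebra.adjoin ℂ (c '' Λ)).topologicalClosure

lemma Ad_mem {u : unitary Op} {s : Set Op} {B : StarSubalgebra ℂ Op}
    (hB : IsClosed (B : Set Op)) (h : ∀ x ∈ s, Ad u x ∈ B) :
    ∀ Q ∈ (StarAlgebra.adjoin ℂ s).topologicalClosure, Ad u Q ∈ B := by
  have h1 : (StarAlgebra.adjoin ℂ s).topologicalClosure ≤ B.comap (Ad u : Op →⋆ₐ[ℂ] Op) :=
    StarSubalgebra.topologicalClosure_minimal (StarAlgebra.adjoin_le h)
      (hB.preimage (Ad_continuous u))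
  exact fun Q hQ => h1 hQ

/-- The restriction of `Q ↦ u Q u*` to an invariant *-subalgebra. -/
def restrictAd (B : StarSubalgebra ℂ Op) (u : unitary Op) (h : ∀ Q ∈ B, Ad u Q ∈ B) :
    B →⋆ₐ[ℂ] B :=
  ((Ad u : Op →⋆ₐ[ℂ] Op).comp B.subtype).codRestrict B fun Q => h Q Q.2

/-- The translation `τ_n` of the CAR algebra, `τ_n(c_j) = c_{j+n}`. -/
def carShift (n : ℤ) : carAlgebra →⋆ₐ[ℂ] carAlgebra :=
  restrictAd carAlgebra (shiftU n) (Ad_mem carAlgebra_isClosed (by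
    rintro _ ⟨j, rfl⟩; rw [Ad_shiftU_annih]; exact annih_mem _))

/-- The gauge automorphism `γ_θ` of the CAR algebra, `γ_θ(c_j) = exp (-i θ) c_j`. -/
def carGauge (θ : ℝ) : carAlgebra →⋆ₐ[ℂ] carAlgebra :=
  restrictAd carAlgebra (gaugeU θ) (Ad_mem carAlgebra_isClosed (by
    rintro _ ⟨j, rfl⟩; rw [Ad_gaugeU_annih]; exact SMulMemClass.smul_mem _ (annih_mem _)))

theorem carShift_c (n j : ℤ) : carShift n (c j) = c (j + n) := Subtype.ext (Ad_shiftU_annih n j)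

theorem carGauge_c (θ : ℝ) (j : ℤ) :
    carGauge θ (c j) = Complex.exp (-(θ * Complex.I)) • c j := Subtype.ext (Ad_gaugeU_annih θ j)

/-! ### The spin algebra

It is realized on the same Fock space through the Jordan-Wigner formulas with the self-adjoint
unitary `T` (`tU`), so that it and the CAR algebra are C*-subalgebras of one algebra.
The relations `pauli_relations` and `pauli_commute` determine the C*-algebra generated by the spin
operators up to isomorphism: it is the infinite tensor product over `ℤ` of the 2 by 2 matrices,
just as the canonical anticommutation relations determine the CAR algebra. -/

def sigmaZ (j : ℤ) : Op := (2 : ℂ) • (star (annih j) * annih j) - 1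

/-- The product `σ_z^(1) ⋯ σ_z^(j-1)` for `j > 1`, `1` for `j = 1`, and
`σ_z^(0) ⋯ σ_z^(j)` for `j < 1`. -/
def jwString (j : ℤ) : Op :=
  if 1 ≤ j then ((List.range (j - 1).toNat).map fun k : ℕ => sigmaZ (k + 1)).prod
  else ((List.range (1 - j).toNat).map fun k : ℕ => sigmaZ (-k)).prod

def sigmaX (j : ℤ) : Op := (tU : Op) * jwString j * (annih j + star (annih j))

def sigmaY (j : ℤ) : Op :=
  Complex.I • ((tU : Op) * jwString j * (annih j - star (annih j)))

/-- The algebra of the spin 1/2 chain: the C*-algebra generated by the Pauli spin operators. -/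
def spinAlgebra : StarSubalgebra ℂ Op :=
  (StarAlgebra.adjoin ℂ (Set.range sigmaX ∪ Set.range sigmaY ∪ Set.range sigmaZ)).topologicalClosure

instance spinAlgebra_isClosed : IsClosed (spinAlgebra : Set Op) :=
  StarSubalgebra.isClosed_topologicalClosure _

lemma sigmaX_mem (j : ℤ) : sigmaX j ∈ spinAlgebra :=
  StarSubalgebra.le_topologicalClosure _ (StarAlgebra.subset_adjoin ℂ _ (Or.inl (Or.inl ⟨j, rfl⟩)))
lemma sigmaY_mem (j : ℤ) : sigmaY j ∈ spinAlgebra :=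
  StarSubalgebra.le_topologicalClosure _ (StarAlgebra.subset_adjoin ℂ _ (Or.inl (Or.inr ⟨j, rfl⟩)))
lemma sigmaZ_mem (j : ℤ) : sigmaZ j ∈ spinAlgebra :=
  StarSubalgebra.le_topologicalClosure _ (StarAlgebra.subset_adjoin ℂ _ (Or.inr ⟨j, rfl⟩))

lemma sigmaZ_apply (j : ℤ) (f : Fock) (S : Finset ℤ) :
    sigmaZ j f S = (if j ∈ S then 1 else -1) * f S := by
  simp only [sigmaZ, sub_apply, smul_apply,
    mul_apply_eq_comp, lp.coeFn_sub, lp.coeFn_smul, Pi.sub_apply, Pi.smul_apply,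
    star_annih_apply, annih_apply, mem_flip, sgn_flip, flip_flip, lt_irrefl]
  by_cases h : j ∈ S
  · simp [h, ← mul_assoc]; ring
  · simp [h]

lemma sgn_succ (j : ℤ) (S : Finset ℤ) :
    sgn (j + 1) S = (if j ∈ S then -1 else 1) * sgn j S := by
  unfold sgn
  split_ifs with h
  · have : S.filter (· < j + 1) = insert j (S.filter (· < j)) := by
      ext i; simp only [Finset.mem_filter, Finset.mem_insert]
      constructor
      · rintro ⟨h1, h2⟩
        rcases eq_or_ne i j with h3 | h3
        · exact Or.inl h3
        · exact Or.inr ⟨h1, by omega⟩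
      · rintro (rfl | ⟨h1, h2⟩)
        · exact ⟨h, by omega⟩
        · exact ⟨h1, by omega⟩
    rw [this, Finset.card_insert_of_notMem (by simp), pow_succ]; ring
  · have : S.filter (· < j + 1) = S.filter (· < j) := by
      ext i; simp only [Finset.mem_filter]
      constructor
      · rintro ⟨h1, h2⟩
        have : i ≠ j := by rintro rfl; exact h h1
        exact ⟨h1, by omega⟩
      · rintro ⟨h1, h2⟩
        exact ⟨h1, by omega⟩
    rw [this, one_mul]

lemma tU_apply (f : Fock) (S : Finset ℤ) : (tU : Op) f S = sgn 1 S * f S := by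
  simp [tU, sgn, ← Int.lt_add_one_iff]

/-- `T S_j` is multiplication by `(-1) ^ (j - 1) * sgn j S`. -/
lemma tU_jwString_apply (j : ℤ) (f : Fock) (S : Finset ℤ) :
    ((tU : Op) * jwString j) f S = ((-1) ^ (j - 1) * sgn j S) * f S := by
  have up : ∀ n : ℕ, ∀ f : Fock, ∀ S,
      ((tU : Op) * ((List.range n).map fun k : ℕ => sigmaZ (k + 1)).prod) f S
        = ((-1) ^ n * sgn (n + 1) S) * f S := by
    intro n
    induction n with
    | zero => intro f S; simp [tU_apply]
    | succ n ih =>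
      intro f S
      rw [List.range_succ, List.map_append, List.prod_append, ← mul_assoc, mul_apply_eq_comp, ih]
      simp only [List.map_cons, List.map_nil, List.prod_cons, List.prod_nil, mul_one, sigmaZ_apply]
      push_cast
      rw [sgn_succ (n + 1)]
      split_ifs <;> ring
  have down : ∀ n : ℕ, ∀ f : Fock, ∀ S,
      ((tU : Op) * ((List.range n).map fun k : ℕ => sigmaZ (-k)).prod) f S
        = ((-1) ^ n * sgn (1 - n) S) * f S := by
    intro n
    induction n with
    | zero => intro f S; simp [tU_apply]
    | succ n ih =>
      intro f S
      rw [List.range_succ, List.map_append, List.prod_append, ← mul_assoc, mul_apply_eq_comp, ih]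
      simp only [List.map_cons, List.map_nil, List.prod_cons, List.prod_nil, mul_one, sigmaZ_apply]
      have e : (1 : ℤ) - n = -n + 1 := by ring
      have e' : (1 : ℤ) - (n + 1 : ℕ) = -n := by push_cast; ring
      rw [e, e', sgn_succ]
      split_ifs <;> ring
  unfold jwString
  split_ifs with h
  · rw [up]
    obtain ⟨n, hn⟩ := Int.eq_ofNat_of_zero_le (show 0 ≤ j - 1 by omega)
    have : j = n + 1 := by omega
    subst this
    simp
  · rw [down]
    obtain ⟨n, hn⟩ := Int.eq_ofNat_of_zero_le (show 0 ≤ 1 - j by omega)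
    have : j = 1 - n := by omega
    subst this
    have e1 : ((-1 : ℂ) ^ n)⁻¹ = (-1) ^ n := by rw [← inv_pow]; norm_num
    simp [sub_sub_cancel_left, e1]


lemma neg_one_zpow_mul_self (n : ℤ) : (-1 : ℂ) ^ n * (-1) ^ n = 1 := by
  rw [← mul_zpow]; simp

lemma sigmaX_apply (j : ℤ) (f : Fock) (S : Finset ℤ) :
    sigmaX j f S = (-1) ^ (j - 1) * f (flipSite j S) := by
  rw [sigmaX, mul_apply_eq_comp, tU_jwString_apply]
  simp only [add_apply, lp.coeFn_add, Pi.add_apply, annih_apply, star_annih_apply]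
  by_cases h : j ∈ S <;> simp [h, mul_assoc, ← mul_assoc (sgn j S)]

lemma sigmaY_apply (j : ℤ) (f : Fock) (S : Finset ℤ) :
    sigmaY j f S =
      (-1) ^ (j - 1) * (if j ∈ S then -Complex.I else Complex.I) * f (flipSite j S) := by
  rw [sigmaY, smul_apply, lp.coeFn_smul, Pi.smul_apply, mul_apply_eq_comp, tU_jwString_apply]
  simp only [sub_apply, lp.coeFn_sub, Pi.sub_apply, annih_apply, star_annih_apply, smul_eq_mul]
  have := sgn_mul_self j S
  by_cases h : j ∈ S
  · simp only [h, if_true]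
    linear_combination (-Complex.I * (-1) ^ (j - 1) * f (flipSite j S)) * this
  · simp only [h, if_false]
    linear_combination (Complex.I * (-1) ^ (j - 1) * f (flipSite j S)) * this

/-- The Pauli relations at one site. -/
theorem pauli_relations (j : ℤ) :
    sigmaX j * sigmaX j = 1 ∧ sigmaY j * sigmaY j = 1 ∧ sigmaZ j * sigmaZ j = 1 ∧
    sigmaX j * sigmaY j = Complex.I • sigmaZ j ∧ sigmaY j * sigmaX j = -(Complex.I • sigmaZ j) := by
  have h1 := neg_one_zpow_mul_self (j - 1)
  have h2 := Complex.I_mul_I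
  refine ⟨?_, ?_, ?_, ?_, ?_⟩ <;> refine op_ext fun f S => ?_ <;>
    simp only [mul_apply_eq_comp, sigmaX_apply, sigmaY_apply, sigmaZ_apply, flip_flip, mem_flip,
      smul_apply, neg_apply, lp.coeFn_smul, lp.coeFn_neg, Pi.smul_apply, Pi.neg_apply, smul_eq_mul,
      one_apply_eq_self] <;>
    by_cases h : j ∈ S <;> (try simp [h]) <;> grind

theorem pauli_selfAdjoint (j : ℤ) :
    IsSelfAdjoint (sigmaX j) ∧ IsSelfAdjoint (sigmaY j) ∧ IsSelfAdjoint (sigmaZ j) := by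
  have hX : sigmaX j = weighted (flipSite j) (fun _ => (-1) ^ (j - 1)) (by simp) :=
    op_ext fun f S => sigmaX_apply j f S
  have hY : sigmaY j = weighted (flipSite j)
      (fun S => (-1) ^ (j - 1) * (if j ∈ S then -Complex.I else Complex.I))
      (fun S => by split_ifs <;> simp) := op_ext fun f S => sigmaY_apply j f S
  refine ⟨?_, ?_, ?_⟩
  · rw [IsSelfAdjoint, hX, star_weighted]
    refine op_ext fun f S => ?_
    simp [map_zpow₀]
  · rw [IsSelfAdjoint, hY, star_weighted]
    refine op_ext fun f S => ?_
    by_cases h : j ∈ S <;> simp [map_zpow₀, mem_flip, h]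
  · simp [IsSelfAdjoint, sigmaZ]

/-- The spin operators at different sites commute. -/
theorem pauli_commute {j k : ℤ} (hjk : j ≠ k) {P Q : Op}
    (hP : P = sigmaX j ∨ P = sigmaY j ∨ P = sigmaZ j)
    (hQ : Q = sigmaX k ∨ Q = sigmaY k ∨ Q = sigmaZ k) : P * Q = Q * P := by
  rcases hP with rfl | rfl | rfl <;> rcases hQ with rfl | rfl | rfl <;>
    refine op_ext fun f S => ?_ <;>
    simp only [mul_apply_eq_comp, sigmaX_apply, sigmaY_apply, sigmaZ_apply, flip_comm j k,
      mem_flip, ne_eq, hjk, hjk.symm, not_false_eq_true, iff_true] <;> ring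

/-- The unitary mapping `e_S` to `(-1) ^ (n #S) e_{S + n}`. -/
def spinShiftU (n : ℤ) : unitary Op :=
  monomialUnitary (translate (-n)) (fun S => ((-1) ^ n) ^ S.card) (by simp)

lemma pow_card_flip {a : ℂ} (ha : a * a = 1) (j : ℤ) (S : Finset ℤ) :
    a ^ (flipSite j S).card = a * a ^ S.card := by
  by_cases h : j ∈ S
  · rw [flip_of_mem h]
    conv_rhs => rw [← Finset.insert_erase h, Finset.card_insert_of_notMem (by simp), pow_succ']
    rw [← mul_assoc, ha, one_mul]
  · rw [flip_of_notMem h, Finset.card_insert_of_notMem h, pow_succ']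

/-- `τ_n(σ_x^(j)) = σ_x^(j+n)`, and likewise for the other two components. -/
theorem Ad_spinShiftU_sigmaX (n j : ℤ) : Ad (spinShiftU n) (sigmaX j) = sigmaX (j + n) := by
  rw [Ad_eq_iff]
  refine op_ext fun f S => ?_
  simp only [mul_apply_eq_comp, spinShiftU, monomialUnitary_apply, sigmaX_apply, translate_flip,
    pow_card_flip (neg_one_zpow_mul_self n), add_neg_cancel_right]
  rw [show j + n - 1 = (j - 1) + n by ring, zpow_add₀ (by norm_num)]
  linear_combination (-(((-1 : ℂ) ^ n) ^ S.card * (-1) ^ (j - 1) * f (flipSite j (translate (-n) S)))) *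
    neg_one_zpow_mul_self n

theorem Ad_spinShiftU_sigmaY (n j : ℤ) : Ad (spinShiftU n) (sigmaY j) = sigmaY (j + n) := by
  rw [Ad_eq_iff]
  refine op_ext fun f S => ?_
  simp only [mul_apply_eq_comp, spinShiftU, monomialUnitary_apply, sigmaY_apply, translate_flip,
    pow_card_flip (neg_one_zpow_mul_self n), add_neg_cancel_right, mem_translate, sub_neg_eq_add]
  rw [show j + n - 1 = (j - 1) + n by ring, zpow_add₀ (by norm_num)]
  linear_combination (-(((-1 : ℂ) ^ n) ^ S.card * (-1) ^ (j - 1) *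
    (if j + n ∈ S then -Complex.I else Complex.I) * f (flipSite j (translate (-n) S)))) *
    neg_one_zpow_mul_self n

theorem Ad_spinShiftU_sigmaZ (n j : ℤ) : Ad (spinShiftU n) (sigmaZ j) = sigmaZ (j + n) := by
  rw [Ad_eq_iff]
  refine op_ext fun f S => ?_
  simp only [mul_apply_eq_comp, spinShiftU, monomialUnitary_apply, sigmaZ_apply,
    mem_translate, sub_neg_eq_add]
  ring

/-- The translation `τ_n` of the spin algebra, `τ_n(σ_α^(j)) = σ_α^(j+n)`. -/
def spinShift (n : ℤ) : spinAlgebra →⋆ₐ[ℂ] spinAlgebra :=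
  restrictAd spinAlgebra (spinShiftU n) (Ad_mem spinAlgebra_isClosed (by
    rintro _ ((⟨j, rfl⟩ | ⟨j, rfl⟩) | ⟨j, rfl⟩)
    · rw [Ad_spinShiftU_sigmaX]; exact sigmaX_mem _
    · rw [Ad_spinShiftU_sigmaY]; exact sigmaY_mem _
    · rw [Ad_spinShiftU_sigmaZ]; exact sigmaZ_mem _))

/-! ### The common even part -/

/-- The parity `Θ`, as an automorphism of the bounded operators: `Θ(c_j) = -c_j`, `Θ(T) = T`,
`Θ(σ_x^(j)) = -σ_x^(j)`, `Θ(σ_y^(j)) = -σ_y^(j)`, `Θ(σ_z^(j)) = σ_z^(j)`. -/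
def parity : Op ≃⋆ₐ[ℂ] Op := Ad parityU

lemma parity_annih (j : ℤ) : parity (annih j) = -annih j := Ad_parityU_annih j

lemma parity_T : parity (tU : Op) = tU := by
  rw [parity, Ad_eq_iff]
  refine op_ext fun f S => ?_
  simp [parityU, tU]; ring

lemma parity_sigmaZ (j : ℤ) : parity (sigmaZ j) = sigmaZ j := by
  simp [sigmaZ, parity_annih, map_sub, map_smul, map_mul, map_star]

lemma parity_jwString (j : ℤ) : parity (jwString j) = jwString j := by
  unfold jwString
  split_ifs <;> simp [map_list_prod, Function.comp_def, parity_sigmaZ]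

lemma parity_sigmaX (j : ℤ) : parity (sigmaX j) = -sigmaX j := by
  simp only [sigmaX, map_mul, map_add, map_star, parity_T, parity_jwString, parity_annih, star_neg]
  rw [← neg_add, mul_neg]

lemma parity_sigmaY (j : ℤ) : parity (sigmaY j) = -sigmaY j := by
  simp only [sigmaY, map_smul, map_mul, map_sub, map_star, parity_T, parity_jwString,
    parity_annih, star_neg]
  rw [← smul_neg, ← mul_neg, neg_sub']

/-- The even part `Q_+ = (Q + Θ(Q)) / 2`. -/
def evenPart (Q : Op) : Op := (2⁻¹ : ℂ) • (Q + parity Q)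

/-- The odd part `Q_- = (Q - Θ(Q)) / 2`. -/
def oddPart (Q : Op) : Op := (2⁻¹ : ℂ) • (Q - parity Q)

lemma parity_continuous : Continuous parity := Ad_continuous _

lemma T_mul_T : (tU : Op) * tU = 1 := by
  refine op_ext fun f S => ?_
  simp [tU, ← mul_assoc, ← mul_pow]

lemma star_T : star (tU : Op) = tU := by
  have h : star (tU : Op) * tU = 1 := by simp
  calc star (tU : Op) = star (tU : Op) * (tU * tU) := by rw [T_mul_T, mul_one]
    _ = tU := by rw [← mul_assoc, h, one_mul]

lemma Ad_T (Q : Op) : Ad tU Q = tU * Q * tU := by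
  rw [Unitary.conjStarAlgAut_apply, star_T]

lemma even_add_odd (Q : Op) : evenPart Q + oddPart Q = Q := by
  rw [evenPart, oddPart, ← smul_add, add_add_sub_cancel, ← two_smul ℂ, smul_smul]; norm_num

/-- For a C*-algebra `B` invariant under conjugation by `T`, the C*-algebra of the `Q` with
`Q_+ ∈ B` and `T Q_- ∈ B`. -/
def mixed (B : StarSubalgebra ℂ Op) (hB : ∀ Q ∈ B, Ad tU Q ∈ B) : StarSubalgebra ℂ Op where
  carrier := {Q | evenPart Q ∈ B ∧ (tU : Op) * oddPart Q ∈ B}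
  mul_mem' := by
    rintro P Q ⟨hP1, hP2⟩ ⟨hQ1, hQ2⟩
    have e : evenPart (P * Q) = evenPart P * evenPart Q
        + Ad tU (tU * oddPart P) * (tU * oddPart Q) := by
      rw [Ad_T, show (tU : Op) * (tU * oddPart P) * tU * (tU * oddPart Q)
        = (tU * tU) * oddPart P * ((tU * tU) * oddPart Q) by noncomm_ring, T_mul_T]
      simp only [evenPart, oddPart, map_mul, one_mul, smul_mul_smul_comm]
      rw [← smul_add, add_mul, sub_mul, mul_add, mul_add, mul_sub, mul_sub]
      match_scalars <;> norm_num
    have o : (tU : Op) * oddPart (P * Q) = Ad tU (evenPart P) * (tU * oddPart Q)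
        + (tU * oddPart P) * evenPart Q := by
      rw [Ad_T, show (tU : Op) * evenPart P * tU * (tU * oddPart Q)
        = tU * evenPart P * ((tU * tU) * oddPart Q) by noncomm_ring, T_mul_T, one_mul, mul_assoc,
        mul_assoc, ← mul_add]
      congr 1
      simp only [evenPart, oddPart, map_mul, smul_mul_smul_comm]
      rw [← smul_add, add_mul, sub_mul, mul_add, mul_add, mul_sub, mul_sub]
      match_scalars <;> norm_num
    exact ⟨e ▸ add_mem (mul_mem hP1 hQ1) (mul_mem (hB _ hP2) hQ2),
      o ▸ add_mem (mul_mem (hB _ hP1) hQ2) (mul_mem hP2 hQ1)⟩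
  add_mem' := by
    rintro P Q ⟨hP1, hP2⟩ ⟨hQ1, hQ2⟩
    have e : evenPart (P + Q) = evenPart P + evenPart Q := by
      simp only [evenPart, map_add]; module
    have o : oddPart (P + Q) = oddPart P + oddPart Q := by
      simp only [oddPart, map_add]; module
    refine ⟨e ▸ add_mem hP1 hQ1, ?_⟩
    rw [o, mul_add]
    exact add_mem hP2 hQ2
  algebraMap_mem' := by
    intro a
    have h : parity (algebraMap ℂ Op a) = algebraMap ℂ Op a := by
      rw [Algebra.algebraMap_eq_smul_one, map_smul, map_one]
    have e : evenPart (algebraMap ℂ Op a) = algebraMap ℂ Op a := by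
      rw [evenPart, h]; module
    have o : oddPart (algebraMap ℂ Op a) = 0 := by
      rw [oddPart, h]; simp
    refine ⟨e.symm ▸ algebraMap_mem B a, ?_⟩
    rw [o, mul_zero]
    exact zero_mem B
  star_mem' := by
    rintro Q ⟨h1, h2⟩
    have e : evenPart (star Q) = star (evenPart Q) := by
      simp [evenPart, map_star]
    have o : (tU : Op) * oddPart (star Q) = Ad tU (star (tU * oddPart Q)) := by
      rw [Ad_T, star_mul, star_T, mul_assoc, mul_assoc, T_mul_T, mul_one]
      simp [oddPart, map_star]
    exact ⟨e ▸ star_mem h1, o ▸ hB _ (star_mem h2)⟩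

lemma mixed_isClosed (B : StarSubalgebra ℂ Op) (hB : ∀ Q ∈ B, Ad tU Q ∈ B)
    (h : IsClosed (B : Set Op)) : IsClosed (mixed B hB : Set Op) := by
  have h1 : Continuous evenPart := by
    exact (continuous_id.add parity_continuous).const_smul (2⁻¹ : ℂ)
  have h2 : Continuous fun Q => (tU : Op) * oddPart Q := by
    have h3 : Continuous oddPart :=
      (continuous_id.sub parity_continuous).const_smul (2⁻¹ : ℂ)
    exact continuous_const.mul h3
  exact (h.preimage h1).inter (h.preimage h2)

lemma even_of_parity_neg {Q : Op} (h : parity Q = -Q) : evenPart Q = 0 ∧ oddPart Q = Q := by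
  rw [evenPart, oddPart, h]
  exact ⟨by simp, by module⟩

lemma even_of_parity_eq {Q : Op} (h : parity Q = Q) : evenPart Q = Q ∧ oddPart Q = 0 := by
  rw [evenPart, oddPart, h]
  exact ⟨by module, by simp⟩

lemma parity_evenPart (Q : Op) : parity (evenPart Q) = evenPart Q := by
  have h : parity (parity Q) = Q := by
    have h2 : (parityU : Op) * parityU = 1 := by
      refine op_ext fun f S => ?_
      simp [parityU, ← mul_assoc, ← mul_pow]
    have h3 : parityU * parityU = 1 := Subtype.ext h2
    rw [parity, ← Unitary.conjStarAlgAut_mul_apply, h3, map_one]; rfl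
  rw [evenPart, map_smul, map_add, h, add_comm]

lemma Ad_T_car : ∀ Q ∈ carAlgebra, Ad tU Q ∈ carAlgebra :=
  Ad_mem carAlgebra_isClosed (by
    rintro _ ⟨j, rfl⟩; rw [Ad_tU_annih]; exact SMulMemClass.smul_mem _ (annih_mem _))

lemma sigmaZ_mem_car (j : ℤ) : sigmaZ j ∈ carAlgebra :=
  sub_mem (SMulMemClass.smul_mem _ (mul_mem (star_mem (annih_mem j)) (annih_mem j))) (one_mem _)

lemma jwString_mem {B : StarSubalgebra ℂ Op} (h : ∀ j, sigmaZ j ∈ B) (j : ℤ) :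
    jwString j ∈ B := by
  unfold jwString
  split_ifs <;> refine list_prod_mem fun x hx => ?_ <;>
    obtain ⟨k, _, rfl⟩ := List.mem_map.1 hx <;> exact h _

lemma spin_le_mixed : spinAlgebra ≤ mixed carAlgebra Ad_T_car := by
  refine StarSubalgebra.topologicalClosure_minimal (StarAlgebra.adjoin_le ?_)
    (mixed_isClosed _ _ carAlgebra_isClosed)
  have hs := jwString_mem sigmaZ_mem_car
  rintro _ ((⟨j, rfl⟩ | ⟨j, rfl⟩) | ⟨j, rfl⟩)
  · obtain ⟨h1, h2⟩ := even_of_parity_neg (parity_sigmaX j)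
    refine ⟨h1 ▸ zero_mem _, ?_⟩
    rw [h2, sigmaX, ← mul_assoc, ← mul_assoc, T_mul_T, one_mul]
    exact mul_mem (hs j) (add_mem (annih_mem j) (star_mem (annih_mem j)))
  · obtain ⟨h1, h2⟩ := even_of_parity_neg (parity_sigmaY j)
    refine ⟨h1 ▸ zero_mem _, ?_⟩
    rw [h2, sigmaY, mul_smul_comm, ← mul_assoc, ← mul_assoc, T_mul_T, one_mul]
    exact SMulMemClass.smul_mem _
      (mul_mem (hs j) (sub_mem (annih_mem j) (star_mem (annih_mem j))))
  · obtain ⟨h1, h2⟩ := even_of_parity_eq (parity_sigmaZ j)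
    refine ⟨h1.symm ▸ sigmaZ_mem_car j, ?_⟩
    rw [h2, mul_zero]
    exact zero_mem _

lemma evenPart_mem_car {Q : Op} (hQ : Q ∈ spinAlgebra) : evenPart Q ∈ carAlgebra :=
  (spin_le_mixed hQ).1

lemma tU_sigmaX (j : ℤ) :
    Ad tU (sigmaX j) = (if j ≤ 0 then (-1 : ℂ) else 1) • sigmaX j := by
  rw [Ad_eq_iff]
  refine op_ext fun f S => ?_
  simp only [smul_mul_assoc, smul_apply, lp.coeFn_smul, Pi.smul_apply, mul_apply_eq_comp,
    tU_apply, sigmaX_apply, sgn_flip, smul_eq_mul, ← Int.lt_add_one_iff, zero_add]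
  split_ifs <;> ring

lemma tU_sigmaY (j : ℤ) :
    Ad tU (sigmaY j) = (if j ≤ 0 then (-1 : ℂ) else 1) • sigmaY j := by
  rw [Ad_eq_iff]
  refine op_ext fun f S => ?_
  simp only [smul_mul_assoc, smul_apply, lp.coeFn_smul, Pi.smul_apply, mul_apply_eq_comp,
    tU_apply, sigmaY_apply, sgn_flip, smul_eq_mul, ← Int.lt_add_one_iff, zero_add]
  by_cases h : j < 1 <;> simp only [h, if_true, if_false] <;> ring

lemma tU_sigmaZ (j : ℤ) : Ad tU (sigmaZ j) = sigmaZ j := by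
  rw [Ad_eq_iff]
  refine op_ext fun f S => ?_
  simp only [mul_apply_eq_comp, tU_apply, sigmaZ_apply]
  ring

lemma Ad_T_spin : ∀ Q ∈ spinAlgebra, Ad tU Q ∈ spinAlgebra :=
  Ad_mem spinAlgebra_isClosed (by
    rintro _ ((⟨j, rfl⟩ | ⟨j, rfl⟩) | ⟨j, rfl⟩)
    · rw [tU_sigmaX]; exact SMulMemClass.smul_mem _ (sigmaX_mem _)
    · rw [tU_sigmaY]; exact SMulMemClass.smul_mem _ (sigmaY_mem _)
    · rw [tU_sigmaZ]; exact sigmaZ_mem _)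

lemma jwString_apply (j : ℤ) (f : Fock) (S : Finset ℤ) :
    jwString j f S = sgn 1 S * ((-1) ^ (j - 1) * sgn j S) * f S := by
  have h : jwString j = (tU : Op) * (tU * jwString j) := by rw [← mul_assoc, T_mul_T, one_mul]
  rw [h, mul_apply_eq_comp, tU_apply, tU_jwString_apply, ← mul_assoc]

lemma T_mul_annih (j : ℤ) : (tU : Op) * annih j =
    jwString j * ((2⁻¹ : ℂ) • (sigmaX j - Complex.I • sigmaY j)) := by
  refine op_ext fun f S => ?_
  simp only [mul_apply_eq_comp, tU_apply, jwString_apply, annih_apply, smul_apply, sub_apply,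
    lp.coeFn_smul, lp.coeFn_sub, Pi.smul_apply, Pi.sub_apply, sigmaX_apply, sigmaY_apply,
    smul_eq_mul]
  have h1 := neg_one_zpow_mul_self (j - 1)
  have h2 := Complex.I_mul_I
  by_cases h : j ∈ S
  · simp only [h, if_true]
    linear_combination (-(sgn 1 S * sgn j S * f (flipSite j S) * ((-1) ^ (j - 1)) ^ 2) * 2⁻¹) * h2
  · simp only [h, if_false]
    linear_combination (-(sgn 1 S * sgn j S * f (flipSite j S))) * h1 +
      ((sgn 1 S * sgn j S * f (flipSite j S) * ((-1) ^ (j - 1)) ^ 2) * 2⁻¹) * h2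

lemma car_le_mixed : carAlgebra ≤ mixed spinAlgebra Ad_T_spin := by
  refine StarSubalgebra.topologicalClosure_minimal (StarAlgebra.adjoin_le ?_)
    (mixed_isClosed _ _ spinAlgebra_isClosed)
  rintro _ ⟨j, rfl⟩
  obtain ⟨h1, h2⟩ := even_of_parity_neg (parity_annih j)
  refine ⟨h1 ▸ zero_mem _, ?_⟩
  rw [h2, T_mul_annih]
  exact mul_mem (jwString_mem sigmaZ_mem j) (SMulMemClass.smul_mem _
    (sub_mem (sigmaX_mem j) (SMulMemClass.smul_mem _ (sigmaY_mem j))))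

/-- The spin algebra and the CAR algebra have the same even elements. -/
theorem even_mem_iff {Q : Op} (h : parity Q = Q) : Q ∈ spinAlgebra ↔ Q ∈ carAlgebra := by
  constructor
  · intro hQ; simpa [(even_of_parity_eq h).1] using (spin_le_mixed hQ).1
  · intro hQ; simpa [(even_of_parity_eq h).1] using (car_le_mixed hQ).1

/-- The parity `Θ` of the spin algebra. -/
def spinParity : spinAlgebra →⋆ₐ[ℂ] spinAlgebra :=
  restrictAd spinAlgebra parityU (Ad_mem spinAlgebra_isClosed (by
    rintro _ ((⟨j, rfl⟩ | ⟨j, rfl⟩) | ⟨j, rfl⟩)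
    · exact (parity_sigmaX j).symm ▸ neg_mem (sigmaX_mem _)
    · exact (parity_sigmaY j).symm ▸ neg_mem (sigmaY_mem _)
    · exact (parity_sigmaZ j).symm ▸ sigmaZ_mem _))

/-- The `Θ`-invariant extension to the spin algebra of the restriction of `ψ` to the even part of
the CAR algebra: the functional `Q ↦ ψ(Q_+)`. -/
def thetaExtension (ψ : carAlgebra →ₗ[ℂ] ℂ) : spinAlgebra →ₗ[ℂ] ℂ where
  toFun Q := ψ ⟨evenPart Q, evenPart_mem_car Q.2⟩
  map_add' P Q := by
    rw [← map_add]
    congr 1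
    refine Subtype.ext ?_
    change (2⁻¹ : ℂ) • ((P + Q : Op) + parity (P + Q : Op)) =
      (2⁻¹ : ℂ) • ((P : Op) + parity P) + (2⁻¹ : ℂ) • ((Q : Op) + parity Q)
    rw [map_add]; module
  map_smul' a Q := by
    rw [← map_smul]
    congr 1
    refine Subtype.ext ?_
    change (2⁻¹ : ℂ) • ((a • (Q : Op)) + parity (a • (Q : Op))) =
      a • ((2⁻¹ : ℂ) • ((Q : Op) + parity Q))
    rw [map_smul]; module

theorem thetaExtension_parity (ψ : carAlgebra →ₗ[ℂ] ℂ) (Q : spinAlgebra) :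
    thetaExtension ψ (spinParity Q) = thetaExtension ψ Q := by
  change ψ ⟨evenPart (parity (Q : Op)), _⟩ = ψ ⟨evenPart Q, _⟩
  congr 2
  have h : parity (parity (Q : Op)) + parity Q = Q + parity Q := by
    have h1 := parity_evenPart Q
    simp only [evenPart, map_smul, map_add] at h1
    have h2 := smul_right_injective Op (show (2⁻¹ : ℂ) ≠ 0 by norm_num) h1
    rw [add_comm]; exact h2
  rw [evenPart, evenPart, add_comm, h]

theorem thetaExtension_of_even (ψ : carAlgebra →ₗ[ℂ] ℂ) (Q : carAlgebra)
    (h : parity (Q : Op) = Q) :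
    thetaExtension ψ ⟨Q, (even_mem_iff h).2 Q.2⟩ = ψ Q := by
  change ψ ⟨evenPart (Q : Op), _⟩ = ψ Q
  congr 1
  exact Subtype.ext (even_of_parity_eq h).1

/-! ### States, GNS representations and type I von Neumann algebras -/

section General

variable {A : Type} [CStarAlgebra A]

/-- A state: a normalized positive linear functional. -/
def IsState (φ : A →ₗ[ℂ] ℂ) : Prop := (∀ a, 0 ≤ φ (star a * a)) ∧ φ 1 = 1

/-- A pure state: an extreme point of the set of states. -/
def IsPureState (φ : A →ₗ[ℂ] ℂ) : Prop := φ ∈ Set.extremePoints ℝ {ω | IsState ω}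

lemma IsPureState.isState {φ : A →ₗ[ℂ] ℂ} (h : IsPureState φ) : IsState φ := h.1

attribute [local instance] CStarAlgebra.spectralOrder CStarAlgebra.spectralOrderedRing

/-- A state as a positive linear map, for the order of the C*-algebra `A` by its positive
elements. -/
def IsState.toPositive {φ : A →ₗ[ℂ] ℂ} (h : IsState φ) : A →ₚ[ℂ] ℂ :=
  PositiveLinearMap.mk₀ φ (fun a ha => by
    obtain ⟨b, rfl⟩ := CStarAlgebra.nonneg_iff_eq_star_mul_self.1 ha
    exact h.1 b)

/-- The Hilbert space of the GNS representation of a state. -/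
abbrev IsState.GNS {φ : A →ₗ[ℂ] ℂ} (h : IsState φ) : Type := h.toPositive.GNS

/-- The GNS representation of a state. -/
def IsState.gnsRep {φ : A →ₗ[ℂ] ℂ} (h : IsState φ) : A →⋆ₐ[ℂ] (h.GNS →L[ℂ] h.GNS) :=
  h.toPositive.gnsStarAlgHom

variable {K : Type} [NormedAddCommGroup K] [InnerProductSpace ℂ K] [CompleteSpace K]

/-- The von Neumann algebra generated by a *-algebra of bounded operators: its bicommutant. -/
def bicommutant (B : StarSubalgebra ℂ (K →L[ℂ] K)) : VonNeumannAlgebra K where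
  toStarSubalgebra := StarSubalgebra.centralizer ℂ
    (StarSubalgebra.centralizer ℂ (B : Set (K →L[ℂ] K)) : Set (K →L[ℂ] K))
  centralizer_centralizer' := by simp

lemma coe_bicommutant (B : StarSubalgebra ℂ (K →L[ℂ] K)) :
    (bicommutant B : Set (K →L[ℂ] K)) = (B : Set (K →L[ℂ] K)).centralizer.centralizer := by
  change ((StarSubalgebra.centralizer ℂ (StarSubalgebra.centralizer ℂ (B : Set (K →L[ℂ] K)) :
    Set (K →L[ℂ] K)) : StarSubalgebra ℂ (K →L[ℂ] K)) : Set (K →L[ℂ] K)) = _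
  rw [StarSubalgebra.coe_centralizer_centralizer, StarMemClass.star_coe_eq, Set.union_self]

/-- An abelian projection of `M`: a projection `e ∈ M` such that `e M e` is commutative. -/
def IsAbelianProjection (M : VonNeumannAlgebra K) (e : K →L[ℂ] K) : Prop :=
  e ∈ M ∧ IsStarProjection e ∧ ∀ a ∈ M, ∀ b ∈ M, Commute (e * a * e) (e * b * e)

/-- A von Neumann algebra is of type I if every nonzero central projection majorizes a nonzero
abelian projection. -/
def IsTypeI (M : VonNeumannAlgebra K) : Prop :=
  ∀ z ∈ M, z ∈ M.commutant → IsStarProjection z → z ≠ 0 →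
    ∃ e, IsAbelianProjection M e ∧ e ≠ 0 ∧ z * e = e

end General

/-- `ψ` is the Fock state: the unique state with `ψ(c_j* c_j) = 0` for all `j`. -/
def IsFockState (ψ : carAlgebra →ₗ[ℂ] ℂ) : Prop :=
  (IsState ψ ∧ ∀ j, ψ (star (c j) * c j) = 0) ∧
    ∀ ω : carAlgebra →ₗ[ℂ] ℂ, IsState ω → (∀ j, ω (star (c j) * c j) = 0) → ω = ψ

/-- `ψ` is the anti-Fock state: the unique state with `ψ(c_j c_j*) = 0` for all `j`. -/
def IsAntiFockState (ψ : carAlgebra →ₗ[ℂ] ℂ) : Prop :=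
  (IsState ψ ∧ ∀ j, ψ (c j * star (c j)) = 0) ∧
    ∀ ω : carAlgebra →ₗ[ℂ] ℂ, IsState ω → (∀ j, ω (c j * star (c j)) = 0) → ω = ψ

end FermionChain

end

open FermionChain

/-! Both parts are proved in the GNS representation of `ψ`. It is irreducible because `ψ` is pure,
and by invariance the gauge automorphisms and the translation are implemented by unitaries `U θ` and
`shift` that fix the cyclic vector `Ω`; `Γ = U π` implements the parity. `GaugeChain` collects these
data. Let `M_m` be the von Neumann algebra of the sites `j ≤ m`.

The common root of both parts is `odd_implementer_eq_zero`: no nonzero operator `W` that is odd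
under `Γ` reverses the signs of exactly the `a_j` with `j ≤ m`. It suffices to treat self-adjoint
`W`. By irreducibility `W²` is a scalar, and `U θ W (U θ)*` is a multiple of `W`; the factor squares
to one, so `W` commutes with every `U (2θ)`, in particular with `Γ`. A first consequence is that
`M_m` is a factor (`factor`): the even part of a central element commutes with all generators, and
its odd part times `Γ` is an odd implementer.

Part (i). Let `ω` be a state of the spin algebra with the same even part as `ψ`. Its values on
products of an even element with an element `T b`, `b` odd, define an operator from odd to even
vectors of the GNS space of `ψ` that intertwines even elements with their conjugates by `T`. Adding
its conjugate by `b_1 + b_1*` gives an odd implementer, so it is zero and `ω` vanishes on odd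
elements. Hence `ω` is determined by its even part (`eq_thetaExtension`), and purity of `ψ` passes
to the extension. Translation invariance holds because the two translations agree on even elements.

Part (ii). In a type I factor an abelian projection is minimal, and it yields a minimal projection
`p` of the commutant of `M_m` (`exists_minimal_com`). The gauge action on `M_m` is implemented
inside the range of `p`, which makes the compressions `p Q_q p` of the total charge projections
commute. The `a_j` of the half line shift them. Functional calculus then produces vectors orthogonal
to their images under all words of nonzero charge (`exists_charge_localized`), and from these a
charge grading `P_k` of the half line by projections of `M_m`.

Since `M_m` is a factor, a grading is unique up to a shift of the labels. The grading of `M_(m+1)`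
obtained by adding the occupation number `n` of the new site therefore agrees, up to an integer `r`,
with the translate of `P`. In the invariant vector `Ω` this says that adding `n - r` to the
half-line charge preserves its distribution. The mean of a bounded increasing function of the charge
would change unless `n` is surely `0` or surely `1` (`eq_zero_or_eq_zero_of_shift`). Translation
extends this to all sites, and normal ordering shows that such a state is unique. -/

namespace FermionChain

noncomputable section

/-! ### Projections onto closed spans -/

section SpanProj

variable {H : Type*} [NormedAddCommGroup H] [InnerProductSpace ℂ H]

lemma mem_closure_span {s : Set H} {h : H} (hh : h ∈ s) :
    h ∈ (Submodule.span ℂ s).topologicalClosure :=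
  Submodule.le_topologicalClosure _ (Submodule.subset_span hh)

lemma closure_span_le {s : Set H} {V : Submodule ℂ H} (hV : IsClosed (V : Set H))
    (h : ∀ k ∈ s, k ∈ V) : (Submodule.span ℂ s).topologicalClosure ≤ V :=
  Submodule.topologicalClosure_minimal _ (Submodule.span_le.2 h) hV

lemma isClosed_closure_span (s : Set H) :
    IsClosed ((Submodule.span ℂ s).topologicalClosure : Set H) :=
  Submodule.isClosed_topologicalClosure _

lemma map_mem_of_closure_span {s : Set H} (x : H →L[ℂ] H) {V : Submodule ℂ H}
    (hV : IsClosed (V : Set H)) (h : ∀ k ∈ s, x k ∈ V) :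
    ∀ k ∈ (Submodule.span ℂ s).topologicalClosure, x k ∈ V := by
  have := closure_span_le (s := s) (V := V.comap (x : H →ₗ[ℂ] H))
    (hV.preimage x.continuous) h
  exact fun k hk => this hk

lemma inner_eq_zero_of_closure_span {s : Set H} {h : H} (hs : ∀ k ∈ s, ⟪h, k⟫_ℂ = 0) :
    ∀ k ∈ (Submodule.span ℂ s).topologicalClosure, ⟪h, k⟫_ℂ = 0 := by
  have := closure_span_le (s := s) (V := LinearMap.ker (innerSL ℂ h : H →L[ℂ] ℂ).toLinearMap)
    (ContinuousLinearMap.isClosed_ker (innerSL ℂ h)) (by simpa using hs)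
  intro k hk
  simpa using this hk

variable [CompleteSpace H]

/-- The orthogonal projection onto the closed linear span of a set of vectors. -/
def spanProj (s : Set H) : H →L[ℂ] H := (Submodule.span ℂ s).topologicalClosure.starProjection

lemma isStarProjection_spanProj (s : Set H) : IsStarProjection (spanProj s) :=
  isStarProjection_starProjection

lemma spanProj_mem (s : Set H) (h : H) :
    spanProj s h ∈ (Submodule.span ℂ s).topologicalClosure :=
  Submodule.starProjection_apply_mem _ _

lemma spanProj_eq_self_of_mem {s : Set H} {h : H}
    (hh : h ∈ (Submodule.span ℂ s).topologicalClosure) : spanProj s h = h :=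
  Submodule.starProjection_eq_self_iff.2 hh

/-- An operator mapping `s` to the closed span of `t`, whose adjoint maps `t` to the closed span
of `s`, intertwines the projections. -/
lemma mul_spanProj {s t : Set H} {x : H →L[ℂ] H}
    (h1 : ∀ k ∈ s, x k ∈ (Submodule.span ℂ t).topologicalClosure)
    (h2 : ∀ k ∈ t, star x k ∈ (Submodule.span ℂ s).topologicalClosure) :
    x * spanProj s = spanProj t * x := by
  ext h
  refine (Submodule.eq_starProjection_of_mem_of_inner_eq_zero
    (map_mem_of_closure_span x (isClosed_closure_span t) h1 _ (spanProj_mem s h)) ?_).symm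
  refine inner_eq_zero_of_closure_span fun k hk => ?_
  change ⟪x h - x (spanProj s h), k⟫_ℂ = 0
  rw [← map_sub, ← ContinuousLinearMap.adjoint_inner_right]
  exact Submodule.starProjection_inner_eq_zero _ _ (h2 k hk)

lemma commute_spanProj {s : Set H} {x : H →L[ℂ] H}
    (h1 : ∀ k ∈ s, x k ∈ (Submodule.span ℂ s).topologicalClosure)
    (h2 : ∀ k ∈ s, star x k ∈ (Submodule.span ℂ s).topologicalClosure) :
    Commute x (spanProj s) := mul_spanProj h1 h2

lemma mul_spanProj_eq_zero {s : Set H} {x : H →L[ℂ] H} (h : ∀ k ∈ s, x k = 0) :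
    x * spanProj s = 0 := by
  ext k
  exact map_mem_of_closure_span (V := ⊥) x (by simp) (by simpa using h) _ (spanProj_mem s k)

lemma spanProj_mul_spanProj_eq_zero {s t : Set H} (h : ∀ k ∈ s, ∀ l ∈ t, ⟪k, l⟫_ℂ = 0) :
    spanProj s * spanProj t = 0 := by
  refine mul_spanProj_eq_zero fun l hl => ?_
  refine (Submodule.eq_starProjection_of_mem_of_inner_eq_zero (zero_mem _) ?_)
  refine inner_eq_zero_of_closure_span fun k hk => ?_
  rw [sub_zero, ← inner_conj_symm, h k hk l hl, map_zero]

lemma spanProj_ne_zero {s : Set H} {h : H} (hs : h ∈ s) (h0 : h ≠ 0) : spanProj s ≠ 0 := by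
  intro h1
  have := spanProj_eq_self_of_mem (mem_closure_span hs)
  rw [h1] at this
  exact h0 (by simpa using this.symm)

lemma mem_closure_span_of_spanProj_eq_one {s : Set H} (hs : spanProj s = 1) (h : H) :
    h ∈ (Submodule.span ℂ s).topologicalClosure := by
  have := spanProj_mem s h
  rwa [hs] at this

lemma eq_zero_of_spanProj_eq_zero {ι : Type*} {s : ι → Set H} (hs : spanProj (⋃ i, s i) = 1)
    {h : H} (hh : ∀ i, spanProj (s i) h = 0) : h = 0 := by
  rw [← inner_self_eq_zero (𝕜 := ℂ)]
  refine inner_eq_zero_of_closure_span (s := ⋃ i, s i) (fun k hk => ?_) h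
    (mem_closure_span_of_spanProj_eq_one hs h)
  obtain ⟨i, hi⟩ := Set.mem_iUnion.1 hk
  have h1 : spanProj (s i) k = k := spanProj_eq_self_of_mem (mem_closure_span hi)
  rw [← h1, ← (isStarProjection_spanProj (s i)).isSelfAdjoint.star_eq,
    ContinuousLinearMap.star_eq_adjoint, ContinuousLinearMap.adjoint_inner_right, hh,
    inner_zero_left]

end SpanProj

/-! ### Irreducible systems of fermions with gauge and translation symmetry -/

/-- An irreducible representation of the canonical anticommutation relations over `ℤ` with
unitaries implementing the gauge transformations and the translation, and an invariant vector. -/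
structure GaugeChain (H : Type*) [NormedAddCommGroup H] [InnerProductSpace ℂ H]
    [CompleteSpace H] where
  /-- The annihilation operators. -/
  a : ℤ → H →L[ℂ] H
  anti : ∀ j k, a j * a k + a k * a j = 0
  anti_star : ∀ j k, a j * star (a k) + star (a k) * a j = if j = k then 1 else 0
  /-- The gauge unitaries. -/
  U : ℝ → unitary (H →L[ℂ] H)
  U_mul_a : ∀ θ j, (U θ : H →L[ℂ] H) * a j
    = Complex.exp (-(θ * Complex.I)) • (a j * (U θ : H →L[ℂ] H))
  /-- The translation unitary. -/
  shift : unitary (H →L[ℂ] H)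
  shift_mul_a : ∀ j, (shift : H →L[ℂ] H) * a j = a (j + 1) * (shift : H →L[ℂ] H)
  /-- The invariant vector. -/
  Ω : H
  norm_Ω : ‖Ω‖ = 1
  U_Ω : ∀ θ, (U θ : H →L[ℂ] H) Ω = Ω
  shift_Ω : (shift : H →L[ℂ] H) Ω = Ω
  irreducible : ∀ x : H →L[ℂ] H, (∀ j, Commute x (a j)) → (∀ j, Commute x (star (a j))) →
    ∃ s : ℂ, x = s • 1

namespace GaugeChain

variable {H : Type*} [NormedAddCommGroup H] [InnerProductSpace ℂ H] [CompleteSpace H]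
  (G : GaugeChain H)

lemma Ω_ne_zero : G.Ω ≠ 0 := by
  intro h
  have := G.norm_Ω
  simp [h] at this

lemma U_mul_star_U (θ : ℝ) : (G.U θ : H →L[ℂ] H) * star (G.U θ : H →L[ℂ] H) = 1 :=
  Unitary.mul_star_self_of_mem (G.U θ).2

lemma star_U_mul_U (θ : ℝ) : star (G.U θ : H →L[ℂ] H) * (G.U θ : H →L[ℂ] H) = 1 :=
  Unitary.star_mul_self_of_mem (G.U θ).2

lemma U_mul_star_a (θ : ℝ) (j : ℤ) : (G.U θ : H →L[ℂ] H) * star (G.a j)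
    = Complex.exp (θ * Complex.I) • (star (G.a j) * (G.U θ : H →L[ℂ] H)) := by
  have h := congrArg (fun x => (G.U θ : H →L[ℂ] H) * star x * (G.U θ : H →L[ℂ] H)) (G.U_mul_a θ j)
  simp only [star_mul, star_smul, mul_smul_comm, smul_mul_assoc] at h
  have e : star (Complex.exp (-(θ * Complex.I))) = Complex.exp (θ * Complex.I) := by
    rw [Complex.star_def, ← Complex.exp_conj]; simp
  rw [e, ← mul_assoc, ← mul_assoc] at h
  simp only [mul_assoc, G.star_U_mul_U, mul_one] at h
  rw [h, ← mul_assoc (G.U θ : H →L[ℂ] H), G.U_mul_star_U, one_mul]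

/-- The parity operator. -/
def Γ : H →L[ℂ] H := (G.U Real.pi : H →L[ℂ] H)

lemma Γ_mul_a (j : ℤ) : G.Γ * G.a j = -(G.a j * G.Γ) := by
  have := G.U_mul_a Real.pi j
  rwa [Complex.exp_neg, Complex.exp_pi_mul_I, inv_neg, inv_one, neg_one_smul] at this

lemma Γ_mul_star_a (j : ℤ) : G.Γ * star (G.a j) = -(star (G.a j) * G.Γ) := by
  have := G.U_mul_star_a Real.pi j
  rwa [Complex.exp_pi_mul_I, neg_one_smul] at this

lemma eq_one_of_commute {x : H →L[ℂ] H} (h1 : ∀ j, Commute x (G.a j))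
    (h2 : ∀ j, Commute x (star (G.a j))) (h3 : x G.Ω = G.Ω) : x = 1 := by
  obtain ⟨s, rfl⟩ := G.irreducible x h1 h2
  have : (s - 1) • G.Ω = 0 := by
    rw [sub_smul, one_smul, sub_eq_zero]
    simpa using h3
  rcases smul_eq_zero.1 this with h | h
  · rw [sub_eq_zero.1 h, one_smul]
  · exact absurd h G.Ω_ne_zero

lemma star_U_mul_a (θ : ℝ) (j : ℤ) : star (G.U θ : H →L[ℂ] H) * G.a j
    = Complex.exp (θ * Complex.I) • (G.a j * star (G.U θ : H →L[ℂ] H)) := by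
  have h := congrArg star (G.U_mul_star_a θ j)
  have e : star (Complex.exp (θ * Complex.I)) = Complex.exp (-(θ * Complex.I)) := by
    rw [Complex.star_def, ← Complex.exp_conj]; simp
  rw [star_smul, star_mul, star_mul, star_star, e] at h
  rw [h, smul_smul, ← Complex.exp_add]; simp

lemma star_U_mul_star_a (θ : ℝ) (j : ℤ) : star (G.U θ : H →L[ℂ] H) * star (G.a j)
    = Complex.exp (-(θ * Complex.I)) • (star (G.a j) * star (G.U θ : H →L[ℂ] H)) := by
  have h := congrArg star (G.U_mul_a θ j)
  have e : star (Complex.exp (-(θ * Complex.I))) = Complex.exp (θ * Complex.I) := by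
    rw [Complex.star_def, ← Complex.exp_conj]; simp
  rw [star_smul, star_mul, star_mul, e] at h
  rw [h, smul_smul, ← Complex.exp_add]; simp

lemma star_U_Ω (θ : ℝ) : star (G.U θ : H →L[ℂ] H) G.Ω = G.Ω := by
  conv_lhs => rw [← G.U_Ω θ]
  exact congrArg (fun x : H →L[ℂ] H => x G.Ω) (G.star_U_mul_U θ)

/-- The unitaries are given for each angle separately, without a group law. The law follows because
`U (θ + η)* U θ U η` commutes with all generators and fixes `Ω`, and irreducibility then leaves only
the identity. No continuity in the angle enters. -/
lemma U_add (θ η : ℝ) : (G.U (θ + η) : H →L[ℂ] H) = G.U θ * G.U η := by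
  have h : star (G.U (θ + η) : H →L[ℂ] H) * (G.U θ * G.U η) = 1 := by
    refine G.eq_one_of_commute (fun j => ?_) (fun j => ?_) ?_
    · rw [commute_iff_eq, mul_assoc, mul_assoc (G.U θ : H →L[ℂ] H), G.U_mul_a, mul_smul_comm,
        ← mul_assoc (G.U θ : H →L[ℂ] H), G.U_mul_a, mul_smul_comm, smul_mul_assoc,
        mul_smul_comm, mul_assoc (G.a j) (G.U θ : H →L[ℂ] H), ← mul_assoc _ (G.a j),
        G.star_U_mul_a]
      simp only [smul_mul_assoc, smul_smul, ← Complex.exp_add, mul_assoc]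
      push_cast
      ring_nf
      simp
    · rw [commute_iff_eq, mul_assoc, mul_assoc (G.U θ : H →L[ℂ] H), G.U_mul_star_a, mul_smul_comm,
        ← mul_assoc (G.U θ : H →L[ℂ] H), G.U_mul_star_a, mul_smul_comm, smul_mul_assoc,
        mul_smul_comm, mul_assoc (star (G.a j)) (G.U θ : H →L[ℂ] H), ← mul_assoc _ (star (G.a j)),
        G.star_U_mul_star_a]
      simp only [smul_mul_assoc, smul_smul, ← Complex.exp_add, mul_assoc]
      push_cast
      ring_nf
      simp
    · simp [G.U_Ω, G.star_U_Ω]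
  have h2 := congrArg (fun x => (G.U (θ + η) : H →L[ℂ] H) * x) h
  simp only [← mul_assoc, G.U_mul_star_U, one_mul, mul_one] at h2
  exact h2.symm

lemma U_two_pi : (G.U (2 * Real.pi) : H →L[ℂ] H) = 1 := by
  have e : Complex.exp (((2 * Real.pi : ℝ) : ℂ) * Complex.I) = 1 := by
    push_cast; exact Complex.exp_two_pi_mul_I
  refine G.eq_one_of_commute (fun j => ?_) (fun j => ?_) (G.U_Ω _)
  · rw [commute_iff_eq, G.U_mul_a, Complex.exp_neg, e, inv_one, one_smul]
  · rw [commute_iff_eq, G.U_mul_star_a, e, one_smul]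

lemma Γ_mul_Γ : G.Γ * G.Γ = 1 := by
  rw [Γ, ← G.U_add, ← two_mul, G.U_two_pi]

lemma star_Γ : star G.Γ = G.Γ := by
  have h : star G.Γ * G.Γ = 1 := Unitary.coe_star_mul_self _
  calc star G.Γ = star G.Γ * (G.Γ * G.Γ) := by rw [G.Γ_mul_Γ, mul_one]
    _ = G.Γ := by rw [← mul_assoc, h, one_mul]

/-! ### Half-line algebras -/

/-- The operators `a_j`, `a_j*` with `j ≤ m`. -/
def gens (m : ℤ) : Set (H →L[ℂ] H) := {x | ∃ j ≤ m, x = G.a j ∨ x = star (G.a j)}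

/-- The commutant of the algebra of the half line `j ≤ m`. -/
def com (m : ℤ) : Set (H →L[ℂ] H) := Set.centralizer (G.gens m)

/-- The von Neumann algebra of the half line `j ≤ m`. -/
def bicom (m : ℤ) : Set (H →L[ℂ] H) := Set.centralizer (G.com m)

variable {G} {m : ℤ}

lemma a_mem_gens {j : ℤ} (h : j ≤ m) : G.a j ∈ G.gens m := ⟨j, h, Or.inl rfl⟩
lemma star_a_mem_gens {j : ℤ} (h : j ≤ m) : star (G.a j) ∈ G.gens m := ⟨j, h, Or.inr rfl⟩

lemma star_mem_gens {x : H →L[ℂ] H} (hx : x ∈ G.gens m) : star x ∈ G.gens m := by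
  obtain ⟨j, hj, rfl | rfl⟩ := hx
  · exact star_a_mem_gens hj
  · rw [star_star]; exact a_mem_gens hj

lemma mem_com {x : H →L[ℂ] H} (h1 : ∀ j ≤ m, G.a j * x = x * G.a j)
    (h2 : ∀ j ≤ m, star (G.a j) * x = x * star (G.a j)) : x ∈ G.com m := by
  rintro _ ⟨j, hj, rfl | rfl⟩
  exacts [h1 j hj, h2 j hj]

lemma star_mem_com {x : H →L[ℂ] H} (hx : x ∈ G.com m) : star x ∈ G.com m := by
  intro g hg
  have := congrArg star (hx _ (star_mem_gens hg))
  simpa using this.symm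

lemma star_mem_bicom {x : H →L[ℂ] H} (hx : x ∈ G.bicom m) : star x ∈ G.bicom m := by
  intro g hg
  have := congrArg star (hx _ (star_mem_com hg))
  simpa using this.symm

lemma mul_mem_com {x y : H →L[ℂ] H} (hx : x ∈ G.com m) (hy : y ∈ G.com m) : x * y ∈ G.com m :=
  Set.mul_mem_centralizer hx hy

lemma mul_mem_bicom {x y : H →L[ℂ] H} (hx : x ∈ G.bicom m) (hy : y ∈ G.bicom m) :
    x * y ∈ G.bicom m := Set.mul_mem_centralizer hx hy

lemma add_mem_bicom {x y : H →L[ℂ] H} (hx : x ∈ G.bicom m) (hy : y ∈ G.bicom m) :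
    x + y ∈ G.bicom m := Set.add_mem_centralizer hx hy

lemma smul_mem_bicom {x : H →L[ℂ] H} (s : ℂ) (hx : x ∈ G.bicom m) : s • x ∈ G.bicom m := by
  intro g hg
  rw [mul_smul_comm, hx g hg, smul_mul_assoc]

lemma sub_mem_bicom {x y : H →L[ℂ] H} (hx : x ∈ G.bicom m) (hy : y ∈ G.bicom m) :
    x - y ∈ G.bicom m := by
  rw [sub_eq_add_neg, ← neg_one_smul ℂ y]
  exact add_mem_bicom hx (smul_mem_bicom _ hy)

lemma one_mem_com : (1 : H →L[ℂ] H) ∈ G.com m := Set.one_mem_centralizer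
lemma one_mem_bicom : (1 : H →L[ℂ] H) ∈ G.bicom m := Set.one_mem_centralizer

lemma gens_subset_bicom : G.gens m ⊆ G.bicom m := Set.subset_centralizer_centralizer

lemma bicom_mono {m n : ℤ} (h : m ≤ n) : G.bicom m ⊆ G.bicom n := by
  refine Set.centralizer_subset (Set.centralizer_subset ?_)
  rintro _ ⟨j, hj, h'⟩
  exact ⟨j, hj.trans h, h'⟩

lemma commute_of_mem {x y : H →L[ℂ] H} (hx : x ∈ G.bicom m) (hy : y ∈ G.com m) : x * y = y * x :=
  (hx y hy).symm

/-! ### There is no odd operator implementing the parity of a half line -/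

/-- Two operators that reverse the signs of the same `a_j` have a product commuting with everything.
So `W²` is a scalar and `U θ W (U θ)*` is a multiple of `W`. The factor squares to one, so it
disappears when the angle is doubled, and the parity belongs to a doubled angle. -/
lemma odd_implementer_selfAdjoint_eq_zero {W : H →L[ℂ] H} (hs : star W = W)
    (h1 : ∀ j, W * G.a j = (if j ≤ m then (-1 : ℂ) else 1) • (G.a j * W))
    (h2 : ∀ j, W * star (G.a j) = (if j ≤ m then (-1 : ℂ) else 1) • (star (G.a j) * W))
    (hΓ : G.Γ * W = -(W * G.Γ)) : W = 0 := by
  have sq : ∀ j, (if j ≤ m then (-1 : ℂ) else 1) * (if j ≤ m then (-1 : ℂ) else 1) = 1 := by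
    intro j; split_ifs <;> norm_num
  have key : ∀ X : H →L[ℂ] H,
      (∀ j, X * G.a j = (if j ≤ m then (-1 : ℂ) else 1) • (G.a j * X)) →
      (∀ j, X * star (G.a j) = (if j ≤ m then (-1 : ℂ) else 1) • (star (G.a j) * X)) →
      ∃ s : ℂ, X * W = s • 1 := by
    intro X hX1 hX2
    refine G.irreducible _ (fun j => ?_) (fun j => ?_)
    · rw [commute_iff_eq, mul_assoc, h1, mul_smul_comm, ← mul_assoc, hX1, smul_mul_assoc, smul_smul,
        sq, one_smul, mul_assoc]
    · rw [commute_iff_eq, mul_assoc, h2, mul_smul_comm, ← mul_assoc, hX2, smul_mul_assoc, smul_smul,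
        sq, one_smul, mul_assoc]
  obtain ⟨s, hW⟩ := key W h1 h2
  by_cases hs0 : s = 0
  · rw [hs0, zero_smul] at hW
    have : star W * W = 0 := by rw [hs, hW]
    exact CStarRing.star_mul_self_eq_zero_iff W |>.1 this
  have hconj : ∀ θ : ℝ, ∃ t : ℂ, (G.U θ : H →L[ℂ] H) * W = t • (W * G.U θ) := by
    intro θ
    obtain ⟨t, ht⟩ := key ((G.U θ : H →L[ℂ] H) * W * star (G.U θ : H →L[ℂ] H))
      (fun j => by
        rw [mul_assoc, G.star_U_mul_a, mul_smul_comm, mul_assoc (G.U θ : H →L[ℂ] H),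
          ← mul_assoc W, h1, smul_mul_assoc, mul_smul_comm, mul_assoc (G.a j),
          ← mul_assoc _ (G.a j), G.U_mul_a, smul_mul_assoc, smul_comm, smul_smul (Complex.exp _),
          ← Complex.exp_add]
        simp [mul_assoc])
      (fun j => by
        rw [mul_assoc, G.star_U_mul_star_a, mul_smul_comm, mul_assoc (G.U θ : H →L[ℂ] H),
          ← mul_assoc W, h2, smul_mul_assoc, mul_smul_comm, mul_assoc (star (G.a j)),
          ← mul_assoc _ (star (G.a j)), G.U_mul_star_a, smul_mul_assoc, smul_comm,
          smul_smul (Complex.exp _), ← Complex.exp_add]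
        simp [mul_assoc])
    refine ⟨s⁻¹ * t, ?_⟩
    have h3 := congrArg (fun X => X * (W * (G.U θ : H →L[ℂ] H))) ht
    simp only [smul_mul_assoc, one_mul] at h3
    rw [mul_assoc, ← mul_assoc W W, hW, smul_mul_assoc, one_mul, mul_smul_comm, mul_assoc,
      G.star_U_mul_U, mul_one] at h3
    rw [← smul_smul, ← h3, smul_smul, inv_mul_cancel₀ hs0, one_smul]
  have hhalf : ∀ θ : ℝ, (G.U (θ + θ) : H →L[ℂ] H) * W = W * G.U (θ + θ) := by
    intro θ
    obtain ⟨t, ht⟩ := hconj θ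
    by_cases hW0 : W = 0
    · simp [hW0]
    have h4 : (G.U θ : H →L[ℂ] H) * (W * W) = (t * t) • ((W * W) * G.U θ) := by
      rw [← mul_assoc, ht, smul_mul_assoc, mul_assoc, ht, mul_smul_comm, smul_smul, mul_assoc]
    -- `W * W` is the nonzero scalar `s`, so the factor can be read off at `Ω`, which `U θ` fixes.
    have ht2 : t * t = 1 := by
      rw [hW, mul_smul_comm, mul_one, smul_mul_assoc, one_mul, smul_smul] at h4
      have h5 := congrArg (fun X : H →L[ℂ] H => X G.Ω) h4
      simp only [smul_apply, G.U_Ω] at h5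
      have h6 := smul_left_injective ℂ G.Ω_ne_zero h5
      field_simp at h6
      rw [← pow_two]; exact h6.symm
    rw [G.U_add, mul_assoc, ht, mul_smul_comm, ← mul_assoc, ht, smul_mul_assoc, smul_smul, ht2,
      one_smul, mul_assoc]
  -- The rotation by `π / 2` is a square root of the parity: more gauge symmetry than `Θ` alone is
  -- needed here.
  have h7 := hhalf (Real.pi / 2)
  rw [add_halves] at h7
  change G.Γ * W = W * G.Γ at h7
  rw [hΓ, neg_eq_iff_add_eq_zero, ← two_smul ℂ, smul_eq_zero] at h7
  have h8 : W * G.Γ = 0 := h7.resolve_left (by norm_num)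
  rw [← mul_one W, ← G.Γ_mul_Γ, ← mul_assoc, h8, zero_mul]

/-- An odd operator implementing the parity of a half line vanishes. -/
theorem odd_implementer_eq_zero {W : H →L[ℂ] H}
    (h1 : ∀ j, W * G.a j = (if j ≤ m then (-1 : ℂ) else 1) • (G.a j * W))
    (h2 : ∀ j, W * star (G.a j) = (if j ≤ m then (-1 : ℂ) else 1) • (star (G.a j) * W))
    (hΓ : G.Γ * W = -(W * G.Γ)) : W = 0 := by
  have sq : ∀ j, (if j ≤ m then (-1 : ℂ) else 1) * (if j ≤ m then (-1 : ℂ) else 1) = 1 := by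
    intro j; split_ifs <;> norm_num
  have sr : ∀ j, star (if j ≤ m then (-1 : ℂ) else 1) = (if j ≤ m then (-1 : ℂ) else 1) := by
    intro j; split_ifs <;> simp
  have g1 : ∀ j, star W * G.a j = (if j ≤ m then (-1 : ℂ) else 1) • (G.a j * star W) := by
    intro j
    have := congrArg star (h2 j)
    rw [star_smul, sr, star_mul, star_mul, star_star] at this
    rw [this, smul_smul, sq, one_smul]
  have g2 : ∀ j, star W * star (G.a j)
      = (if j ≤ m then (-1 : ℂ) else 1) • (star (G.a j) * star W) := by
    intro j
    have := congrArg star (h1 j)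
    rw [star_smul, sr, star_mul, star_mul] at this
    rw [this, smul_smul, sq, one_smul]
  have g3 : G.Γ * star W = -(star W * G.Γ) := by
    have := congrArg star hΓ
    rw [star_neg, star_mul, star_mul, G.star_Γ] at this
    rw [this, neg_neg]
  -- The relations have real coefficients, so the real and imaginary parts of `W` satisfy them too.
  have e1 : W + star W = 0 := by
    refine odd_implementer_selfAdjoint_eq_zero (G := G) (m := m) (by simp [add_comm])
      (fun j => ?_) (fun j => ?_) ?_
    · rw [add_mul, h1, g1, mul_add, smul_add]
    · rw [add_mul, h2, g2, mul_add, smul_add]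
    · rw [mul_add, hΓ, g3, add_mul, neg_add]
  have e2 : Complex.I • (W - star W) = 0 := by
    refine odd_implementer_selfAdjoint_eq_zero (G := G) (m := m) ?_ (fun j => ?_) (fun j => ?_) ?_
    · rw [star_smul, star_sub, star_star, Complex.star_def, Complex.conj_I, neg_smul, ← smul_neg,
        neg_sub]
    · rw [smul_mul_assoc, sub_mul, h1, g1, mul_smul_comm, mul_sub, ← smul_sub, smul_comm]
    · rw [smul_mul_assoc, sub_mul, h2, g2, mul_smul_comm, mul_sub, ← smul_sub, smul_comm]
    · rw [mul_smul_comm, mul_sub, hΓ, g3, smul_mul_assoc, sub_mul, ← smul_neg]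
      congr 1; abel
  have e3 : W - star W = 0 := (smul_eq_zero.1 e2).resolve_left Complex.I_ne_zero
  have : (2 : ℂ) • W = (W + star W) + (W - star W) := by module
  rw [e1, e3, add_zero] at this
  exact (smul_eq_zero.1 this).resolve_left (by norm_num)

end GaugeChain

end

end FermionChain

namespace FermionChain

noncomputable section

namespace GaugeChain

variable {H : Type*} [NormedAddCommGroup H] [InnerProductSpace ℂ H] [CompleteSpace H]
  {G : GaugeChain H} {m : ℤ}

/-! ### Half-line von Neumann algebras are factors -/

lemma Γ_mul_gen {g : H →L[ℂ] H} (hg : g ∈ G.gens m) : G.Γ * g = -(g * G.Γ) := by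
  obtain ⟨j, _, rfl | rfl⟩ := hg
  exacts [G.Γ_mul_a j, G.Γ_mul_star_a j]

lemma Γ_Γ_mul (x : H →L[ℂ] H) : G.Γ * (G.Γ * x) = x := by
  rw [← mul_assoc, G.Γ_mul_Γ, one_mul]

lemma gen_mul_Γ {g : H →L[ℂ] H} (hg : g ∈ G.gens m) : g * G.Γ = -(G.Γ * g) := by
  rw [Γ_mul_gen hg, neg_neg]

lemma conj_Γ_mem_com {y : H →L[ℂ] H} (hy : y ∈ G.com m) : G.Γ * y * G.Γ ∈ G.com m := by
  intro g hg
  rw [mul_assoc, ← mul_assoc g, gen_mul_Γ hg, neg_mul, mul_assoc, ← mul_assoc g, hy g hg,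
    mul_assoc, gen_mul_Γ hg]
  simp only [mul_neg, neg_neg, mul_assoc]

lemma conj_Γ_mem_bicom {x : H →L[ℂ] H} (hx : x ∈ G.bicom m) : G.Γ * x * G.Γ ∈ G.bicom m := by
  intro y hy
  have h := hx _ (conj_Γ_mem_com hy)
  have h2 := congrArg (fun z => G.Γ * z * G.Γ) h
  simp only [mul_assoc, Γ_Γ_mul, G.Γ_mul_Γ, mul_one] at h2
  simpa only [mul_assoc] using h2

lemma a_mul_gen {j : ℤ} (hj : m < j) {g : H →L[ℂ] H} (hg : g ∈ G.gens m) :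
    G.a j * g = -(g * G.a j) := by
  obtain ⟨k, hk, rfl | rfl⟩ := hg
  · exact eq_neg_of_add_eq_zero_left (G.anti j k)
  · have := G.anti_star j k
    rw [if_neg (by omega)] at this
    exact eq_neg_of_add_eq_zero_left this

lemma star_a_mul_gen {j : ℤ} (hj : m < j) {g : H →L[ℂ] H} (hg : g ∈ G.gens m) :
    star (G.a j) * g = -(g * star (G.a j)) := by
  have := congrArg star (a_mul_gen hj (star_mem_gens hg))
  rw [star_neg, star_mul, star_mul, star_star] at this
  rw [this, neg_neg]

/-- The sites beyond `m` anticommute with the half line; multiplication by the parity turns this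
into commutation. -/
lemma Γ_mul_a_mem_com {j : ℤ} (hj : m < j) : G.Γ * G.a j ∈ G.com m := by
  intro g hg
  rw [mul_assoc, a_mul_gen hj hg, ← mul_assoc, gen_mul_Γ hg, neg_mul, mul_neg, mul_assoc]

lemma Γ_mul_star_a_mem_com {j : ℤ} (hj : m < j) : G.Γ * star (G.a j) ∈ G.com m := by
  intro g hg
  rw [mul_assoc, star_a_mul_gen hj hg, ← mul_assoc, gen_mul_Γ hg, neg_mul, mul_neg, mul_assoc]

lemma commute_of_even {x y : H →L[ℂ] H} (hx : x * (G.Γ * y) = (G.Γ * y) * x)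
    (hΓ : G.Γ * x = x * G.Γ) : x * y = y * x := by
  rw [← mul_assoc, ← hΓ, mul_assoc, mul_assoc] at hx
  have := congrArg (fun z => G.Γ * z) hx
  simpa only [Γ_Γ_mul] using this

/-- Even elements of the algebra of a half line commute with the `a_j` of the complement. -/
lemma commute_a_of_even {x : H →L[ℂ] H} (hx : x ∈ G.bicom m) (hΓ : G.Γ * x = x * G.Γ) {j : ℤ}
    (hj : m < j) : x * G.a j = G.a j * x :=
  commute_of_even (commute_of_mem hx (Γ_mul_a_mem_com hj)) hΓ

lemma commute_star_a_of_even {x : H →L[ℂ] H} (hx : x ∈ G.bicom m) (hΓ : G.Γ * x = x * G.Γ) {j : ℤ}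
    (hj : m < j) : x * star (G.a j) = star (G.a j) * x :=
  commute_of_even (commute_of_mem hx (Γ_mul_star_a_mem_com hj)) hΓ

lemma com_add {x y : H →L[ℂ] H} (hx : x ∈ G.com m) (hy : y ∈ G.com m) : x + y ∈ G.com m :=
  Set.add_mem_centralizer hx hy

lemma smul_mem_com {x : H →L[ℂ] H} (s : ℂ) (hx : x ∈ G.com m) : s • x ∈ G.com m := by
  intro g hg
  rw [mul_smul_comm, hx g hg, smul_mul_assoc]

lemma sub_mem_com {x y : H →L[ℂ] H} (hx : x ∈ G.com m) (hy : y ∈ G.com m) : x - y ∈ G.com m := by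
  rw [sub_eq_add_neg, ← neg_one_smul ℂ y]
  exact com_add hx (smul_mem_com _ hy)

/-- The von Neumann algebra of a half line is a factor. -/
theorem factor {x : H →L[ℂ] H} (h1 : x ∈ G.com m) (h2 : x ∈ G.bicom m) : ∃ s : ℂ, x = s • 1 := by
  have heven : G.Γ * (x + G.Γ * x * G.Γ) = (x + G.Γ * x * G.Γ) * G.Γ := by
    simp only [mul_add, add_mul, mul_assoc, Γ_Γ_mul, G.Γ_mul_Γ, mul_one]
    exact add_comm _ _
  have hodd : G.Γ * (x - G.Γ * x * G.Γ) = -((x - G.Γ * x * G.Γ) * G.Γ) := by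
    simp only [mul_sub, sub_mul, mul_assoc, Γ_Γ_mul, G.Γ_mul_Γ, mul_one]
    exact (neg_sub _ _).symm
  have b1 := add_mem_bicom h2 (conj_Γ_mem_bicom h2)
  have b2 := sub_mem_bicom h2 (conj_Γ_mem_bicom h2)
  have c1 := com_add h1 (conj_Γ_mem_com h1)
  have c2 := sub_mem_com h1 (conj_Γ_mem_com h1)
  -- The even part commutes with the half line as an element of the commutant, and with the other
  -- sites as an even element of the algebra.
  obtain ⟨s, hs⟩ : ∃ s : ℂ, x + G.Γ * x * G.Γ = s • 1 := by
    refine G.irreducible _ (fun j => ?_) (fun j => ?_)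
    · rcases le_or_gt j m with hj | hj
      · exact (c1 _ (a_mem_gens hj)).symm
      · exact commute_a_of_even b1 heven hj
    · rcases le_or_gt j m with hj | hj
      · exact (c1 _ (star_a_mem_gens hj)).symm
      · exact commute_star_a_of_even b1 heven hj
  set z := x - G.Γ * x * G.Γ with hz
  -- The odd part `z` commutes with the `a_j` of the half line and anticommutes with the others.
  -- Multiplication by `Γ` exchanges the two signs.
  have h0 : z * G.Γ = 0 := by
    refine odd_implementer_eq_zero (G := G) (m := m) (fun j => ?_) (fun j => ?_) ?_
    · split_ifs with hj
      · rw [mul_assoc, G.Γ_mul_a, mul_neg, ← mul_assoc, ← c2 _ (a_mem_gens hj), mul_assoc,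
          neg_one_smul]
      · rw [mul_assoc, commute_of_mem b2 (Γ_mul_a_mem_com (by omega)), G.Γ_mul_a, neg_mul,
          mul_assoc, hodd, mul_neg, neg_neg, one_smul]
    · split_ifs with hj
      · rw [mul_assoc, G.Γ_mul_star_a, mul_neg, ← mul_assoc, ← c2 _ (star_a_mem_gens hj),
          mul_assoc, neg_one_smul]
      · rw [mul_assoc, commute_of_mem b2 (Γ_mul_star_a_mem_com (by omega)), G.Γ_mul_star_a, neg_mul,
          mul_assoc, hodd, mul_neg, neg_neg, one_smul]
    · rw [← mul_assoc, hodd, neg_mul]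
  have h3 : z = 0 := by rw [← mul_one z, ← G.Γ_mul_Γ, ← mul_assoc, h0, zero_mul]
  refine ⟨2⁻¹ * s, ?_⟩
  rw [← smul_smul, ← hs, show x + G.Γ * x * G.Γ = (2 : ℂ) • x - z by rw [hz]; module, h3, sub_zero,
    smul_smul]
  norm_num

lemma eq_one_of_isStarProjection {p : H →L[ℂ] H} (hp : IsStarProjection p) (h0 : p ≠ 0)
    (h : ∃ s : ℂ, p = s • 1) : p = 1 := by
  obtain ⟨s, rfl⟩ := h
  have h1 : ((s * s) • 1 : H →L[ℂ] H) = s • 1 := by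
    have := hp.isIdempotentElem.eq
    rwa [smul_mul_smul_comm, one_mul] at this
  have h2 : (s * (s - 1)) • (1 : H →L[ℂ] H) = 0 := by
    rw [mul_sub, mul_one, sub_smul, h1, sub_self]
  rw [mul_smul, smul_comm, smul_eq_zero] at h2
  rcases h2 with h2 | h2
  · rw [sub_eq_zero.1 h2, one_smul]
  · exact absurd h2 h0

/-- A set of vectors whose closed span is invariant under the algebra of a half line and its
commutant is total. -/
lemma spanProj_eq_one {s : Set H} {h : H} (hs : h ∈ s) (h0 : h ≠ 0)
    (h1 : ∀ g ∈ G.gens m, ∀ k ∈ s, g k ∈ (Submodule.span ℂ s).topologicalClosure)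
    (h2 : ∀ y ∈ G.com m, ∀ k ∈ s, y k ∈ (Submodule.span ℂ s).topologicalClosure) :
    spanProj s = 1 := by
  refine eq_one_of_isStarProjection (isStarProjection_spanProj s) (spanProj_ne_zero hs h0)
    (factor (G := G) (m := m) (fun g hg => ?_) (fun y hy => ?_))
  · exact commute_spanProj (h1 g hg) (h1 _ (star_mem_gens hg))
  · exact commute_spanProj (h2 y hy) (h2 _ (star_mem_com hy))

lemma spanProj_mem_bicom {s : Set H}
    (h2 : ∀ y ∈ G.com m, ∀ k ∈ s, y k ∈ (Submodule.span ℂ s).topologicalClosure) :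
    spanProj s ∈ G.bicom m :=
  fun y hy => commute_spanProj (h2 y hy) (h2 _ (star_mem_com hy))

lemma spanProj_mem_com {s : Set H}
    (h2 : ∀ g ∈ G.gens m, ∀ k ∈ s, g k ∈ (Submodule.span ℂ s).topologicalClosure) :
    spanProj s ∈ G.com m :=
  fun g hg => commute_spanProj (h2 g hg) (h2 _ (star_mem_gens hg))

/-- The vectors `b (y k)` with `b` in the half-line algebra form a set invariant under that algebra
and, since `b y` commutes with the commutant, under the commutant too. In a factor they are total,
and `x` kills them. -/
lemma eq_zero_of_mul_mul_eq_zero {x y : H →L[ℂ] H} (hy : y ∈ G.bicom m)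
    (h : ∀ b ∈ G.bicom m, x * b * y = 0) (hy0 : y ≠ 0) : x = 0 := by
  obtain ⟨k, hk⟩ : ∃ k, y k ≠ 0 := by
    by_contra! hc
    exact hy0 (ContinuousLinearMap.ext hc)
  have := spanProj_eq_one (G := G) (m := m) (s := {v | ∃ b ∈ G.bicom m, ∃ k, v = b (y k)})
    (h := y k) ⟨1, one_mem_bicom, k, rfl⟩ hk
    (by
      rintro g hg _ ⟨b, hb, k, rfl⟩
      exact mem_closure_span ⟨g * b, mul_mem_bicom (gens_subset_bicom hg) hb, k, rfl⟩)
    (by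
      rintro z hz _ ⟨b, hb, k, rfl⟩
      refine mem_closure_span ⟨b, hb, z k, ?_⟩
      have h3 := commute_of_mem (mul_mem_bicom hb hy) hz
      exact (congrArg (fun w : H →L[ℂ] H => w k) h3).symm)
  rw [← mul_one x, ← this]
  refine mul_spanProj_eq_zero ?_
  rintro _ ⟨b, hb, k, rfl⟩
  exact congrArg (fun w : H →L[ℂ] H => w k) (h b hb)

/-! ### Abelian projections are minimal -/

lemma posPart_mem_bicom {b : H →L[ℂ] H} (hb : b ∈ G.bicom m) (hs : IsSelfAdjoint b) :
    b⁺ ∈ G.bicom m := by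
  intro y hy
  have h : Commute b y := commute_of_mem hb hy
  exact (hs.commute_cfcₙ h _).symm

lemma negPart_mem_bicom {b : H →L[ℂ] H} (hb : b ∈ G.bicom m) (hs : IsSelfAdjoint b) :
    b⁻ ∈ G.bicom m := by
  intro y hy
  have h : Commute b y := commute_of_mem hb hy
  exact (hs.commute_cfcₙ h _).symm

/-- Since `b b⁺ = b⁺ b⁺`, one has `(q b⁺)(q b⁺)* = q b b⁺ q* = 0`. -/
lemma mul_posPart_eq_zero {q b : H →L[ℂ] H} (hs : IsSelfAdjoint b) (h : q * b = 0) :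
    q * b⁺ = 0 := by
  have h1 : b * b⁺ = b⁺ * b⁺ := by
    have := congrArg (· * b⁺) (CFC.posPart_sub_negPart b hs)
    simp only [sub_mul, CFC.negPart_mul_posPart, sub_zero] at this
    exact this.symm
  have h2 : star b⁺ = b⁺ := (CFC.posPart_nonneg b).isSelfAdjoint
  rw [← CStarRing.mul_star_self_eq_zero_iff, star_mul, h2, mul_assoc, ← mul_assoc b⁺, ← h1,
    mul_assoc, ← mul_assoc, h, zero_mul]

lemma mul_negPart_eq_zero {q b : H →L[ℂ] H} (hs : IsSelfAdjoint b) (h : q * b = 0) :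
    q * b⁻ = 0 := by
  rw [← CFC.posPart_neg]
  exact mul_posPart_eq_zero hs.neg (by rw [mul_neg, h, neg_zero])

/-- Both parts of `b` lie in the corner of `e`, which is commutative. So `b⁺` passes through `e x
e`, and `b⁺ x b⁻ = (e x e) b⁺ b⁻ = 0` for every `x`; in a factor one of the two must vanish. -/
lemma posPart_eq_zero_or_negPart_eq_zero {e b : H →L[ℂ] H} (he : IsStarProjection e)
    (hab : ∀ x ∈ G.bicom m, ∀ y ∈ G.bicom m, Commute (e * x * e) (e * y * e))
    (hb : b ∈ G.bicom m) (hs : IsSelfAdjoint b) (heb : e * b = b) : b⁺ = 0 ∨ b⁻ = 0 := by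
  by_contra! hc
  have h0 : (1 - e) * b = 0 := by rw [sub_mul, heb, one_mul, sub_self]
  have h1 : e * b⁺ = b⁺ := by
    have := mul_posPart_eq_zero hs h0
    rw [sub_mul, one_mul, sub_eq_zero] at this
    exact this.symm
  have h2 : e * b⁻ = b⁻ := by
    have := mul_negPart_eq_zero hs h0
    rw [sub_mul, one_mul, sub_eq_zero] at this
    exact this.symm
  have h3 : b⁺ * e = b⁺ := by
    have := congrArg star h1
    rwa [star_mul, (CFC.posPart_nonneg b).isSelfAdjoint.star_eq, he.isSelfAdjoint.star_eq] at this
  refine hc.1 (eq_zero_of_mul_mul_eq_zero (negPart_mem_bicom hb hs) (fun x hx => ?_) hc.2)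
  have h4 := (hab _ (posPart_mem_bicom hb hs) x hx).eq
  rw [h1, h3] at h4
  calc b⁺ * x * b⁻ = b⁺ * (e * x * e) * b⁻ := by
        rw [← mul_assoc, ← mul_assoc, h3, mul_assoc (b⁺ * x), h2]
    _ = 0 := by rw [h4, mul_assoc, CFC.posPart_mul_negPart, mul_zero]

lemma re_inner_nonneg_of_negPart_eq_zero {b : H →L[ℂ] H} (hs : IsSelfAdjoint b) (h : b⁻ = 0)
    (v : H) : 0 ≤ (⟪v, b v⟫_ℂ).re := by
  have h1 : 0 ≤ b := (CFC.negPart_eq_zero_iff b hs).1 h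
  exact ((ContinuousLinearMap.nonneg_iff_isPositive b).1 h1).re_inner_nonneg_right v

/-- For each real `l` the operator `e x e - l e` has a definite sign. So no `l` can separate two
values of the quotient of the quadratic forms of `e x e` and `e`, and the value `r` found at one
vector `v` holds everywhere. -/
lemma abelian_scalar_of_selfAdjoint {e x : H →L[ℂ] H} (hem : e ∈ G.bicom m)
    (he : IsStarProjection e)
    (hab : ∀ x ∈ G.bicom m, ∀ y ∈ G.bicom m, Commute (e * x * e) (e * y * e))
    (h0 : e ≠ 0) (hx : x ∈ G.bicom m) (hs : IsSelfAdjoint x) : ∃ s : ℂ, e * x * e = s • e := by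
  have hee : e * e = e := he.isIdempotentElem.eq
  obtain ⟨v, hv⟩ : ∃ v, e v ≠ 0 := by
    by_contra! hc
    exact h0 (ContinuousLinearMap.ext hc)
  have hsa : IsSelfAdjoint (e * x * e) := by
    rw [IsSelfAdjoint, star_mul, star_mul, hs.star_eq, he.isSelfAdjoint.star_eq, mul_assoc]
  have hq : ∀ w, (⟪w, e w⟫_ℂ).re = ‖e w‖ ^ 2 := by
    intro w
    have h2 : ⟪e w, e w⟫_ℂ = ⟪w, e w⟫_ℂ := by
      rw [← ContinuousLinearMap.adjoint_inner_right, ← ContinuousLinearMap.star_eq_adjoint,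
        he.isSelfAdjoint.star_eq]
      exact congrArg (fun z : H →L[ℂ] H => ⟪w, z w⟫_ℂ) hee
    rw [← h2, inner_self_eq_norm_sq_to_K]
    norm_cast
  have hpos : 0 < ‖e v‖ ^ 2 := by positivity
  have key : ∀ l : ℝ, (∀ w, 0 ≤ (⟪w, (e * x * e) w⟫_ℂ).re - l * ‖e w‖ ^ 2) ∨
      ∀ w, (⟪w, (e * x * e) w⟫_ℂ).re - l * ‖e w‖ ^ 2 ≤ 0 := by
    intro l
    have hsb : IsSelfAdjoint (e * x * e - (l : ℂ) • e) := by
      refine hsa.sub ?_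
      rw [IsSelfAdjoint, star_smul, he.isSelfAdjoint.star_eq]; simp
    have hform : ∀ w, (⟪w, (e * x * e - (l : ℂ) • e) w⟫_ℂ).re
        = (⟪w, (e * x * e) w⟫_ℂ).re - l * ‖e w‖ ^ 2 := by
      intro w
      rw [sub_apply, inner_sub_right, Complex.sub_re, smul_apply, inner_smul_right,
        Complex.re_ofReal_mul, hq]
    rcases posPart_eq_zero_or_negPart_eq_zero he hab
      (sub_mem_bicom (mul_mem_bicom (mul_mem_bicom hem hx) hem) (smul_mem_bicom _ hem)) hsb
      (by rw [mul_sub, ← mul_assoc, ← mul_assoc, hee, mul_smul_comm, hee]) with h | h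
    · right
      intro w
      rw [← hform]
      have := re_inner_nonneg_of_negPart_eq_zero hsb.neg (by rw [CFC.negPart_neg, h]) w
      rw [neg_apply, inner_neg_right, Complex.neg_re] at this
      linarith
    · left
      intro w
      rw [← hform]
      exact re_inner_nonneg_of_negPart_eq_zero hsb h w
  set r : ℝ := (⟪v, (e * x * e) v⟫_ℂ).re / ‖e v‖ ^ 2 with hr
  have hrv : (⟪v, (e * x * e) v⟫_ℂ).re = r * ‖e v‖ ^ 2 := by rw [hr]; field_simp
  have heq : ∀ w, (⟪w, (e * x * e) w⟫_ℂ).re = r * ‖e w‖ ^ 2 := by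
    intro w
    refine le_antisymm ?_ ?_
    · refine le_of_forall_pos_le_add fun ε hε => ?_
      -- A value slightly above `r` excludes the positive sign at `v`. The denominator keeps the
      -- error at `w` below `ε`, also when `e w = 0`.
      rcases key (r + ε / (‖e w‖ ^ 2 + 1)) with h | h
      · have := h v
        have h5 : 0 < ε / (‖e w‖ ^ 2 + 1) := by positivity
        nlinarith
      · have := h w
        have h5 : ε / (‖e w‖ ^ 2 + 1) * ‖e w‖ ^ 2 ≤ ε := by
          rw [div_mul_eq_mul_div, div_le_iff₀ (by positivity)]
          nlinarith
        linarith
    · refine le_of_forall_pos_le_add fun ε hε => ?_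
      rcases key (r - ε / (‖e w‖ ^ 2 + 1)) with h | h
      · have := h w
        have h5 : ε / (‖e w‖ ^ 2 + 1) * ‖e w‖ ^ 2 ≤ ε := by
          rw [div_mul_eq_mul_div, div_le_iff₀ (by positivity)]
          nlinarith
        linarith
      · have := h v
        have h5 : 0 < ε / (‖e w‖ ^ 2 + 1) := by positivity
        nlinarith
  refine ⟨r, ?_⟩
  rw [← sub_eq_zero]
  have hsb : IsSelfAdjoint (e * x * e - (r : ℂ) • e) := by
    refine hsa.sub ?_
    rw [IsSelfAdjoint, star_smul, he.isSelfAdjoint.star_eq]; simp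
  have h6 : ∀ w, ⟪(e * x * e - (r : ℂ) • e) w, w⟫_ℂ = 0 := by
    intro w
    have hreal : (((⟪(e * x * e - (r : ℂ) • e) w, w⟫_ℂ).re : ℝ) : ℂ)
        = ⟪(e * x * e - (r : ℂ) • e) w, w⟫_ℂ := hsb.isSymmetric.coe_re_inner_apply_self w
    rw [← hreal, ← inner_conj_symm]
    rw [sub_apply, inner_sub_right, smul_apply, inner_smul_right]
    simp only [map_sub, map_mul, Complex.conj_ofReal, Complex.sub_re,
      Complex.re_ofReal_mul, Complex.conj_re, heq w, hq]
    simp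
  have h7 := (inner_map_self_eq_zero (e * x * e - (r : ℂ) • e : H →L[ℂ] H).toLinearMap).1 h6
  exact ContinuousLinearMap.coe_injective h7

/-- In a factor, an abelian projection is minimal. -/
lemma abelian_scalar {e x : H →L[ℂ] H} (hem : e ∈ G.bicom m) (he : IsStarProjection e)
    (hab : ∀ x ∈ G.bicom m, ∀ y ∈ G.bicom m, Commute (e * x * e) (e * y * e))
    (h0 : e ≠ 0) (hx : x ∈ G.bicom m) : ∃ s : ℂ, e * x * e = s • e := by
  obtain ⟨s, hs⟩ := abelian_scalar_of_selfAdjoint hem he hab h0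
    (add_mem_bicom hx (star_mem_bicom hx)) (IsSelfAdjoint.add_star_self x)
  obtain ⟨t, ht⟩ := abelian_scalar_of_selfAdjoint hem he hab h0
    (smul_mem_bicom Complex.I (sub_mem_bicom hx (star_mem_bicom hx)))
    (by
      rw [IsSelfAdjoint, star_smul, star_sub, star_star, Complex.star_def, Complex.conj_I, neg_smul,
        ← smul_neg, neg_sub])
  refine ⟨2⁻¹ * (s - Complex.I * t), ?_⟩
  have h1 : x = (2⁻¹ : ℂ) • ((x + star x) - Complex.I • (Complex.I • (x - star x))) := by
    rw [smul_smul, Complex.I_mul_I]; module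
  conv_lhs => rw [h1]
  rw [mul_smul_comm, smul_mul_assoc, mul_sub, sub_mul, hs, mul_smul_comm, smul_mul_assoc, ht]
  module

/-- If the algebra of a half line has a nonzero abelian projection, its commutant has a minimal
projection. -/
theorem exists_minimal_com {e : H →L[ℂ] H} (hem : e ∈ G.bicom m) (he : IsStarProjection e)
    (hab : ∀ x ∈ G.bicom m, ∀ y ∈ G.bicom m, Commute (e * x * e) (e * y * e)) (h0 : e ≠ 0) :
    ∃ p ∈ G.com m, IsStarProjection p ∧ p ≠ 0 ∧ ∀ y ∈ G.com m, ∃ s : ℂ, p * y * p = s • p := by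
  obtain ⟨v, hv⟩ : ∃ v, e v ≠ 0 := by
    by_contra! hc
    exact h0 (ContinuousLinearMap.ext hc)
  have hee : ∀ w, e (e w) = e w := fun w =>
    congrArg (fun z : H →L[ℂ] H => z w) he.isIdempotentElem.eq
  set ζ := e v with hζ
  have heζ : e ζ = ζ := hee v
  set S : Set H := {k | ∃ x ∈ G.bicom m, k = x ζ} with hS
  have hζS : ζ ∈ S := ⟨1, one_mem_bicom, rfl⟩
  have hpc : spanProj S ∈ G.com m := spanProj_mem_com (by
    rintro g hg _ ⟨x, hx, rfl⟩
    exact mem_closure_span ⟨g * x, mul_mem_bicom (gens_subset_bicom hg) hx, rfl⟩)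
  -- Minimality of `e` makes `e x ζ = e x e ζ` a multiple of `ζ`, so `e` maps the cyclic subspace of
  -- `ζ` to a line.
  have hline : ∀ k ∈ (Submodule.span ℂ S).topologicalClosure, e k ∈ Submodule.span ℂ {ζ} := by
    refine map_mem_of_closure_span e (Submodule.closed_of_finiteDimensional _) ?_
    rintro _ ⟨x, hx, rfl⟩
    obtain ⟨s, hs⟩ := abelian_scalar hem he hab h0 hx
    have h1 : e (x ζ) = s • ζ := by
      have := congrArg (fun z : H →L[ℂ] H => z ζ) hs
      simpa [heζ] using this
    rw [h1]
    exact Submodule.smul_mem _ _ (Submodule.mem_span_singleton_self ζ)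
  refine ⟨spanProj S, hpc, isStarProjection_spanProj S, spanProj_ne_zero hζS hv, fun y hy => ?_⟩
  -- The vector on the right lies in the cyclic subspace and is fixed by `e`, which commutes with
  -- the commutant and fixes `ζ`; so it lies on the line. On the cyclic subspace an element of the
  -- commutant is determined by its value at `ζ`.
  obtain ⟨s, hs⟩ : ∃ s : ℂ, s • ζ = spanProj S (y ζ) := by
    have h1 := hline _ (spanProj_mem S (y ζ))
    have h2 : e (spanProj S (y ζ)) = spanProj S (y ζ) := by
      have := congrArg (fun z : H →L[ℂ] H => z ζ) (commute_of_mem hem (mul_mem_com hpc hy))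
      simpa [heζ] using this
    rw [h2] at h1
    exact Submodule.mem_span_singleton.1 h1
  refine ⟨s, ?_⟩
  have h3 : (spanProj S * y - s • 1) * spanProj S = 0 := by
    refine mul_spanProj_eq_zero ?_
    rintro _ ⟨x, hx, rfl⟩
    have := congrArg (fun z : H →L[ℂ] H => z ζ) (commute_of_mem hx (mul_mem_com hpc hy))
    simp only [mul_apply_eq_comp] at this
    simp [← this, ← hs]
  rw [sub_mul, smul_mul_assoc, one_mul, sub_eq_zero] at h3
  exact h3

end GaugeChain

end

end FermionChain

namespace FermionChain

noncomputable section

/-! ### Strong limits and orthogonal families of projections. -/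

section Projections

variable {H : Type*} [NormedAddCommGroup H] [InnerProductSpace ℂ H]

/-- Multiplication respects strong convergence when the left factors are uniformly bounded. This
carries commutation relations from approximants to strong limits. -/
lemma tendsto_mul_apply {A B : ℕ → H →L[ℂ] H} {A' B' : H →L[ℂ] H} (hA : ∀ n h, ‖A n h‖ ≤ ‖h‖)
    (h1 : ∀ h, Filter.Tendsto (fun n => A n h) Filter.atTop (nhds (A' h)))
    (h2 : ∀ h, Filter.Tendsto (fun n => B n h) Filter.atTop (nhds (B' h))) (h : H) :
    Filter.Tendsto (fun n => (A n * B n) h) Filter.atTop (nhds ((A' * B') h)) := by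
  have h3 : Filter.Tendsto (fun n => A n (B n h - B' h)) Filter.atTop (nhds 0) := by
    refine squeeze_zero_norm (fun n => hA n _) ?_
    have := ((h2 h).sub_const (B' h)).norm
    simpa using this
  have h4 := h3.add (h1 (B' h))
  rw [zero_add] at h4
  refine h4.congr fun n => ?_
  rw [← map_add, sub_add_cancel]; rfl

lemma isClosed_tendsto {A : ℕ → H →L[ℂ] H} {A' : H →L[ℂ] H} (hA : ∀ n h, ‖A n h‖ ≤ ‖h‖) :
    IsClosed {h | Filter.Tendsto (fun n => A n h) Filter.atTop (nhds (A' h))} := by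
  rw [← isSeqClosed_iff_isClosed]
  intro u v hu huv
  rw [Set.mem_ofPred_eq, Metric.tendsto_atTop]
  intro ε hε
  have hv : Filter.Tendsto (fun n => ‖v - u n‖ + ‖A' (u n) - A' v‖) Filter.atTop (nhds 0) := by
    have e1 := (tendsto_const_nhds (x := v)).sub huv |>.norm
    have e2 := ((A'.continuous.tendsto v).comp huv).sub_const (A' v) |>.norm
    simpa using e1.add e2
  obtain ⟨k, hk⟩ := ((tendsto_order.1 hv).2 (ε / 2) (by positivity)).exists
  obtain ⟨N, hN⟩ := (Metric.tendsto_atTop.1 (hu k)) (ε / 2) (by positivity)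
  refine ⟨N, fun n hn => ?_⟩
  have h1 := hN n hn
  rw [dist_eq_norm] at h1 ⊢
  have e : A n v - A' v = A n (v - u k) + (A n (u k) - A' (u k)) + (A' (u k) - A' v) := by
    rw [map_sub]; abel
  calc ‖A n v - A' v‖ ≤ ‖A n (v - u k)‖ + ‖A n (u k) - A' (u k)‖ + ‖A' (u k) - A' v‖ := by
        rw [e]; exact norm_add₃_le
    _ < ε := by linarith [hA n (v - u k)]

lemma pow_mul_of_mul {x g : H →L[ℂ] H} {c : ℂ} (h : x * g = c • (g * x)) (k : ℕ) :
    x ^ k * g = c ^ k • (g * x ^ k) := by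
  induction k with
  | zero => simp
  | succ k ih =>
    rw [pow_succ, mul_assoc, h, mul_smul_comm, ← mul_assoc, ih, smul_mul_assoc, smul_smul,
      pow_succ', mul_assoc]

variable [CompleteSpace H]

lemma inner_apply_isStarProjection {p : H →L[ℂ] H} (hp : IsStarProjection p) (h : H) :
    ⟪h, p h⟫_ℂ = (‖p h‖ ^ 2 : ℝ) := by
  have h2 : ⟪p h, p h⟫_ℂ = ⟪h, p h⟫_ℂ := by
    rw [← ContinuousLinearMap.adjoint_inner_right, ← ContinuousLinearMap.star_eq_adjoint,
      hp.isSelfAdjoint.star_eq]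
    exact congrArg (fun z : H →L[ℂ] H => ⟪h, z h⟫_ℂ) hp.isIdempotentElem.eq
  rw [← h2, inner_self_eq_norm_sq_to_K]
  norm_cast

lemma norm_apply_le_of_isStarProjection {p : H →L[ℂ] H} (hp : IsStarProjection p) (h : H) :
    ‖p h‖ ≤ ‖h‖ := by
  have h1 := inner_apply_isStarProjection hp h
  have h2 : ‖p h‖ ^ 2 ≤ ‖h‖ * ‖p h‖ := by
    have := norm_inner_le_norm (𝕜 := ℂ) h (p h)
    rw [h1, Complex.norm_real, Real.norm_of_nonneg (by positivity)] at this
    exact this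
  by_contra! hc
  have := norm_nonneg h
  nlinarith

lemma isStarProjection_sum {ι : Type*} {P : ι → H →L[ℂ] H} (hP : ∀ i, IsStarProjection (P i))
    (ho : ∀ i j, i ≠ j → P i * P j = 0) (F : Finset ι) : IsStarProjection (∑ i ∈ F, P i) := by
  classical
  induction F using Finset.induction_on with
  | empty => simp
  | insert i F hi ih =>
    rw [Finset.sum_insert hi]
    refine (hP i).add ih ?_
    rw [Finset.mul_sum]
    exact Finset.sum_eq_zero fun j hj => ho i j (by rintro rfl; exact hi hj)

/-- Bessel's inequality for a family of mutually orthogonal projections. -/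
lemma sum_norm_sq_le {ι : Type*} {P : ι → H →L[ℂ] H} (hP : ∀ i, IsStarProjection (P i))
    (ho : ∀ i j, i ≠ j → P i * P j = 0) (F : Finset ι) (h : H) :
    ∑ i ∈ F, ‖P i h‖ ^ 2 ≤ ‖h‖ ^ 2 := by
  have hF := isStarProjection_sum hP ho F
  have h1 : ((∑ i ∈ F, ‖P i h‖ ^ 2 : ℝ) : ℂ) = ((‖(∑ i ∈ F, P i) h‖ ^ 2 : ℝ) : ℂ) := by
    rw [← inner_apply_isStarProjection hF, sum_apply, inner_sum]
    push_cast
    refine Finset.sum_congr rfl fun i _ => ?_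
    rw [inner_apply_isStarProjection (hP i)]
    push_cast; rfl
  rw [Complex.ofReal_inj] at h1
  rw [h1]
  exact pow_le_pow_left₀ (norm_nonneg _) (norm_apply_le_of_isStarProjection hF h) 2

lemma norm_unitary_apply (u : unitary (H →L[ℂ] H)) (h : H) : ‖(u : H →L[ℂ] H) h‖ = ‖h‖ := by
  have h1 : ⟪(u : H →L[ℂ] H) h, (u : H →L[ℂ] H) h⟫_ℂ = ⟪h, h⟫_ℂ := by
    rw [← ContinuousLinearMap.adjoint_inner_right, ← ContinuousLinearMap.star_eq_adjoint]
    exact congrArg (fun z : H →L[ℂ] H => ⟪h, z h⟫_ℂ) (Unitary.star_mul_self_of_mem u.2)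
  rw [inner_self_eq_norm_sq_to_K, inner_self_eq_norm_sq_to_K] at h1
  have h2 : ‖(u : H →L[ℂ] H) h‖ ^ 2 = ‖h‖ ^ 2 := by exact_mod_cast h1
  exact (pow_left_inj₀ (norm_nonneg _) (norm_nonneg _) (by norm_num)).1 h2

end Projections

namespace GaugeChain

variable {H : Type*} [NormedAddCommGroup H] [InnerProductSpace ℂ H] [CompleteSpace H]
  (G : GaugeChain H) {m : ℤ}

/-! ### The total charge -/

/-- The vectors of charge `q`. -/
def charged (q : ℤ) : Set H :=
  {h | ∀ θ : ℝ, (G.U θ : H →L[ℂ] H) h = Complex.exp (q * (θ * Complex.I)) • h}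

/-- The projection onto the vectors of charge `q`. -/
def chargeProj (q : ℤ) : H →L[ℂ] H := spanProj (G.charged q)

variable {G}

lemma a_charged {q : ℤ} (j : ℤ) {h : H} (hh : h ∈ G.charged q) : G.a j h ∈ G.charged (q - 1) := by
  intro θ
  have h1 := congrArg (fun z : H →L[ℂ] H => z h) (G.U_mul_a θ j)
  simp only [mul_apply_eq_comp, smul_apply, hh θ, map_smul, smul_smul, ← Complex.exp_add] at h1
  rw [h1]
  congr 2
  push_cast; ring

lemma star_a_charged {q : ℤ} (j : ℤ) {h : H} (hh : h ∈ G.charged q) :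
    star (G.a j) h ∈ G.charged (q + 1) := by
  intro θ
  have h1 := congrArg (fun z : H →L[ℂ] H => z h) (G.U_mul_star_a θ j)
  simp only [mul_apply_eq_comp, smul_apply, hh θ, map_smul, smul_smul, ← Complex.exp_add] at h1
  rw [h1]
  congr 2
  push_cast; ring

lemma Ω_charged : G.Ω ∈ G.charged 0 := by
  intro θ
  simp [G.U_Ω]

lemma inner_charged {q r : ℤ} (hqr : q ≠ r) {h k : H} (hh : h ∈ G.charged q)
    (hk : k ∈ G.charged r) : ⟪h, k⟫_ℂ = 0 := by
  have hne : ((r : ℂ) - q) ≠ 0 := by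
    rw [sub_ne_zero]; exact_mod_cast hqr.symm
  -- At this angle the phases of the two charges differ by the factor `-1`.
  set θ : ℝ := Real.pi / (r - q) with hθ
  have h1 : ⟪(G.U θ : H →L[ℂ] H) h, (G.U θ : H →L[ℂ] H) k⟫_ℂ = ⟪h, k⟫_ℂ := by
    rw [← ContinuousLinearMap.adjoint_inner_right, ← ContinuousLinearMap.star_eq_adjoint]
    exact congrArg (fun z : H →L[ℂ] H => ⟪h, z k⟫_ℂ) (G.star_U_mul_U θ)
  rw [hh θ, hk θ, inner_smul_left, inner_smul_right, ← mul_assoc, ← Complex.exp_conj,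
    ← Complex.exp_add] at h1
  have e : (starRingEnd ℂ) ((q : ℂ) * (θ * Complex.I)) + r * (θ * Complex.I)
      = Real.pi * Complex.I := by
    simp only [map_mul, map_intCast, Complex.conj_ofReal, Complex.conj_I, hθ]
    push_cast
    field_simp
    ring
  rw [e, Complex.exp_pi_mul_I, neg_one_mul, neg_eq_iff_add_eq_zero, ← two_mul] at h1
  exact (mul_eq_zero.1 h1).resolve_left (by norm_num)

lemma isStarProjection_chargeProj (q : ℤ) : IsStarProjection (G.chargeProj q) :=
  isStarProjection_spanProj _

lemma chargeProj_mul_of_ne {q r : ℤ} (h : q ≠ r) : G.chargeProj q * G.chargeProj r = 0 :=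
  spanProj_mul_spanProj_eq_zero fun _ hk _ hl => inner_charged h hk hl

lemma a_mul_chargeProj (q j : ℤ) : G.a j * G.chargeProj q = G.chargeProj (q - 1) * G.a j := by
  refine mul_spanProj (fun k hk => mem_closure_span (a_charged j hk)) (fun k hk => ?_)
  have := star_a_charged j hk
  rw [sub_add_cancel] at this
  exact mem_closure_span this

/-- The closed span is invariant under all `a_j` and `a_j*` and contains `Ω`, so irreducibility
leaves only the whole space. -/
lemma spanProj_iUnion_charged : spanProj (⋃ q, G.charged q) = 1 := by
  have e1 : ∀ j, ∀ k ∈ ⋃ q, G.charged q,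
      G.a j k ∈ (Submodule.span ℂ (⋃ q, G.charged q)).topologicalClosure := by
    intro j k hk
    obtain ⟨q, hq⟩ := Set.mem_iUnion.1 hk
    exact mem_closure_span (Set.mem_iUnion.2 ⟨_, a_charged j hq⟩)
  have e2 : ∀ j, ∀ k ∈ ⋃ q, G.charged q,
      star (G.a j) k ∈ (Submodule.span ℂ (⋃ q, G.charged q)).topologicalClosure := by
    intro j k hk
    obtain ⟨q, hq⟩ := Set.mem_iUnion.1 hk
    exact mem_closure_span (Set.mem_iUnion.2 ⟨_, star_a_charged j hq⟩)
  refine eq_one_of_isStarProjection (isStarProjection_spanProj _)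
    (spanProj_ne_zero (Set.mem_iUnion.2 ⟨0, Ω_charged⟩) G.Ω_ne_zero) (G.irreducible _ ?_ ?_)
  · exact fun j => (commute_spanProj (e1 j) (e2 j)).symm
  · exact fun j => (commute_spanProj (e2 j) (by rw [star_star]; exact e1 j)).symm

lemma eq_zero_of_chargeProj {h : H} (hh : ∀ q, G.chargeProj q h = 0) : h = 0 :=
  eq_zero_of_spanProj_eq_zero spanProj_iUnion_charged hh

variable (G) in
/-- The average of the gauge unitaries over the `n`-th roots of unity with weights selecting the
charge `q`. -/
def cyclicAverage (q : ℤ) (n : ℕ) : H →L[ℂ] H :=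
  (n : ℂ)⁻¹ • ∑ k ∈ Finset.range n, (Complex.exp (-(q * ((2 * Real.pi / n : ℝ) * Complex.I)))) ^ k •
    (G.U (2 * Real.pi / n) : H →L[ℂ] H) ^ k

lemma norm_U_pow_apply (θ : ℝ) (k : ℕ) (h : H) : ‖((G.U θ : H →L[ℂ] H) ^ k) h‖ = ‖h‖ :=
  norm_unitary_apply (G.U θ ^ k) h

lemma norm_cyclicAverage_apply_le (q : ℤ) (n : ℕ) (h : H) : ‖G.cyclicAverage q n h‖ ≤ ‖h‖ := by
  rcases Nat.eq_zero_or_pos n with rfl | hn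
  · simp [cyclicAverage]
  have hn' : (0 : ℝ) < n := by exact_mod_cast hn
  rw [cyclicAverage, smul_apply, norm_smul, sum_apply, norm_inv, Complex.norm_natCast,
    inv_mul_le_iff₀ hn']
  refine (norm_sum_le _ _).trans ?_
  have : ∀ k ∈ Finset.range n, ‖((Complex.exp (-(q * ((2 * Real.pi / n : ℝ) * Complex.I)))) ^ k •
      (G.U (2 * Real.pi / n) : H →L[ℂ] H) ^ k) h‖ = ‖h‖ := by
    intro k _
    have e : ‖Complex.exp (-(q * ((2 * Real.pi / n : ℝ) * Complex.I)))‖ = 1 := by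
      rw [show -((q : ℂ) * ((2 * Real.pi / n : ℝ) * Complex.I))
        = ((-(q * (2 * Real.pi / n)) : ℝ) : ℂ) * Complex.I by push_cast; ring]
      exact Complex.norm_exp_ofReal_mul_I _
    rw [smul_apply, norm_smul, norm_pow, e, one_pow, one_mul, norm_U_pow_apply]
  rw [Finset.sum_congr rfl this]
  simp

lemma U_pow_charged {q : ℤ} {h : H} (hh : h ∈ G.charged q) (θ : ℝ) (k : ℕ) :
    ((G.U θ : H →L[ℂ] H) ^ k) h = (Complex.exp (q * (θ * Complex.I))) ^ k • h := by
  induction k with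
  | zero => simp
  | succ k ih =>
    rw [pow_succ', mul_apply_eq_comp, ih, map_smul, hh θ, smul_smul, pow_succ]

/-- The average is already exact for finite `n`: the relative phase is an `n`-th root of unity, and
for `n > |r - q|` it equals one only if `r = q`. -/
lemma cyclicAverage_charged {q r : ℤ} {h : H} (hh : h ∈ G.charged r) {n : ℕ}
    (hn : (|r - q| : ℤ) < n) : G.cyclicAverage q n h = if r = q then h else 0 := by
  have hn0 : 0 < n := by have := abs_nonneg (r - q); omega
  have hnC : (n : ℂ) ≠ 0 := by exact_mod_cast hn0.ne'
  set z := Complex.exp ((r - q) * ((2 * Real.pi / n : ℝ) * Complex.I)) with hz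
  have e1 : G.cyclicAverage q n h = ((n : ℂ)⁻¹ * ∑ k ∈ Finset.range n, z ^ k) • h := by
    rw [cyclicAverage, smul_apply, sum_apply, mul_smul, Finset.sum_smul]
    congr 1
    refine Finset.sum_congr rfl fun k _ => ?_
    rw [smul_apply, U_pow_charged hh, smul_smul, ← mul_pow, ← Complex.exp_add, hz]
    congr 3
    ring
  rw [e1]
  split_ifs with hrq
  · have : z = 1 := by rw [hz, hrq]; simp
    rw [this]; simp [hnC]
  · have hz1 : z ≠ 1 := by
      intro h1
      rw [hz, Complex.exp_eq_one_iff] at h1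
      obtain ⟨t, ht⟩ := h1
      have h2 : ((r : ℂ) - q) = t * n := by
        have hpi : (Real.pi : ℂ) ≠ 0 := by exact_mod_cast Real.pi_ne_zero
        push_cast at ht
        field_simp at ht
        rw [ht, mul_comm]
      have h3 : r - q = t * n := by exact_mod_cast h2
      rw [h3, abs_mul] at hn
      have ht0 : t ≠ 0 := by rintro rfl; simp [sub_eq_zero, hrq] at h3
      have : 1 ≤ |t| := Int.one_le_abs ht0
      rw [Nat.abs_cast] at hn
      nlinarith
    have hzn : z ^ n = 1 := by
      rw [hz, ← Complex.exp_nat_mul, Complex.exp_eq_one_iff]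
      refine ⟨r - q, ?_⟩
      push_cast
      field_simp
    rw [geom_sum_eq hz1, hzn]; simp

/-- On each charged vector the averages are eventually constant, and they are uniformly bounded.
They are finite combinations of powers of one unitary, so their compressions can be treated
algebraically and no continuity of `U` is required. -/
lemma tendsto_cyclicAverage (q : ℤ) (h : H) :
    Filter.Tendsto (fun n => G.cyclicAverage q n h) Filter.atTop (nhds (G.chargeProj q h)) := by
  let V : Submodule ℂ H :=
    { carrier := {h | Filter.Tendsto (fun n => G.cyclicAverage q n h) Filter.atTop
        (nhds (G.chargeProj q h))}
      add_mem' := fun {x y} hx hy => by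
        simp only [Set.mem_ofPred_eq, map_add] at hx hy ⊢
        exact hx.add hy
      zero_mem' := by simp
      smul_mem' := fun s x hx => by
        simp only [Set.mem_ofPred_eq, map_smul] at hx ⊢
        exact hx.const_smul s }
  have hV : IsClosed (V : Set H) := isClosed_tendsto (norm_cyclicAverage_apply_le q)
  refine closure_span_le (s := ⋃ q, G.charged q) hV (fun k hk => ?_) 
    (mem_closure_span_of_spanProj_eq_one spanProj_iUnion_charged h)
  obtain ⟨r, hr⟩ := Set.mem_iUnion.1 hk
  have h1 : G.chargeProj q k = if r = q then k else 0 := by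
    have h2 : G.chargeProj r k = k := spanProj_eq_self_of_mem (mem_closure_span hr)
    split_ifs with hrq
    · rw [← hrq, h2]
    · rw [← h2]
      exact congrArg (fun z : H →L[ℂ] H => z k) (chargeProj_mul_of_ne (Ne.symm hrq))
  change Filter.Tendsto (fun n => G.cyclicAverage q n k) Filter.atTop (nhds (G.chargeProj q k))
  rw [h1]
  refine tendsto_const_nhds.congr' ?_
  filter_upwards [Filter.eventually_gt_atTop (|r - q|).toNat] with n hn
  rw [cyclicAverage_charged hr (by omega)]

/-! ### Compressions of the total charge to a minimal subspace -/

/-- This treats `a_j` and `a_j*` alike: later steps need only that a generator and its adjoint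
acquire conjugate phases. -/
lemma gen_phase {g : H →L[ℂ] H} (hg : g ∈ G.gens m) (θ : ℝ) : ∃ c : ℂ, conj c * c = 1 ∧
    (G.U θ : H →L[ℂ] H) * g = c • (g * (G.U θ : H →L[ℂ] H)) ∧
    (G.U θ : H →L[ℂ] H) * star g = conj c • (star g * (G.U θ : H →L[ℂ] H)) := by
  have e1 : conj (Complex.exp (θ * Complex.I)) = Complex.exp (-(θ * Complex.I)) := by
    rw [← Complex.exp_conj]; simp
  have e2 : conj (Complex.exp (-(θ * Complex.I))) = Complex.exp (θ * Complex.I) := by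
    rw [← Complex.exp_conj]; simp
  obtain ⟨j, _, rfl | rfl⟩ := hg
  · refine ⟨_, ?_, G.U_mul_a θ j, ?_⟩
    · rw [e2, ← Complex.exp_add]; simp
    · rw [e2, G.U_mul_star_a]
  · refine ⟨_, ?_, G.U_mul_star_a θ j, ?_⟩
    · rw [e1, ← Complex.exp_add]; simp
    · rw [e1, star_star, G.U_mul_a]

/-- A minimal projection of the commutant of the algebra of a half line. -/
structure IsMinimalCom (G : GaugeChain H) (m : ℤ) (p : H →L[ℂ] H) : Prop where
  mem : p ∈ G.com m
  isStarProjection : IsStarProjection p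
  ne_zero : p ≠ 0
  scalar : ∀ y ∈ G.com m, ∃ s : ℂ, p * y * p = s • p

namespace IsMinimalCom

variable {p : H →L[ℂ] H}

lemma mul_self (hp : IsMinimalCom G m p) : p * p = p := hp.isStarProjection.isIdempotentElem.eq
lemma star_eq (hp : IsMinimalCom G m p) : star p = p := hp.isStarProjection.isSelfAdjoint.star_eq

lemma exists_apply_ne_zero (hp : IsMinimalCom G m p) : ∃ v, p v ≠ 0 := by
  by_contra! hc
  exact hp.ne_zero (ContinuousLinearMap.ext hc)

/-- `T` has the form `p y U θ p` with `y` in the commutant. Some such product is nonzero: otherwise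
`p` would kill the vectors `y (U θ (p k))`, which form a set invariant under the half line and its
commutant and are therefore total. -/
lemma exists_implementer (hp : IsMinimalCom G m p) (θ : ℝ) : ∃ T : H →L[ℂ] H, T ≠ 0 ∧ p * T = T ∧ T * p = T ∧
    ∀ g ∈ G.gens m, ∀ c : ℂ, (G.U θ : H →L[ℂ] H) * g = c • (g * (G.U θ : H →L[ℂ] H)) →
      T * g = c • (g * T) := by
  have key : ∃ y ∈ G.com m, p * y * G.U θ * p ≠ 0 := by
    by_contra! hc
    obtain ⟨v, hv⟩ := hp.exists_apply_ne_zero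
    have h1 := spanProj_eq_one (G := G) (m := m)
      (s := {w | ∃ y ∈ G.com m, ∃ k, w = y ((G.U θ : H →L[ℂ] H) (p k))})
      (h := (G.U θ : H →L[ℂ] H) (p v)) ⟨1, one_mem_com, v, rfl⟩
      (by
        intro h2
        have := norm_unitary_apply (G.U θ) (p v)
        rw [h2, norm_zero] at this
        exact hv (norm_eq_zero.1 this.symm))
      (by
        rintro g hg _ ⟨y, hy, k, rfl⟩
        obtain ⟨c, hc1, hc2, _⟩ := gen_phase hg θ
        refine mem_closure_span ⟨y, hy, conj c • g k, ?_⟩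
        have e1 := congrArg (fun z : H →L[ℂ] H => z ((G.U θ : H →L[ℂ] H) (p k))) (hy g hg)
        have e2 := congrArg (fun z : H →L[ℂ] H => z (p k)) hc2
        have e3 := congrArg (fun z : H →L[ℂ] H => z k) (hp.mem g hg)
        simp only [mul_apply_eq_comp, smul_apply] at e1 e2 e3
        rw [e1, map_smul, ← e3, map_smul, e2, smul_smul, hc1, one_smul])
      (by
        rintro z hz _ ⟨y, hy, k, rfl⟩
        exact mem_closure_span ⟨z * y, mul_mem_com hz hy, k, rfl⟩)
    refine hp.ne_zero ?_
    rw [← mul_one p, ← h1]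
    refine mul_spanProj_eq_zero ?_
    rintro _ ⟨y, hy, k, rfl⟩
    exact congrArg (fun z : H →L[ℂ] H => z k) (hc y hy)
  obtain ⟨y, hy, hne⟩ := key
  refine ⟨_, hne, ?_, ?_, fun g hg c hc => ?_⟩
  · simp only [← mul_assoc, hp.mul_self]
  · rw [mul_assoc, hp.mul_self]
  · have h1 : p * y * g = g * (p * y) := (mul_mem_com hp.mem hy g hg).symm
    rw [mul_assoc, ← hp.mem g hg, ← mul_assoc, mul_assoc (p * y), hc, mul_smul_comm, smul_mul_assoc,
      ← mul_assoc (p * y), h1]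
    simp only [mul_assoc]

/-- The phases cancel in `T* T` and in `U^k p (T*)^k`, so both lie in the commutant and minimality
makes their compressions multiples of `p`. Multiplying the second by `T^k` removes `(T*)^k`. Thus
all compressed powers of `U θ` come from powers of one operator. -/
lemma compress_U_pow (hp : IsMinimalCom G m p) {θ : ℝ} {T : H →L[ℂ] H} (hT0 : T ≠ 0) (hpT : p * T = T) (hTp : T * p = T)
    (hT : ∀ g ∈ G.gens m, ∀ c : ℂ, (G.U θ : H →L[ℂ] H) * g = c • (g * (G.U θ : H →L[ℂ] H)) →
      T * g = c • (g * T)) (k : ℕ) :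
    ∃ s : ℂ, p * (G.U θ : H →L[ℂ] H) ^ k * p = s • (p * T ^ k) := by
  have hT' : ∀ g ∈ G.gens m, ∀ c : ℂ, conj c * c = 1 →
      (G.U θ : H →L[ℂ] H) * star g = conj c • (star g * (G.U θ : H →L[ℂ] H)) →
      star T * g = conj c • (g * star T) := by
    intro g hg c hc1 hc2
    have := congrArg star (hT _ (star_mem_gens hg) _ hc2)
    rw [star_smul, star_mul, star_mul, star_star, Complex.star_def, Complex.conj_conj] at this
    rw [this, smul_smul, hc1, one_smul]
  obtain ⟨s, hs⟩ : ∃ s : ℂ, star T * T = s • p := by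
    have h1 : star T * T ∈ G.com m := by
      intro g hg
      obtain ⟨c, hc1, hc2, hc3⟩ := gen_phase hg θ
      rw [mul_assoc, hT g hg c hc2, mul_smul_comm, ← mul_assoc, ← mul_assoc,
        hT' g hg c hc1 hc3, smul_mul_assoc, smul_smul, mul_comm c, hc1, one_smul]
    obtain ⟨s, hs⟩ := hp.scalar _ h1
    refine ⟨s, ?_⟩
    have h2 : p * star T = star T := by
      have := congrArg star hTp
      rwa [star_mul, hp.star_eq] at this
    rw [← hs, ← mul_assoc, h2, mul_assoc, hTp]
  have hs0 : s ≠ 0 := by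
    rintro rfl
    rw [zero_smul] at hs
    exact hT0 ((CStarRing.star_mul_self_eq_zero_iff T).1 hs)
  have hpow : ∀ k : ℕ, star T ^ k * p * T ^ k = s ^ k • p := by
    intro k
    induction k with
    | zero => simp
    | succ k ih =>
      rw [pow_succ, pow_succ', show star T ^ k * star T * p * (T * T ^ k)
        = star T ^ k * (star T * (p * T)) * T ^ k by simp only [mul_assoc], hpT, hs, mul_smul_comm,
        smul_mul_assoc, ih, smul_smul, ← pow_succ']
  obtain ⟨t, ht⟩ := hp.scalar ((G.U θ : H →L[ℂ] H) ^ k * p * star T ^ k) (by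
    intro g hg
    obtain ⟨c, hc1, hc2, hc3⟩ := gen_phase hg θ
    rw [mul_assoc _ _ g, pow_mul_of_mul (hT' g hg c hc1 hc3), mul_smul_comm, ← mul_assoc (_ * p) g,
      mul_assoc _ p g, ← hp.mem g hg, ← mul_assoc _ g p, pow_mul_of_mul hc2, smul_mul_assoc,
      smul_mul_assoc, smul_smul, ← mul_pow, hc1, one_pow, one_smul]
    simp only [mul_assoc])
  refine ⟨(s ^ k)⁻¹ * t, ?_⟩
  have h3 := congrArg (fun z => z * T ^ k) ht
  simp only [smul_mul_assoc] at h3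
  rw [mul_smul, ← h3, show p * ((G.U θ : H →L[ℂ] H) ^ k * p * star T ^ k) * p * T ^ k
    = p * (G.U θ : H →L[ℂ] H) ^ k * p * (star T ^ k * p * T ^ k) by simp only [mul_assoc], hpow,
    mul_smul_comm, smul_smul, inv_mul_cancel₀ (pow_ne_zero k hs0), one_smul, mul_assoc (p * _), hp.mul_self]

lemma commute_compress_U_pow (hp : IsMinimalCom G m p) (θ : ℝ) (k l : ℕ) : Commute (p * (G.U θ : H →L[ℂ] H) ^ k * p)
    (p * (G.U θ : H →L[ℂ] H) ^ l * p) := by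
  obtain ⟨T, hT0, hpT, hTp, hT⟩ := hp.exists_implementer θ
  obtain ⟨s, hs⟩ := hp.compress_U_pow hT0 hpT hTp hT k
  obtain ⟨t, ht⟩ := hp.compress_U_pow hT0 hpT hTp hT l
  have hc : Commute p T := by rw [commute_iff_eq, hpT, hTp]
  rw [hs, ht]
  refine (Commute.smul_left (Commute.smul_right ?_ _) _)
  exact (((Commute.refl p).mul_right (hc.pow_right l))).mul_left
    ((hc.symm.pow_left k).mul_right (((Commute.refl T).pow_left k).pow_right l))

lemma commute_compress_cyclicAverage (hp : IsMinimalCom G m p) (q r : ℤ) (n : ℕ) :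
    Commute (p * G.cyclicAverage q n * p) (p * G.cyclicAverage r n * p) := by
  simp only [cyclicAverage, mul_smul_comm, smul_mul_assoc, Finset.mul_sum, Finset.sum_mul]
  refine Commute.smul_left (Commute.smul_right ?_ _) _
  refine Commute.sum_left _ _ _ fun k _ => Commute.sum_right _ _ _ fun l _ => ?_
  exact Commute.smul_left (Commute.smul_right (hp.commute_compress_U_pow _ k l) _) _

/-- The compressions of the charge projections to a minimal subspace commute. -/
lemma commute_compress_chargeProj (hp : IsMinimalCom G m p) (q r : ℤ) :
    Commute (p * G.chargeProj q * p) (p * G.chargeProj r * p) := by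
  have hn : ∀ h, ‖p h‖ ≤ ‖h‖ := norm_apply_le_of_isStarProjection hp.isStarProjection
  have h1 : ∀ (q : ℤ) (n : ℕ) (h : H), ‖(p * G.cyclicAverage q n * p) h‖ ≤ ‖h‖ := fun q n h =>
    (hn _).trans ((norm_cyclicAverage_apply_le q n _).trans (hn h))
  have h2 : ∀ (q : ℤ) (h : H), Filter.Tendsto (fun n => (p * G.cyclicAverage q n * p) h)
      Filter.atTop (nhds ((p * G.chargeProj q * p) h)) := fun q h =>
    (p.continuous.tendsto _).comp (tendsto_cyclicAverage q (p h))
  rw [commute_iff_eq]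
  ext h
  refine tendsto_nhds_unique (tendsto_mul_apply (h1 q) (h2 q) (h2 r) h) ?_
  refine (tendsto_mul_apply (h1 r) (h2 r) (h2 q) h).congr fun n => ?_
  rw [(hp.commute_compress_cyclicAverage q r n).eq]

end IsMinimalCom

end GaugeChain

end

end FermionChain

namespace FermionChain

noncomputable section

/-- The continuous functional calculus respects intertwining relations. -/
lemma intertwine_cfc {A : Type*} [CStarAlgebra A] {x b d : A} (hb : IsSelfAdjoint b)
    (hd : IsSelfAdjoint d) (h : x * b = d * x) {f : ℝ → ℝ} (hf : Continuous f) :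
    x * cfc f b = cfc f d * x := by
  have hpoly : ∀ q : Polynomial ℝ, x * cfc q.eval b = cfc q.eval d * x := by
    intro q
    rw [cfc_polynomial q b hb, cfc_polynomial q d hd]
    induction q using Polynomial.induction_on' with
    | add p q hp hq => rw [map_add, map_add, mul_add, add_mul, hp, hq]
    | monomial n r =>
      have hn : ∀ n : ℕ, x * b ^ n = d ^ n * x := by
        intro n
        induction n with
        | zero => simp
        | succ n ih => rw [pow_succ, ← mul_assoc, ih, mul_assoc, h, ← mul_assoc, pow_succ]
      rw [Polynomial.aeval_monomial, Polynomial.aeval_monomial, ← mul_assoc,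
        ← Algebra.commutes, mul_assoc, hn, mul_assoc]
  -- One interval containing both spectra, so that the same polynomial approximates `f` for `b` and
  -- for `d`.
  set r := max (‖b‖ * ‖(1 : A)‖) (‖d‖ * ‖(1 : A)‖)
  have hsb : ∀ s ∈ spectrum ℝ b, s ∈ Set.Icc (-r) r := fun s hs =>
    abs_le.1 ((spectrum.norm_le_norm_mul_of_mem hs).trans (le_max_left _ _))
  have hsd : ∀ s ∈ spectrum ℝ d, s ∈ Set.Icc (-r) r := fun s hs =>
    abs_le.1 ((spectrum.norm_le_norm_mul_of_mem hs).trans (le_max_right _ _))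
  rw [← sub_eq_zero, ← norm_le_zero_iff]
  refine le_of_forall_pos_le_add fun ε hε => ?_
  rw [zero_add]
  set δ := ε / (2 * (‖x‖ + 1)) with hδ
  have hδ0 : 0 < δ := by positivity
  obtain ⟨q, hq⟩ := exists_polynomial_near_of_continuousOn (-r) r f hf.continuousOn δ hδ0
  have e1 : ‖cfc f b - cfc q.eval b‖ ≤ δ := by
    rw [← cfc_sub f q.eval b hf.continuousOn q.continuous.continuousOn]
    refine norm_cfc_le hδ0.le fun s hs => ?_
    rw [norm_sub_rev]
    exact (hq s (hsb s hs)).le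
  have e2 : ‖cfc f d - cfc q.eval d‖ ≤ δ := by
    rw [← cfc_sub f q.eval d hf.continuousOn q.continuous.continuousOn]
    refine norm_cfc_le hδ0.le fun s hs => ?_
    rw [norm_sub_rev]
    exact (hq s (hsd s hs)).le
  have e3 : x * cfc f b - cfc f d * x
      = x * (cfc f b - cfc q.eval b) - (cfc f d - cfc q.eval d) * x := by
    rw [mul_sub, sub_mul, hpoly]; abel
  rw [e3]
  calc _ ≤ ‖x‖ * δ + δ * ‖x‖ := by
        refine (norm_sub_le _ _).trans (add_le_add ?_ ?_)
        · exact (norm_mul_le _ _).trans (by gcongr)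
        · exact (norm_mul_le _ _).trans (by gcongr)
    _ ≤ ε := by
        have : δ * (2 * (‖x‖ + 1)) = ε := by rw [hδ]; field_simp
        nlinarith

namespace GaugeChain

variable {H : Type*} [NormedAddCommGroup H] [InnerProductSpace ℂ H] [CompleteSpace H]
  (G : GaugeChain H) (m : ℤ)

/-! ### Words in the generators of a half line -/

/-- Products of the operators `a_j`, `a_j*` with `j ≤ m`, with their charge. -/
inductive IsWord : ℤ → (H →L[ℂ] H) → Prop
  | one : IsWord 0 1
  | a_mul {j k : ℤ} {w : H →L[ℂ] H} : j ≤ m → IsWord k w → IsWord (k - 1) (G.a j * w)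
  | star_a_mul {j k : ℤ} {w : H →L[ℂ] H} : j ≤ m → IsWord k w → IsWord (k + 1) (star (G.a j) * w)

variable {G m}

lemma IsWord.mem_bicom {k : ℤ} {w : H →L[ℂ] H} (h : IsWord G m k w) : w ∈ G.bicom m := by
  induction h with
  | one => exact one_mem_bicom
  | a_mul hj _ ih => exact mul_mem_bicom (gens_subset_bicom (a_mem_gens hj)) ih
  | star_a_mul hj _ ih => exact mul_mem_bicom (gens_subset_bicom (star_a_mem_gens hj)) ih

lemma IsWord.mul {k l : ℤ} {w v : H →L[ℂ] H} (h : IsWord G m k w) (h' : IsWord G m l v) :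
    IsWord G m (k + l) (w * v) := by
  induction h with
  | one => simpa using h'
  | a_mul hj _ ih => rw [mul_assoc, sub_add_eq_add_sub]; exact IsWord.a_mul hj ih
  | star_a_mul hj _ ih => rw [mul_assoc, add_right_comm]; exact IsWord.star_a_mul hj ih

lemma IsWord.star {k : ℤ} {w : H →L[ℂ] H} (h : IsWord G m k w) : IsWord G m (-k) (star w) := by
  induction h with
  | one => simpa using IsWord.one
  | a_mul hj _ ih =>
    rw [star_mul, neg_sub, sub_eq_neg_add]
    have := ih.mul (IsWord.star_a_mul hj IsWord.one)
    simpa using this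
  | star_a_mul hj _ ih =>
    rw [star_mul, star_star, neg_add]
    have := ih.mul (IsWord.a_mul hj IsWord.one)
    simpa [sub_eq_add_neg] using this

/-! ### Level operators -/

/-- The positive part of `p Q p - t`, for the projection `Q` onto the vectors of charge `q`. -/
def level (G : GaugeChain H) (p : H →L[ℂ] H) (t : ℝ) (q : ℤ) : H →L[ℂ] H :=
  cfc (fun s : ℝ => max (s - t) 0) (p * G.chargeProj q * p)

namespace IsMinimalCom

variable {p : H →L[ℂ] H} {t : ℝ}

lemma isSelfAdjoint_compress (hp : IsMinimalCom G m p) (q : ℤ) :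
    IsSelfAdjoint (p * G.chargeProj q * p) := by
  rw [IsSelfAdjoint, star_mul, star_mul, hp.star_eq,
    (isStarProjection_chargeProj q).isSelfAdjoint.star_eq, mul_assoc]

lemma commute_level (hp : IsMinimalCom G m p) (t : ℝ) (q r : ℤ) :
    Commute (G.level p t q) (G.level p t r) :=
  (hp.isSelfAdjoint_compress q).commute_cfc
    ((hp.isSelfAdjoint_compress r).commute_cfc (hp.commute_compress_chargeProj q r).symm _).symm _

lemma a_mul_level (hp : IsMinimalCom G m p) (t : ℝ) {j : ℤ} (hj : j ≤ m) (q : ℤ) :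
    G.a j * G.level p t q = G.level p t (q - 1) * G.a j := by
  refine intertwine_cfc (hp.isSelfAdjoint_compress q) (hp.isSelfAdjoint_compress (q - 1)) ?_
    (by fun_prop)
  have h1 := hp.mem _ (a_mem_gens hj)
  rw [← mul_assoc, ← mul_assoc, h1, mul_assoc p, a_mul_chargeProj, ← mul_assoc, mul_assoc _ _ p, h1,
    ← mul_assoc]

lemma star_level (p : H →L[ℂ] H) (t : ℝ) (q : ℤ) : star (G.level p t q) = G.level p t q :=
  (cfc_predicate (R := ℝ) (p := IsSelfAdjoint) _ _ : IsSelfAdjoint (G.level p t q)).star_eq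

lemma star_a_mul_level (hp : IsMinimalCom G m p) (t : ℝ) {j : ℤ} (hj : j ≤ m) (q : ℤ) :
    star (G.a j) * G.level p t q = G.level p t (q + 1) * star (G.a j) := by
  have := congrArg star (hp.a_mul_level t hj (q + 1))
  rw [star_mul, star_mul, star_level, star_level, add_sub_cancel_right] at this
  exact this.symm

/-- For `t > 0` the function `max (s - t) 0` is `s` times a continuous function, the denominator
`max s t` being positive. So the level operator has the compression, and hence `p`, as a left
factor. -/
lemma mul_level (hp : IsMinimalCom G m p) (ht : 0 < t) (q : ℤ) :
    p * G.level p t q = G.level p t q := by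
  have hg : Continuous fun s : ℝ => max (s - t) 0 / max s t := by
    refine Continuous.div (by fun_prop) (by fun_prop) fun s => ?_
    have := le_max_right s t
    linarith
  have e : (fun s : ℝ => max (s - t) 0) = fun s => s * (max (s - t) 0 / max s t) := by
    funext s
    rcases le_total s t with h | h
    · rw [max_eq_right (by linarith : s - t ≤ 0)]; simp
    · rw [max_eq_left h]
      have : s ≠ 0 := by linarith
      field_simp
  have h1 : G.level p t q = (p * G.chargeProj q * p)
      * cfc (fun s : ℝ => max (s - t) 0 / max s t) (p * G.chargeProj q * p) := by
    rw [level, e, cfc_mul (fun s : ℝ => s) _ _ (by fun_prop) hg.continuousOn,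
      cfc_id' ℝ _ (hp.isSelfAdjoint_compress q)]
  rw [h1, ← mul_assoc, ← mul_assoc, ← mul_assoc, hp.mul_self]

/-- With `f = max (s - t) 0 ≥ 0` one has `s f = f² + t f`, so the compression is at least `t` on the
range of the level operator. -/
lemma le_inner_level (hp : IsMinimalCom G m p) (t : ℝ) (q : ℤ) (h : H) :
    t * ‖G.level p t q h‖ ^ 2 ≤ ‖G.chargeProj q (p (G.level p t q h))‖ ^ 2 := by
  set v := G.level p t q h with hv
  have hf : Continuous fun s : ℝ => max (s - t) 0 := by fun_prop
  have e : (fun s : ℝ => s * max (s - t) 0)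
      = fun s => max (s - t) 0 * max (s - t) 0 + t * max (s - t) 0 := by
    funext s
    rcases le_total (s - t) 0 with h | h
    · rw [max_eq_right h]; simp
    · rw [max_eq_left h]; ring
  have h1 : (p * G.chargeProj q * p) * G.level p t q
      = G.level p t q * G.level p t q + t • G.level p t q := by
    have h2 := cfc_mul (fun s : ℝ => s) (fun s => max (s - t) 0) (p * G.chargeProj q * p)
      (by fun_prop) hf.continuousOn
    rw [cfc_id' ℝ _ (hp.isSelfAdjoint_compress q), e,
      cfc_add (a := p * G.chargeProj q * p) _ _ (by fun_prop) (by fun_prop),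
      cfc_mul _ _ _ hf.continuousOn hf.continuousOn, cfc_const_mul _ _ _ hf.continuousOn] at h2
    exact h2.symm
  have h3 : ⟪v, (p * G.chargeProj q * p) v⟫_ℂ = ((‖G.chargeProj q (p v)‖ ^ 2 : ℝ) : ℂ) := by
    rw [← inner_apply_isStarProjection (isStarProjection_chargeProj q)]
    conv_lhs => rw [mul_assoc, ← hp.star_eq]
    change ⟪v, (star p) ((G.chargeProj q) ((star p) v))⟫_ℂ = _
    rw [ContinuousLinearMap.star_eq_adjoint, ContinuousLinearMap.adjoint_inner_right,
      ← ContinuousLinearMap.star_eq_adjoint, hp.star_eq]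
  have h4 : (p * G.chargeProj q * p) v = G.level p t q v + (t : ℂ) • v :=
    congrArg (fun z : H →L[ℂ] H => z h) h1
  have h5 : 0 ≤ G.level p t q := cfc_nonneg fun s _ => le_max_right _ _
  have h6 := ((ContinuousLinearMap.nonneg_iff_isPositive _).1 h5).re_inner_nonneg_right v
  rw [h4, inner_add_right, inner_smul_right, inner_self_eq_norm_sq_to_K] at h3
  have h7 := congrArg Complex.re h3
  rw [Complex.add_re, Complex.ofReal_re, Complex.re_ofReal_mul] at h7
  have h8 : (((‖v‖ : ℝ) : ℂ) ^ 2).re = ‖v‖ ^ 2 := by norm_cast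
  change (⟪v, G.level p t q v⟫_ℂ).re + t * (((‖v‖ : ℝ) : ℂ) ^ 2).re = _ at h7
  change 0 ≤ (⟪v, G.level p t q v⟫_ℂ).re at h6
  rw [h8] at h7
  linarith

/-- Charged vectors are total, so some compression is nonzero; its spectrum exceeds half its norm.
-/
lemma exists_level_ne_zero (hp : IsMinimalCom G m p) : ∃ t > 0, ∃ q, G.level p t q ≠ 0 := by
  obtain ⟨v, hv⟩ := hp.exists_apply_ne_zero
  obtain ⟨q, hq⟩ : ∃ q, G.chargeProj q (p v) ≠ 0 := by
    by_contra! hc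
    exact hv (eq_zero_of_chargeProj hc)
  set B := p * G.chargeProj q * p with hB
  have hBpos : B = star (G.chargeProj q * p) * (G.chargeProj q * p) := by
    rw [star_mul, hp.star_eq, (isStarProjection_chargeProj q).isSelfAdjoint.star_eq, mul_assoc,
      ← mul_assoc (G.chargeProj q), (isStarProjection_chargeProj q).isIdempotentElem.eq, hB,
      mul_assoc]
  have hB0 : B ≠ 0 := by
    intro h0
    rw [hBpos] at h0
    have := (CStarRing.star_mul_self_eq_zero_iff _).1 h0
    exact hq (congrArg (fun z : H →L[ℂ] H => z v) this)
  have hn : 0 < ‖B‖ := norm_pos_iff.2 hB0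
  refine ⟨‖B‖ / 2, by positivity, q, fun h0 => ?_⟩
  have hspec : ∀ s ∈ spectrum ℝ B, ‖s‖ ≤ ‖B‖ / 2 := by
    intro s hs
    have h1 := norm_apply_le_norm_cfc (fun s : ℝ => max (s - ‖B‖ / 2) 0) B hs (by fun_prop)
      (hp.isSelfAdjoint_compress q)
    have h2 : cfc (fun s : ℝ => max (s - ‖B‖ / 2) 0) B = 0 := h0
    rw [h2, norm_zero, norm_le_zero_iff] at h1
    have h3 : 0 ≤ s := spectrum_nonneg_of_nonneg (hBpos ▸ star_mul_self_nonneg _) hs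
    rw [Real.norm_of_nonneg h3]
    have := le_max_left (s - ‖B‖ / 2) 0
    linarith
  have h4 := norm_cfc_le (f := fun s : ℝ => s) (a := B) (by positivity : 0 ≤ ‖B‖ / 2) hspec
  rw [cfc_id' ℝ _ (hp.isSelfAdjoint_compress q)] at h4
  linarith

lemma word_mul_prod_level (hp : IsMinimalCom G m p) (t : ℝ) {k : ℤ} {w : H →L[ℂ] H}
    (hw : IsWord G m k w) (l : List ℤ) :
    w * (l.map (G.level p t)).prod = ((l.map (· + k)).map (G.level p t)).prod * w := by
  have step : ∀ (x : H →L[ℂ] H) (d : ℤ),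
      (∀ q, x * G.level p t q = G.level p t (q + d) * x) → ∀ l : List ℤ,
      x * (l.map (G.level p t)).prod = ((l.map (· + d)).map (G.level p t)).prod * x := by
    intro x d hx l
    induction l with
    | nil => simp
    | cons q l ih =>
      simp only [List.map_cons, List.prod_cons]
      rw [← mul_assoc, hx, mul_assoc, ih, mul_assoc]
  induction hw generalizing l with
  | one => simp
  | @a_mul j k w hj _ ih =>
    rw [mul_assoc, ih, ← mul_assoc, step (G.a j) (-1) (fun q => hp.a_mul_level t hj q), mul_assoc]
    simp [Function.comp_def, add_assoc, sub_eq_add_neg]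
  | @star_a_mul j k w hj _ ih =>
    rw [mul_assoc, ih, ← mul_assoc, step _ 1 (fun q => hp.star_a_mul_level t hj q), mul_assoc]
    simp [Function.comp_def, add_assoc]

lemma star_prod_level (t : ℝ) (l : List ℤ) :
    star (l.map (G.level p t)).prod = ((l.reverse).map (G.level p t)).prod := by
  induction l with
  | nil => simp
  | cons q l ih => simp [star_level, ih]

/-- The factors commute, so a vector `u` in the range of the product lies in the range of each
factor, and `p u` has weight at least `t ‖u‖²` in every charge of the list. Bessel's inequality
bounds the number of distinct charges by `1 / t`. -/
lemma card_mul_le_of_prod_level_ne_zero (hp : IsMinimalCom G m p) {l : List ℤ}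
    (h : (l.map (G.level p t)).prod ≠ 0) : (l.toFinset.card : ℝ) * t ≤ 1 := by
  obtain ⟨v, hv⟩ : ∃ v, (l.map (G.level p t)).prod v ≠ 0 := by
    by_contra! hc
    exact h (ContinuousLinearMap.ext hc)
  set u := (l.map (G.level p t)).prod v with hu
  have hn : 0 < ‖u‖ ^ 2 := by positivity
  have h1 : ∀ q ∈ l.toFinset, t * ‖u‖ ^ 2 ≤ ‖G.chargeProj q (p u)‖ ^ 2 := by
    intro q hq
    obtain ⟨s, r, rfl⟩ := List.append_of_mem (List.mem_toFinset.1 hq)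
    have hc : Commute (s.map (G.level p t)).prod (G.level p t q) := by
      refine (Commute.list_prod_right _ _ fun x hx => ?_).symm
      obtain ⟨k, _, rfl⟩ := List.mem_map.1 hx
      exact hp.commute_level t q k
    have e : u = G.level p t q (((s.map (G.level p t)).prod * (r.map (G.level p t)).prod) v) := by
      rw [hu, List.map_append, List.prod_append, List.map_cons, List.prod_cons, ← mul_assoc, hc.eq,
        mul_assoc]
      rfl
    have := hp.le_inner_level t q
      (((s.map (G.level p t)).prod * (r.map (G.level p t)).prod) v)
    rwa [← e] at this
  have h2 := Finset.sum_le_sum h1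
  have h3 := sum_norm_sq_le (fun q => isStarProjection_chargeProj (G := G) q)
    (fun _ _ h => chargeProj_mul_of_ne h) l.toFinset (p u)
  have h4 := pow_le_pow_left₀ (norm_nonneg _)
    (norm_apply_le_of_isStarProjection hp.isStarProjection u) 2
  rw [Finset.sum_const, nsmul_eq_mul] at h2
  have h5 : (l.toFinset.card : ℝ) * t * ‖u‖ ^ 2 ≤ 1 * ‖u‖ ^ 2 := by linarith
  exact le_of_mul_le_mul_right h5 hn

/-- A nonempty finite set of integers is not invariant under a nonzero shift, because the sum of its
elements would change. -/
lemma card_lt_card_union_shift {F : Finset ℤ} (hF : F.Nonempty) {d : ℤ} (hd : d ≠ 0) :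
    F.card < (F ∪ F.image (· + d)).card := by
  refine Finset.card_lt_card ⟨Finset.subset_union_left, fun hs => ?_⟩
  have h1 : F.image (· + d) = F := by
    refine Finset.eq_of_subset_of_card_le (fun x hx => hs (Finset.mem_union_right _ hx)) ?_
    rw [Finset.card_image_of_injective _ (add_left_injective d)]
  have h2 : ∑ x ∈ F.image (· + d), x = ∑ x ∈ F, x := by rw [h1]
  rw [Finset.sum_image (fun x _ y _ h => add_left_injective d h), Finset.sum_add_distrib,
    Finset.sum_const, nsmul_eq_mul] at h2
  have h3 : (F.card : ℤ) * d = 0 := by linarith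
  rcases mul_eq_zero.1 h3 with h | h
  · exact hF.card_pos.ne' (by exact_mod_cast h)
  · exact hd h

/-- There is a nonzero operator into the minimal subspace whose range is orthogonal to its images
under words of nonzero charge. -/
lemma exists_charge_localized (hp : IsMinimalCom G m p) : ∃ x : H →L[ℂ] H, x ≠ 0 ∧ p * x = x ∧
    ∀ (k : ℤ) (w : H →L[ℂ] H), k ≠ 0 → IsWord G m k w → star x * w * x = 0 := by
  obtain ⟨t, ht, q, hq⟩ := hp.exists_level_ne_zero
  -- The operator `x` is a nonzero product of level operators with the largest possible set `F` of
  -- charges. A word `w` of charge `k` shifts the levels, so `x* w x` contains a product over `F ∪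
  -- (F + k)`. For `k ≠ 0` this set is larger than `F`, and the product vanishes by maximality.
  set S : Set ℕ := {n | ∃ l : List ℤ, (l.map (G.level p t)).prod ≠ 0 ∧ l.toFinset.card = n} with hS
  have hne : S.Nonempty := ⟨_, [q], by simpa using hq, rfl⟩
  have hbdd : BddAbove S := by
    refine ⟨⌊t⁻¹⌋₊, ?_⟩
    rintro n ⟨l, hl, rfl⟩
    refine Nat.le_floor ?_
    rw [← div_one t⁻¹, ← mul_one_div, inv_mul_eq_div, le_div_iff₀ ht]
    simpa using hp.card_mul_le_of_prod_level_ne_zero hl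
  obtain ⟨l, hl, hlc⟩ := Nat.sSup_mem hne hbdd
  have hmax : ∀ l' : List ℤ, l.toFinset.card < l'.toFinset.card →
      (l'.map (G.level p t)).prod = 0 := by
    intro l' hlt
    by_contra hc
    have := le_csSup hbdd (⟨l', hc, rfl⟩ : l'.toFinset.card ∈ S)
    omega
  have hl0 : l ≠ [] := by
    rintro rfl
    refine hq ?_
    simpa using hmax [q] (by simp)
  refine ⟨_, hl, ?_, fun k w hk hw => ?_⟩
  · obtain ⟨r, l', rfl⟩ := List.exists_cons_of_ne_nil hl0
    rw [List.map_cons, List.prod_cons, ← mul_assoc, hp.mul_level ht]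
  · rw [mul_assoc, hp.word_mul_prod_level t hw, ← mul_assoc, star_prod_level, ← List.prod_append,
      ← List.map_append, hmax, zero_mul]
    rw [List.toFinset_append, List.toFinset_reverse]
    have h1 : (l.map (· + k)).toFinset = l.toFinset.image (· + k) := by
      ext; simp only [List.mem_toFinset, List.mem_map, Finset.mem_image]
    rw [h1]
    exact card_lt_card_union_shift (List.toFinset_nonempty_iff l |>.2 hl0) hk

end IsMinimalCom

/-! ### Charge gradings of a half line -/

/-- A charge grading of the half line `j ≤ m`: a partition of unity into projections of its
von Neumann algebra on which its generators act as charge shifts. -/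
structure IsGrading (G : GaugeChain H) (m : ℤ) (P : ℤ → H →L[ℂ] H) : Prop where
  isStarProjection : ∀ k, IsStarProjection (P k)
  mem : ∀ k, P k ∈ G.bicom m
  orthogonal : ∀ k l, k ≠ l → P k * P l = 0
  a_mul : ∀ j ≤ m, ∀ k, G.a j * P k = P (k - 1) * G.a j
  complete : ∀ h, (∀ k, P k h = 0) → h = 0

/-- `P k` projects onto the span of the vectors `y w x h` with `y` in the commutant and `w` a word
of charge `k`. Invariance under the commutant puts `P k` into the half-line algebra, and together
the spans are total because that algebra is a factor. For orthogonality, `p` can be inserted around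
`y* y'`, which becomes a scalar and leaves `x* w* w' x = 0`. -/
theorem IsMinimalCom.exists_grading {p : H →L[ℂ] H} (hp : IsMinimalCom G m p) :
    ∃ P, IsGrading G m P := by
  obtain ⟨x, hx0, hpx, hx⟩ := hp.exists_charge_localized
  set S : ℤ → Set H := fun k => {v | ∃ y ∈ G.com m, ∃ w, IsWord G m k w ∧ ∃ h, v = y (w (x h))}
    with hS
  have hcom : ∀ k, ∀ y ∈ G.com m, ∀ v ∈ S k, y v ∈ S k := by
    rintro k y hy _ ⟨z, hz, w, hw, h, rfl⟩
    exact ⟨y * z, mul_mem_com hy hz, w, hw, h, rfl⟩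
  have ha : ∀ j ≤ m, ∀ k, ∀ v ∈ S k, G.a j v ∈ S (k - 1) := by
    rintro j hj k _ ⟨z, hz, w, hw, h, rfl⟩
    refine ⟨z, hz, _, IsWord.a_mul hj hw, h, ?_⟩
    exact congrArg (fun b : H →L[ℂ] H => b (w (x h))) (hz _ (a_mem_gens hj))
  have has : ∀ j ≤ m, ∀ k, ∀ v ∈ S k, star (G.a j) v ∈ S (k + 1) := by
    rintro j hj k _ ⟨z, hz, w, hw, h, rfl⟩
    refine ⟨z, hz, _, IsWord.star_a_mul hj hw, h, ?_⟩
    exact congrArg (fun b : H →L[ℂ] H => b (w (x h))) (hz _ (star_a_mem_gens hj))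
  obtain ⟨v, hv⟩ : ∃ v, x v ≠ 0 := by
    by_contra! hc
    exact hx0 (ContinuousLinearMap.ext hc)
  have htot : spanProj (⋃ k, S k) = 1 := by
    refine spanProj_eq_one (G := G) (m := m) (h := x v)
      (Set.mem_iUnion.2 ⟨0, 1, one_mem_com, 1, IsWord.one, v, rfl⟩) hv ?_ ?_
    · rintro g ⟨j, hj, rfl | rfl⟩ k hk
      · obtain ⟨i, hi⟩ := Set.mem_iUnion.1 hk
        exact mem_closure_span (Set.mem_iUnion.2 ⟨_, ha j hj i k hi⟩)
      · obtain ⟨i, hi⟩ := Set.mem_iUnion.1 hk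
        exact mem_closure_span (Set.mem_iUnion.2 ⟨_, has j hj i k hi⟩)
    · intro y hy k hk
      obtain ⟨i, hi⟩ := Set.mem_iUnion.1 hk
      exact mem_closure_span (Set.mem_iUnion.2 ⟨_, hcom i y hy k hi⟩)
  refine ⟨fun k => spanProj (S k), fun k => isStarProjection_spanProj _, fun k => ?_, ?_, ?_,
    fun h hh => eq_zero_of_spanProj_eq_zero htot hh⟩
  · exact spanProj_mem_bicom fun y hy v hv => mem_closure_span (hcom k y hy v hv)
  · intro k l hkl
    refine spanProj_mul_spanProj_eq_zero ?_
    rintro _ ⟨y, hy, w, hw, h, rfl⟩ _ ⟨y', hy', w', hw', h', rfl⟩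
    obtain ⟨s, hs⟩ := hp.scalar _ (mul_mem_com (star_mem_com hy) hy')
    have e1 : star x * p = star x := by
      have := congrArg star hpx
      rwa [star_mul, hp.star_eq] at this
    have e2 := commute_of_mem hw.star.mem_bicom hp.mem
    have e3 := commute_of_mem hw'.mem_bicom hp.mem
    have e4 : star x * star w * star y * y' * w' * x = 0 := by
      calc star x * star w * star y * y' * w' * x
          = star x * p * star w * (star y * y') * w' * (p * x) := by
            rw [e1, hpx]; simp only [mul_assoc]
        _ = star x * (p * star w) * (star y * y') * (w' * p) * x := by simp only [mul_assoc]
        _ = star x * star w * (p * (star y * y') * p) * w' * x := by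
            rw [← e2, e3]; simp only [mul_assoc]
        _ = s • (star x * (star w * w') * (p * x)) := by
            rw [hs, mul_smul_comm, smul_mul_assoc, smul_mul_assoc]
            congr 1
            rw [mul_assoc _ p w', ← e3]
            simp only [mul_assoc]
        _ = 0 := by
            rw [hpx, hx _ _ _ (hw.star.mul hw'), smul_zero]
            omega
    have e5 : ⟪y (w (x h)), y' (w' (x h'))⟫_ℂ
        = ⟪h, (star x * star w * star y * y' * w' * x) h'⟫_ℂ := by
      simp only [mul_apply_eq_comp, ContinuousLinearMap.star_eq_adjoint,
        ContinuousLinearMap.adjoint_inner_right]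
    rw [e5, e4]; simp
  · intro j hj k
    refine mul_spanProj (fun v hv => mem_closure_span (ha j hj k v hv)) (fun v hv => ?_)
    have := has j hj _ v hv
    rw [sub_add_cancel] at this
    exact mem_closure_span this

end GaugeChain

end

end FermionChain

/-! ### Uniqueness and extension of charge gradings, and shifted distributions. -/

namespace FermionChain

noncomputable section

/-- The operator `∑ c_k P_k`, for mutually orthogonal projections `P_k` and phases `c_k`. -/
lemma exists_phase_sum {H : Type*} [NormedAddCommGroup H] [InnerProductSpace ℂ H] [CompleteSpace H]
    {P : ℤ → H →L[ℂ] H} (hP : ∀ i, IsStarProjection (P i)) (ho : ∀ i j, i ≠ j → P i * P j = 0)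
    {c : ℤ → ℂ} (hc : ∀ k, ‖c k‖ = 1) : ∃ D : H →L[ℂ] H, ∀ k, P k * D = c k • P k := by
  have hV : OrthogonalFamily ℂ (fun i => LinearMap.range (P i : H →ₗ[ℂ] H))
      (fun i => (LinearMap.range (P i : H →ₗ[ℂ] H)).subtypeₗᵢ) := by
    rintro i j hij ⟨_, x, rfl⟩ ⟨_, y, rfl⟩
    change ⟪P i x, P j y⟫_ℂ = 0
    rw [← ContinuousLinearMap.adjoint_inner_right, ← ContinuousLinearMap.star_eq_adjoint,
      (hP i).isSelfAdjoint.star_eq]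
    have := congrArg (fun z : H →L[ℂ] H => z y) (ho i j hij)
    simp only [mul_apply_eq_comp, zero_apply] at this
    rw [this, inner_zero_right]
  let f : H → ∀ i, LinearMap.range (P i : H →ₗ[ℂ] H) := fun h i =>
    ⟨c i • P i h, Submodule.smul_mem _ _ ⟨h, rfl⟩⟩
  have hf : ∀ h i, ‖f h i‖ ^ 2 = ‖P i h‖ ^ 2 := fun h i => by
    change ‖c i • P i h‖ ^ 2 = _
    rw [norm_smul, hc, one_mul]
  have hsum : ∀ h, Summable fun i => c i • P i h := by
    intro h
    refine (hV.summable_iff_norm_sq_summable (f h)).2 ?_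
    simp only [hf]
    exact summable_of_sum_le (fun _ => by positivity) fun F => sum_norm_sq_le hP ho F h
  have hbound : ∀ h, ‖∑' i, c i • P i h‖ ≤ 1 * ‖h‖ := by
    intro h
    refine le_of_tendsto (hsum h).hasSum.norm (Filter.Eventually.of_forall fun F => ?_)
    have h1 := hV.norm_sum (f h) F
    simp only [hf] at h1
    change ‖∑ i ∈ F, c i • P i h‖ ^ 2 = _ at h1
    have h2 := sum_norm_sq_le hP ho F h
    rw [← h1] at h2
    rw [one_mul]
    exact (pow_le_pow_iff_left₀ (norm_nonneg _) (norm_nonneg _) (by norm_num)).1 h2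
  refine ⟨LinearMap.mkContinuous
    { toFun := fun h => ∑' i, c i • P i h
      map_add' := fun x y => by
        simp only [map_add, smul_add]
        exact (hsum x).tsum_add (hsum y)
      map_smul' := fun s x => by
        simp only [map_smul, RingHom.id_apply, smul_comm _ s]
        exact (hsum x).tsum_const_smul s } 1 hbound, fun k => ?_⟩
  ext h
  change P k (∑' i, c i • P i h) = c k • P k h
  rw [(P k).map_tsum (hsum h), tsum_eq_single k]
  · rw [map_smul]
    congr 1
    exact congrArg (fun z : H →L[ℂ] H => z h) (hP k).isIdempotentElem.eq
  · intro i hi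
    rw [map_smul]
    have := congrArg (fun z : H →L[ℂ] H => z h) (ho k i hi.symm)
    simp only [mul_apply_eq_comp, zero_apply] at this
    rw [this, smul_zero]

/-- By irrationality of `π` the single angle `1` distinguishes all charges. -/
lemma exp_int_mul_I_injective {n k : ℤ}
    (h : Complex.exp (n * Complex.I) = Complex.exp (k * Complex.I)) : n = k := by
  rw [Complex.exp_eq_exp_iff_exists_int] at h
  obtain ⟨t, ht⟩ := h
  have h1 : ((n : ℂ) - k) = t * (2 * Real.pi) := by
    have : ((n : ℂ) - k) * Complex.I = t * (2 * Real.pi) * Complex.I := by linear_combination ht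
    exact mul_right_cancel₀ Complex.I_ne_zero this
  have h2 : ((n - k : ℤ) : ℝ) = ((2 * t : ℤ) : ℝ) * Real.pi := by
    have : (((n - k : ℤ) : ℝ) : ℂ) = ((((2 * t : ℤ) : ℝ) * Real.pi : ℝ) : ℂ) := by
      push_cast; rw [h1]; ring
    exact_mod_cast this
  by_cases ht0 : 2 * t = 0
  · rw [ht0] at h2
    simp only [Int.cast_zero, zero_mul, Int.cast_eq_zero] at h2
    omega
  · have h3 : Irrational (((2 * t : ℤ) : ℝ) * Real.pi) := irrational_pi.intCast_mul ht0
    rw [← h2] at h3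
    exact absurd h3 (Int.not_irrational _)

/-- Two summable nonnegative sequences whose sum is reproduced by shifting them by adjacent
amounts: one of them vanishes. -/
lemma eq_zero_or_eq_zero_of_shift {a b : ℤ → ℝ} (ha : ∀ k, 0 ≤ a k) (hb : ∀ k, 0 ≤ b k)
    (sa : Summable a) (sb : Summable b) {r : ℤ}
    (h : ∀ k, a k + b k = a (k + r) + b (k + r - 1)) : (∀ k, b k = 0) ∨ ∀ k, a k = 0 := by
  have bdd : ∀ x : ℝ, ‖Real.arctan x‖ ≤ 2 := fun x => by
    rw [Real.norm_eq_abs, abs_le]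
    have := Real.neg_pi_div_two_lt_arctan x
    have := Real.arctan_lt_pi_div_two x
    have := Real.pi_lt_four
    constructor <;> linarith
  have sm : ∀ (g : ℤ → ℝ) (u : ℤ → ℝ), Summable u → (∀ k, 0 ≤ u k) → (∀ k, ‖g k‖ ≤ 2) →
      Summable fun k => g k * u k := by
    intro g u hu hu0 hg
    refine Summable.of_norm_bounded (hu.mul_left 2) fun k => ?_
    rw [norm_mul, Real.norm_of_nonneg (hu0 k)]
    exact mul_le_mul_of_nonneg_right (hg k) (hu0 k)
  -- Any bounded strictly increasing function serves; boundedness makes the sums converge without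
  -- moments of `a` and `b`.
  set g : ℤ → ℝ := fun k => Real.arctan k with hg
  have hmono : StrictMono g := fun x y hxy => Real.arctan_strictMono (by exact_mod_cast hxy)
  have e1 : ∑' k, g k * a k + ∑' k, g k * b k
      = ∑' k, g (k - r) * a k + ∑' k, g (k - r + 1) * b k := by
    rw [← (sm g a sa ha fun _ => bdd _).tsum_add (sm g b sb hb fun _ => bdd _)]
    have e2 : ∀ k, g k * a k + g k * b k = g k * a (k + r) + g k * b (k + r - 1) := fun k => by
      rw [← mul_add, h, mul_add]
    simp only [e2]
    have s1 : Summable fun k => g k * a (k + r) :=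
      sm g (fun k => a (k + r)) ((Equiv.addRight r).summable_iff.2 sa) (fun _ => ha _)
        fun _ => bdd _
    have s2 : Summable fun k => g k * b (k + r - 1) :=
      sm g (fun k => b (k + r - 1)) (by
        have := (Equiv.addRight (r - 1)).summable_iff.2 sb
        simpa [Function.comp_def, add_sub_assoc] using this) (fun _ => hb _) fun _ => bdd _
    rw [s1.tsum_add s2, ← (Equiv.addRight r).tsum_eq (fun k => g (k - r) * a k),
      ← (Equiv.addRight (r - 1)).tsum_eq (fun k => g (k - r + 1) * b k)]
    congr 1
    · simp
    · refine tsum_congr fun k => ?_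
      simp only [Equiv.coe_addRight]
      congr 2 <;> ring
  have s3 := sm g a sa ha fun _ => bdd _
  have s4 := sm g b sb hb fun _ => bdd _
  have s5 := sm (fun k => g (k - r)) a sa ha fun _ => bdd _
  have s6 := sm (fun k => g (k - r + 1)) b sb hb fun _ => bdd _
  have e3 : ∑' k, ((g k - g (k - r)) * a k + (g k - g (k - r + 1)) * b k) = 0 := by
    have : ∀ k, (g k - g (k - r)) * a k + (g k - g (k - r + 1)) * b k
        = (g k * a k - g (k - r) * a k) + (g k * b k - g (k - r + 1) * b k) := fun k => by ring
    simp only [this]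
    rw [(s3.sub s5).tsum_add (s4.sub s6), s3.tsum_sub s5, s4.tsum_sub s6]
    linarith
  have s7 : Summable fun k => (g k - g (k - r)) * a k + (g k - g (k - r + 1)) * b k := by
    refine ((s3.sub s5).add (s4.sub s6)).congr fun k => ?_
    ring
  -- Summation against `g` moves the shifts to `g`: by `-r` in the terms of `a`, by `1 - r` in those
  -- of `b`. For an integer `r` these shifts never have opposite signs, so all terms have one sign
  -- and vanish. The sequence whose shift is certainly nonzero must be zero.
  rcases le_or_gt r 0 with hr | hr
  · left
    intro k
    have hterm : ∀ k, 0 ≤ -((g k - g (k - r)) * a k + (g k - g (k - r + 1)) * b k) := fun k => by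
      have h1 : g k ≤ g (k - r) := hmono.monotone (by omega)
      have h2 : g k ≤ g (k - r + 1) := hmono.monotone (by omega)
      nlinarith [ha k, hb k, mul_nonneg (sub_nonneg.2 h1) (ha k), mul_nonneg (sub_nonneg.2 h2) (hb k)]
    have h0 := (hasSum_zero_iff_of_nonneg hterm).1 (by
      have := s7.hasSum.neg
      rwa [e3, neg_zero] at this)
    have h1 := congrFun h0 k
    simp only [Pi.zero_apply] at h1
    have h2 : g k ≤ g (k - r) := hmono.monotone (by omega)
    have h3 : g k < g (k - r + 1) := hmono (by omega)
    have h4 := mul_nonneg (sub_nonneg.2 h2) (ha k)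
    have h5 := mul_nonneg (sub_nonneg.2 h3.le) (hb k)
    have h6 : (g (k - r + 1) - g k) * b k = 0 := by nlinarith
    exact (mul_eq_zero.1 h6).resolve_left (by linarith)
  · right
    intro k
    have hterm : ∀ k, 0 ≤ (g k - g (k - r)) * a k + (g k - g (k - r + 1)) * b k := fun k => by
      have h1 : g (k - r) ≤ g k := hmono.monotone (by omega)
      have h2 : g (k - r + 1) ≤ g k := hmono.monotone (by omega)
      exact add_nonneg (mul_nonneg (sub_nonneg.2 h1) (ha k)) (mul_nonneg (sub_nonneg.2 h2) (hb k))
    have h0 := (hasSum_zero_iff_of_nonneg hterm).1 (by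
      have := s7.hasSum
      rwa [e3] at this)
    have h1 := congrFun h0 k
    simp only [Pi.zero_apply] at h1
    have h2 : g (k - r) < g k := hmono (by omega)
    have h3 : g (k - r + 1) ≤ g k := hmono.monotone (by omega)
    have h4 := mul_nonneg (sub_nonneg.2 h2.le) (ha k)
    have h5 := mul_nonneg (sub_nonneg.2 h3) (hb k)
    have h6 : (g k - g (k - r)) * a k = 0 := by linarith
    exact (mul_eq_zero.1 h6).resolve_left (by linarith)

namespace GaugeChain

variable {H : Type*} [NormedAddCommGroup H] [InnerProductSpace ℂ H] [CompleteSpace H]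
  {G : GaugeChain H} {m : ℤ}

namespace IsGrading

variable {P P' : ℤ → H →L[ℂ] H}

lemma star_eq (hP : IsGrading G m P) (k : ℤ) : star (P k) = P k :=
  (hP.isStarProjection k).isSelfAdjoint.star_eq

lemma mul_self (hP : IsGrading G m P) (k : ℤ) : P k * P k = P k :=
  (hP.isStarProjection k).isIdempotentElem.eq

lemma star_a_mul (hP : IsGrading G m P) {j : ℤ} (hj : j ≤ m) (k : ℤ) :
    star (G.a j) * P k = P (k + 1) * star (G.a j) := by
  have := congrArg star (hP.a_mul j hj (k + 1))
  rw [star_mul, star_mul, hP.star_eq, hP.star_eq, add_sub_cancel_right] at this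
  exact this.symm

lemma ext_op (hP : IsGrading G m P) {x y : H →L[ℂ] H} (h : ∀ k, P k * x = P k * y) : x = y := by
  rw [← sub_eq_zero]
  ext v
  refine hP.complete _ fun k => ?_
  have := congrArg (fun z : H →L[ℂ] H => z v) (h k)
  simp only [mul_apply_eq_comp] at this
  rw [sub_apply, map_sub, this, sub_self]

lemma exists_ne_zero (hP : IsGrading G m P) : ∃ k, P k ≠ 0 := by
  by_contra! hc
  exact G.Ω_ne_zero (hP.complete _ fun k => by rw [hc k]; rfl)

/-- The unitary of the algebra of the half line determined by a charge grading. -/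
lemma exists_phase (hP : IsGrading G m P) (θ : ℝ) : ∃ D ∈ G.bicom m,
    (∀ k : ℤ, P k * D = Complex.exp (k * (θ * Complex.I)) • P k) ∧
    (∀ k : ℤ, D * P k = Complex.exp (k * (θ * Complex.I)) • P k) ∧
    (∀ j ≤ m, D * G.a j = Complex.exp (-(θ * Complex.I)) • (G.a j * D)) ∧
    (∀ j ≤ m, D * star (G.a j) = Complex.exp (θ * Complex.I) • (star (G.a j) * D)) := by
  obtain ⟨D, hD⟩ := exists_phase_sum hP.isStarProjection hP.orthogonal
    (c := fun k => Complex.exp (k * (θ * Complex.I))) (fun k => by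
      rw [show (k : ℂ) * (θ * Complex.I) = ((k * θ : ℝ) : ℂ) * Complex.I by push_cast; ring]
      exact Complex.norm_exp_ofReal_mul_I _)
  refine ⟨D, fun y hy => hP.ext_op fun k => ?_, hD, fun k => hP.ext_op fun l => ?_,
    fun j hj => hP.ext_op fun k => ?_, fun j hj => hP.ext_op fun k => ?_⟩
  · rw [← mul_assoc (P k), commute_of_mem (hP.mem k) hy, mul_assoc, hD, ← mul_assoc (P k), hD,
      smul_mul_assoc,
      commute_of_mem (hP.mem k) hy, mul_smul_comm]
  · rw [← mul_assoc (P l), hD, smul_mul_assoc, mul_smul_comm]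
    by_cases hkl : l = k
    · rw [hkl]
    · rw [hP.orthogonal l k hkl, smul_zero, smul_zero]
  · have h1 := hP.a_mul j hj (k + 1)
    rw [add_sub_cancel_right] at h1
    rw [← mul_assoc (P k), hD, smul_mul_assoc, mul_smul_comm, ← mul_assoc (P k) (G.a j), ← h1,
      mul_assoc (G.a j), hD,
      mul_smul_comm, smul_smul, ← Complex.exp_add]
    congr 2
    push_cast; ring
  · have h1 := hP.star_a_mul hj (k - 1)
    rw [sub_add_cancel] at h1
    rw [← mul_assoc (P k), hD, smul_mul_assoc, mul_smul_comm, ← mul_assoc (P k) (star (G.a j)), ← h1,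
      mul_assoc (star (G.a j)), hD,
      mul_smul_comm, smul_smul, ← Complex.exp_add]
    congr 2
    push_cast; ring

/-- A charge grading is unique up to a shift. -/
theorem unique (hP : IsGrading G m P) (hP' : IsGrading G m P') : ∃ r : ℤ, ∀ k, P' k = P (k + r) := by
  -- `E` undoes the rotation of the generators by `D`, so `E D` is central and equal to a scalar
  -- `c`. Wherever `P' l * P k ≠ 0` this fixes `exp (i (k - l))`, and with it `k - l`.
  obtain ⟨D, hDm, _, hD, hDa, hDs⟩ := hP.exists_phase 1
  obtain ⟨E, hEm, hE, _, hEa, hEs⟩ := hP'.exists_phase (-1)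
  obtain ⟨c, hc⟩ := factor (G := G) (m := m) (x := E * D) (mem_com
    (fun j hj => by
      rw [mul_assoc, hDa j hj, mul_smul_comm, ← mul_assoc, ← mul_assoc, hEa j hj, smul_mul_assoc,
        smul_smul, ← Complex.exp_add]
      simp)
    (fun j hj => by
      rw [mul_assoc, hDs j hj, mul_smul_comm, ← mul_assoc, ← mul_assoc, hEs j hj, smul_mul_assoc,
        smul_smul, ← Complex.exp_add]
      simp)) (mul_mem_bicom hEm hDm)
  have key : ∀ k l : ℤ, P' l * P k ≠ 0 → Complex.exp (((k - l : ℤ) : ℂ) * Complex.I) = c := by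
    intro k l hne
    have h1 : P' l * (E * D) * P k = Complex.exp (((k - l : ℤ) : ℂ) * Complex.I) • (P' l * P k) := by
      rw [mul_assoc, mul_assoc E, hD, mul_smul_comm, mul_smul_comm, ← mul_assoc (P' l), hE, smul_mul_assoc,
        smul_smul, ← Complex.exp_add]
      congr 2
      push_cast; ring
    rw [hc, mul_smul_comm, mul_one, smul_mul_assoc, ← sub_eq_zero, ← sub_smul, smul_eq_zero] at h1
    exact (sub_eq_zero.1 (h1.resolve_right hne)).symm
  obtain ⟨k₀, hk₀⟩ := hP.exists_ne_zero
  obtain ⟨l₀, hl₀⟩ : ∃ l, P' l * P k₀ ≠ 0 := by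
    by_contra! hc
    exact hk₀ (hP'.ext_op fun l => by rw [hc l, mul_zero])
  have hz : ∀ k l : ℤ, k ≠ l + (k₀ - l₀) → P' l * P k = 0 := by
    intro k l hkl
    by_contra hne
    have := exp_int_mul_I_injective ((key k l hne).trans (key k₀ l₀ hl₀).symm)
    omega
  have hz' : ∀ k l : ℤ, k ≠ l + (k₀ - l₀) → P k * P' l = 0 := by
    intro k l hkl
    have := congrArg star (hz k l hkl)
    rwa [star_mul, hP.star_eq, hP'.star_eq, star_zero] at this
  refine ⟨k₀ - l₀, fun l => ?_⟩
  have h1 : P' l = P (l + (k₀ - l₀)) * P' l := by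
    refine hP.ext_op fun k => ?_
    by_cases hk : k = l + (k₀ - l₀)
    · rw [hk, ← mul_assoc, hP.mul_self]
    · rw [hz' k l hk, ← mul_assoc, hP.orthogonal _ _ hk, zero_mul]
  have h2 : P (l + (k₀ - l₀)) = P' l * P (l + (k₀ - l₀)) := by
    refine hP'.ext_op fun i => ?_
    by_cases hi : i = l
    · rw [hi, ← mul_assoc, hP'.mul_self]
    · rw [hz _ i (by omega), ← mul_assoc, hP'.orthogonal _ _ hi, zero_mul]
  have h3 := congrArg star h2
  rw [star_mul, hP.star_eq, hP'.star_eq] at h3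
  rw [h3]; exact h1

lemma conj_Γ (hP : IsGrading G m P) : IsGrading G m fun k => G.Γ * P k * G.Γ where
  isStarProjection k := by
    refine ⟨?_, ?_⟩
    · simp only [IsIdempotentElem, mul_assoc, Γ_Γ_mul]
      rw [← mul_assoc (P k), hP.mul_self]
    · rw [IsSelfAdjoint, star_mul, star_mul, hP.star_eq, G.star_Γ, mul_assoc]
  mem k := conj_Γ_mem_bicom (hP.mem k)
  orthogonal k l hkl := by
    simp only [mul_assoc, Γ_Γ_mul]
    rw [← mul_assoc (P k), hP.orthogonal k l hkl, zero_mul, mul_zero]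
  a_mul j hj k := by
    have h1 := G.Γ_mul_a j
    have h2 : G.a j * G.Γ = -(G.Γ * G.a j) := by rw [h1, neg_neg]
    rw [← mul_assoc, ← mul_assoc, h2, neg_mul, mul_assoc G.Γ, hP.a_mul j hj, neg_mul, mul_assoc,
      mul_assoc (P (k - 1)), h2, mul_neg, mul_neg, neg_neg]
    simp only [mul_assoc]
  complete h hh := by
    have h1 : G.Γ h = 0 := by
      refine hP.complete _ fun k => ?_
      have := congrArg G.Γ (hh k)
      rw [map_zero] at this
      rw [← this]
      change _ = (G.Γ * (G.Γ * P k * G.Γ)) h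
      rw [mul_assoc, Γ_Γ_mul]; rfl
    have h2 := congrArg (fun z : H →L[ℂ] H => z h) G.Γ_mul_Γ
    simp only [mul_apply_eq_comp, h1, map_zero] at h2
    exact h2.symm

/-- Charge gradings are even. -/
lemma commute_Γ (hP : IsGrading G m P) (k : ℤ) : G.Γ * P k = P k * G.Γ := by
  -- Conjugation by the parity shifts the labels by `s`. It is an involution, so the shift by `2 s`
  -- is trivial and `s = 0`.
  obtain ⟨s, hs⟩ := hP.unique hP.conj_Γ
  have h1 : ∀ k, P k = P (k + s + s) := by
    intro k
    rw [← hs, ← hs]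
    simp only [mul_assoc, Γ_Γ_mul, G.Γ_mul_Γ, mul_one]
  have hs0 : s = 0 := by
    by_contra hne
    obtain ⟨k, hk⟩ := hP.exists_ne_zero
    refine hk ?_
    calc P k = P k * P k := (hP.mul_self k).symm
      _ = P k * P (k + s + s) := by rw [← h1 k]
      _ = 0 := hP.orthogonal _ _ (by omega)
  have h2 := hs k
  rw [hs0, add_zero] at h2
  have h3 := congrArg (G.Γ * ·) h2
  simp only [mul_assoc, Γ_Γ_mul] at h3
  exact h3.symm

lemma commute_a_succ (hP : IsGrading G m P) (k : ℤ) : P k * G.a (m + 1) = G.a (m + 1) * P k :=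
  commute_a_of_even (hP.mem k) (hP.commute_Γ k) (by omega)

lemma commute_star_a_succ (hP : IsGrading G m P) (k : ℤ) :
    P k * star (G.a (m + 1)) = star (G.a (m + 1)) * P k :=
  commute_star_a_of_even (hP.mem k) (hP.commute_Γ k) (by omega)

end IsGrading

/-! ### The number operator of a site -/

variable (G) in
/-- The number operator `a_j* a_j`. -/
def num (j : ℤ) : H →L[ℂ] H := star (G.a j) * G.a j

lemma a_mul_a_self (j : ℤ) : G.a j * G.a j = 0 := by
  have h := G.anti j j
  rw [← two_smul ℂ, smul_eq_zero] at h
  exact h.resolve_left (by norm_num)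

lemma a_mul_star_a_self (j : ℤ) : G.a j * star (G.a j) = 1 - G.num j := by
  have h := G.anti_star j j
  rw [if_pos rfl] at h
  exact eq_sub_of_add_eq h

lemma a_mul_num (j : ℤ) : G.a j * G.num j = G.a j := by
  rw [num, ← mul_assoc, a_mul_star_a_self, sub_mul, one_mul, num, mul_assoc, a_mul_a_self, mul_zero,
    sub_zero]

lemma num_mul_a (j : ℤ) : G.num j * G.a j = 0 := by
  rw [num, mul_assoc, a_mul_a_self, mul_zero]

lemma isStarProjection_num (j : ℤ) : IsStarProjection (G.num j) := by
  refine ⟨?_, by simp [IsSelfAdjoint, num]⟩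
  rw [IsIdempotentElem]
  conv_lhs => rw [num, mul_assoc]; rw [← num, a_mul_num]
  rfl

lemma a_mul_num_of_lt {j k : ℤ} (h : j < k) : G.a j * G.num k = G.num k * G.a j := by
  have h1 : G.a j * star (G.a k) = -(star (G.a k) * G.a j) := by
    have := G.anti_star j k
    rw [if_neg h.ne] at this
    exact eq_neg_of_add_eq_zero_left this
  have h2 : G.a j * G.a k = -(G.a k * G.a j) := eq_neg_of_add_eq_zero_left (G.anti j k)
  rw [num, ← mul_assoc, h1, neg_mul, mul_assoc, h2, mul_neg, neg_neg, mul_assoc]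

namespace IsGrading

variable {P : ℤ → H →L[ℂ] H}

lemma commute_num (hP : IsGrading G m P) (k : ℤ) : P k * G.num (m + 1) = G.num (m + 1) * P k := by
  rw [num, ← mul_assoc, hP.commute_star_a_succ, mul_assoc, hP.commute_a_succ, mul_assoc]

lemma commute_one_sub_num (hP : IsGrading G m P) (k : ℤ) :
    P k * (1 - G.num (m + 1)) = (1 - G.num (m + 1)) * P k := by
  rw [mul_sub, sub_mul, hP.commute_num, one_mul, mul_one]

/-- The extension of a charge grading by one site. -/
lemma extend (hP : IsGrading G m P) : IsGrading G (m + 1) fun k =>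
    P k * (1 - G.num (m + 1)) + P (k - 1) * G.num (m + 1) := by
  have hn := isStarProjection_num (G := G) (m + 1)
  have hnn : G.num (m + 1) * G.num (m + 1) = G.num (m + 1) := hn.isIdempotentElem.eq
  have hz : (1 - G.num (m + 1)) * G.num (m + 1) = 0 := by rw [sub_mul, one_mul, hnn, sub_self]
  have hz' : G.num (m + 1) * (1 - G.num (m + 1)) = 0 := by rw [mul_sub, mul_one, hnn, sub_self]
  have hcc : (1 - G.num (m + 1)) * (1 - G.num (m + 1)) = 1 - G.num (m + 1) := by
    rw [mul_sub, mul_one, hz, sub_zero]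
  -- Gradings are even and so commute with the number operator of the new site; the empty and
  -- occupied halves multiply separately.
  have hprod : ∀ k l, (P k * (1 - G.num (m + 1)) + P (k - 1) * G.num (m + 1))
      * (P l * (1 - G.num (m + 1)) + P (l - 1) * G.num (m + 1))
      = P k * P l * (1 - G.num (m + 1)) + P (k - 1) * P (l - 1) * G.num (m + 1) := by
    intro k l
    rw [add_mul, mul_add, mul_add, hP.commute_one_sub_num l, hP.commute_num (l - 1)]
    rw [show P k * (1 - G.num (m + 1)) * ((1 - G.num (m + 1)) * P l)
        = P k * ((1 - G.num (m + 1)) * (1 - G.num (m + 1))) * P l by simp only [mul_assoc],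
      show P k * (1 - G.num (m + 1)) * (G.num (m + 1) * P (l - 1))
        = P k * ((1 - G.num (m + 1)) * G.num (m + 1)) * P (l - 1) by simp only [mul_assoc],
      show P (k - 1) * G.num (m + 1) * ((1 - G.num (m + 1)) * P l)
        = P (k - 1) * (G.num (m + 1) * (1 - G.num (m + 1))) * P l by simp only [mul_assoc],
      show P (k - 1) * G.num (m + 1) * (G.num (m + 1) * P (l - 1))
        = P (k - 1) * (G.num (m + 1) * G.num (m + 1)) * P (l - 1) by simp only [mul_assoc],
      hz, hz', hcc, hnn]
    simp only [mul_zero, zero_mul, add_zero, zero_add]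
    rw [mul_assoc, ← hP.commute_one_sub_num l, mul_assoc (P (k - 1)), ← hP.commute_num (l - 1)]
    simp only [mul_assoc]
  have hmemn : G.num (m + 1) ∈ G.bicom (m + 1) :=
    mul_mem_bicom (gens_subset_bicom (star_a_mem_gens le_rfl))
      (gens_subset_bicom (a_mem_gens le_rfl))
  have hmem : ∀ k, P k ∈ G.bicom (m + 1) := fun k => bicom_mono (by omega) (hP.mem k)
  refine ⟨fun k => ⟨?_, ?_⟩, fun k => ?_, fun k l hkl => ?_, fun j hj k => ?_, fun h hh => ?_⟩
  · rw [IsIdempotentElem, hprod, hP.mul_self, hP.mul_self]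
  · rw [IsSelfAdjoint, star_add, star_mul, star_mul, hP.star_eq, hP.star_eq, star_sub, star_one,
      hn.isSelfAdjoint.star_eq, hP.commute_one_sub_num, hP.commute_num]
  · exact add_mem_bicom (mul_mem_bicom (hmem k) (sub_mem_bicom one_mem_bicom hmemn))
      (mul_mem_bicom (hmem _) hmemn)
  · rw [hprod, hP.orthogonal k l hkl, hP.orthogonal (k - 1) (l - 1) (by omega), zero_mul, zero_mul,
      add_zero]
  · rcases eq_or_lt_of_le hj with rfl | hj'
    · rw [mul_add, ← mul_assoc, ← mul_assoc, ← hP.commute_a_succ, ← hP.commute_a_succ, add_mul,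
        mul_assoc, mul_assoc, mul_assoc, mul_assoc, mul_sub, mul_one, a_mul_num, sub_self, mul_zero,
        zero_add, sub_mul, one_mul, num_mul_a, sub_zero, mul_zero, add_zero]
    · have hc := a_mul_num_of_lt (G := G) hj'
      rw [mul_add, ← mul_assoc, ← mul_assoc, hP.a_mul j (by omega), hP.a_mul j (by omega), add_mul,
        mul_assoc, mul_assoc, mul_assoc, mul_assoc, mul_sub, sub_mul, hc, mul_one, one_mul]
  -- Multiplying by the number operator or its complement isolates one summand. In the occupied half
  -- the index `k + 1` accounts for the added particle.
  · have h1 : G.num (m + 1) h = 0 := by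
      refine hP.complete _ fun k => ?_
      have e : G.num (m + 1) * (P (k + 1) * (1 - G.num (m + 1)) + P (k + 1 - 1) * G.num (m + 1))
          = P k * G.num (m + 1) := by
        rw [add_sub_cancel_right, mul_add, hP.commute_one_sub_num, ← mul_assoc, hz', zero_mul,
          zero_add, ← mul_assoc, ← hP.commute_num, mul_assoc, hnn]
      have := congrArg (fun z : H →L[ℂ] H => z h) e
      rw [mul_apply_eq_comp, mul_apply_eq_comp, hh (k + 1), map_zero] at this
      exact this.symm
    have h2 : (1 - G.num (m + 1)) h = 0 := by
      refine hP.complete _ fun k => ?_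
      have e : (1 - G.num (m + 1)) * (P k * (1 - G.num (m + 1)) + P (k - 1) * G.num (m + 1))
          = P k * (1 - G.num (m + 1)) := by
        rw [mul_add, hP.commute_num (k - 1), ← mul_assoc (1 - _) (G.num _), hz, zero_mul,
          add_zero, ← mul_assoc, ← hP.commute_one_sub_num, mul_assoc, hcc]
      have := congrArg (fun z : H →L[ℂ] H => z h) e
      rw [mul_apply_eq_comp, mul_apply_eq_comp, hh k, map_zero] at this
      exact this.symm
    rw [sub_apply, h1, sub_zero] at h2
    exact h2

end IsGrading

/-! ### Translated gradings and the alternative at one site. -/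

lemma shift_mul_star_shift :
    (G.shift : H →L[ℂ] H) * star (G.shift : H →L[ℂ] H) = 1 :=
  Unitary.mul_star_self_of_mem G.shift.2

lemma star_shift_mul_shift :
    star (G.shift : H →L[ℂ] H) * (G.shift : H →L[ℂ] H) = 1 :=
  Unitary.star_mul_self_of_mem G.shift.2

lemma star_shift_mul_shift_mul (x : H →L[ℂ] H) :
    star (G.shift : H →L[ℂ] H) * ((G.shift : H →L[ℂ] H) * x) = x := by
  rw [← mul_assoc, star_shift_mul_shift, one_mul]

lemma shift_mul_star_shift_mul (x : H →L[ℂ] H) :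
    (G.shift : H →L[ℂ] H) * (star (G.shift : H →L[ℂ] H) * x) = x := by
  rw [← mul_assoc, shift_mul_star_shift, one_mul]

lemma star_shift_mul_a (j : ℤ) : star (G.shift : H →L[ℂ] H) * G.a (j + 1)
    = G.a j * star (G.shift : H →L[ℂ] H) := by
  have := congrArg (fun z => star (G.shift : H →L[ℂ] H) * z * star (G.shift : H →L[ℂ] H))
    (G.shift_mul_a j)
  simp only [mul_assoc, shift_mul_star_shift, mul_one, star_shift_mul_shift_mul] at this
  exact this.symm

lemma shift_mul_star_a (j : ℤ) : (G.shift : H →L[ℂ] H) * star (G.a j)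
    = star (G.a (j + 1)) * (G.shift : H →L[ℂ] H) := by
  have := congrArg star (star_shift_mul_a (G := G) j)
  rw [star_mul, star_mul, star_star] at this
  exact this.symm

lemma star_shift_conj_mem_com {y : H →L[ℂ] H} (hy : y ∈ G.com (m + 1)) :
    star (G.shift : H →L[ℂ] H) * y * G.shift ∈ G.com m := by
  refine mem_com (fun j hj => ?_) (fun j hj => ?_)
  · rw [← mul_assoc, ← mul_assoc, ← star_shift_mul_a, mul_assoc _ (G.a (j + 1)),
      hy _ (a_mem_gens (by omega : j + 1 ≤ m + 1)), mul_assoc, mul_assoc, ← G.shift_mul_a]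
    simp only [mul_assoc]
  · have h1 : star (G.a j) * star (G.shift : H →L[ℂ] H)
        = star (G.shift : H →L[ℂ] H) * star (G.a (j + 1)) := by
      have := congrArg star (G.shift_mul_a j)
      rwa [star_mul, star_mul] at this
    rw [← mul_assoc, ← mul_assoc, h1, mul_assoc _ (star (G.a (j + 1))),
      hy _ (star_a_mem_gens (by omega : j + 1 ≤ m + 1)), mul_assoc, mul_assoc, ← shift_mul_star_a]
    simp only [mul_assoc]

lemma IsGrading.translate {P : ℤ → H →L[ℂ] H} (hP : IsGrading G m P) :
    IsGrading G (m + 1) fun k => (G.shift : H →L[ℂ] H) * P k * star (G.shift : H →L[ℂ] H) where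
  isStarProjection k := by
    refine ⟨?_, ?_⟩
    · simp only [IsIdempotentElem, mul_assoc, star_shift_mul_shift_mul]
      rw [← mul_assoc (P k), hP.mul_self]
    · rw [IsSelfAdjoint, star_mul, star_mul, hP.star_eq, star_star, mul_assoc]
  mem k y hy := by
    have h := hP.mem k _ (star_shift_conj_mem_com hy)
    have h2 := congrArg (fun z => (G.shift : H →L[ℂ] H) * z * star (G.shift : H →L[ℂ] H)) h
    simp only [mul_assoc, shift_mul_star_shift_mul, shift_mul_star_shift, mul_one] at h2
    simpa only [mul_assoc] using h2
  orthogonal k l hkl := by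
    simp only [mul_assoc, star_shift_mul_shift_mul]
    rw [← mul_assoc (P k), hP.orthogonal k l hkl, zero_mul, mul_zero]
  a_mul j hj k := by
    have h1 := G.shift_mul_a (j - 1)
    have h2 := star_shift_mul_a (G := G) (j - 1)
    rw [sub_add_cancel] at h1 h2
    rw [← mul_assoc, ← mul_assoc, ← h1, mul_assoc _ (G.a (j - 1)), hP.a_mul _ (by omega), mul_assoc,
      mul_assoc, ← h2]
    simp only [mul_assoc]
  complete h hh := by
    have h1 : star (G.shift : H →L[ℂ] H) h = 0 := by
      refine hP.complete _ fun k => ?_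
      have := congrArg (fun v => (star (G.shift : H →L[ℂ] H)) v) (hh k)
      simp only [map_zero] at this
      rw [← this]
      change _ = (star (G.shift : H →L[ℂ] H) * (G.shift * P k * star (G.shift : H →L[ℂ] H))) h
      rw [mul_assoc, star_shift_mul_shift_mul]; rfl
    have h2 := congrArg (fun z : H →L[ℂ] H => z h) (shift_mul_star_shift (G := G))
    simp only [mul_apply_eq_comp, h1, map_zero] at h2
    exact h2.symm

lemma star_shift_Ω : star (G.shift : H →L[ℂ] H) G.Ω = G.Ω := by
  conv_lhs => rw [← G.shift_Ω]
  exact congrArg (fun x : H →L[ℂ] H => x G.Ω) (star_shift_mul_shift (G := G))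

lemma norm_sq_split {n : H →L[ℂ] H} (hn : IsStarProjection n) {x y : H} (hx : n x = 0)
    (hy : n y = y) : ‖x + y‖ ^ 2 = ‖x‖ ^ 2 + ‖y‖ ^ 2 := by
  have h : ⟪x, y⟫_ℂ = 0 := by
    rw [← hy, ← hn.isSelfAdjoint.star_eq, ContinuousLinearMap.star_eq_adjoint,
      ContinuousLinearMap.adjoint_inner_right, hx, inner_zero_left]
  have := norm_add_sq_eq_norm_sq_add_norm_sq_of_inner_eq_zero x y h
  simpa only [pow_two] using this

/-- If a half line has a charge grading, the next site is empty or occupied. -/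
theorem IsGrading.a_Ω_eq_zero_or {P : ℤ → H →L[ℂ] H} (hP : IsGrading G m P) :
    G.a (m + 1) G.Ω = 0 ∨ star (G.a (m + 1)) G.Ω = 0 := by
  -- Two gradings of the half line `j ≤ m + 1`, one extended by the new site and one translated,
  -- differ by a shift `r`.
  obtain ⟨r, hr⟩ := hP.extend.unique hP.translate
  set n := G.num (m + 1) with hndef
  have hn : IsStarProjection n := isStarProjection_num (G := G) (m + 1)
  have hnn : n * n = n := hn.isIdempotentElem.eq
  have hv1 : ∀ k, n (P k ((1 - n) G.Ω)) = 0 := fun k => by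
    have e : n * P k * (1 - n) = 0 := by
      rw [← hP.commute_num, mul_assoc, mul_sub, mul_one, hnn, sub_self, mul_zero]
    exact congrArg (fun z : H →L[ℂ] H => z G.Ω) e
  have hv2 : ∀ k, n (P k (n G.Ω)) = P k (n G.Ω) := fun k => by
    have e : n * P k * n = P k * n := by rw [← hP.commute_num, mul_assoc, hnn]
    exact congrArg (fun z : H →L[ℂ] H => z G.Ω) e
  -- Since `Ω` is translation invariant, the translated grading has in `Ω` the weights of `P`. Each
  -- weight splits into the contributions of the empty and the occupied site, which are orthogonal.
  have hrec : ∀ k, ‖P k ((1 - n) G.Ω)‖ ^ 2 + ‖P k (n G.Ω)‖ ^ 2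
      = ‖P (k + r) ((1 - n) G.Ω)‖ ^ 2 + ‖P (k + r - 1) (n G.Ω)‖ ^ 2 := by
    intro k
    rw [← norm_sq_split hn (hv1 k) (hv2 k), ← norm_sq_split hn (hv1 (k + r)) (hv2 (k + r - 1)),
      ← map_add, sub_apply, sub_add_cancel]
    have h1 := congrArg (fun z : H →L[ℂ] H => ‖z G.Ω‖) (hr k)
    simp only [mul_apply_eq_comp, star_shift_Ω, norm_unitary_apply, add_apply] at h1
    exact congrArg (· ^ 2) h1
  have hs : ∀ v, Summable fun k => ‖P k v‖ ^ 2 := fun v =>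
    summable_of_sum_le (fun _ => by positivity)
      fun F => sum_norm_sq_le hP.isStarProjection hP.orthogonal F v
  have hΩ : ∀ x : H →L[ℂ] H, (star x * x) G.Ω = 0 → x G.Ω = 0 := by
    intro x hx
    rw [← inner_self_eq_zero (𝕜 := ℂ), ← ContinuousLinearMap.adjoint_inner_right,
      ← ContinuousLinearMap.star_eq_adjoint]
    change ⟪G.Ω, (star x * x) G.Ω⟫_ℂ = 0
    rw [hx, inner_zero_right]
  rcases eq_zero_or_eq_zero_of_shift (a := fun k => ‖P k ((1 - n) G.Ω)‖ ^ 2)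
    (b := fun k => ‖P k (n G.Ω)‖ ^ 2) (fun _ => by positivity) (fun _ => by positivity)
    (hs _) (hs _) hrec with h | h
  · left
    refine hΩ _ (hP.complete _ fun k => ?_)
    exact norm_eq_zero.1 ((pow_eq_zero_iff two_ne_zero).1 (h k))
  · right
    refine hΩ _ (hP.complete _ fun k => ?_)
    rw [star_star, a_mul_star_a_self]
    exact norm_eq_zero.1 ((pow_eq_zero_iff two_ne_zero).1 (h k))

/-- If the von Neumann algebra of a half line has a nonzero abelian projection, then the next site
is empty or occupied. -/
theorem a_Ω_eq_zero_or_of_abelian {e : H →L[ℂ] H} (hem : e ∈ G.bicom m) (he : IsStarProjection e)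
    (hab : ∀ x ∈ G.bicom m, ∀ y ∈ G.bicom m, Commute (e * x * e) (e * y * e)) (h0 : e ≠ 0) :
    G.a (m + 1) G.Ω = 0 ∨ star (G.a (m + 1)) G.Ω = 0 := by
  obtain ⟨p, h1, h2, h3, h4⟩ := exists_minimal_com hem he hab h0
  obtain ⟨P, hP⟩ := IsMinimalCom.exists_grading (⟨h1, h2, h3, h4⟩ : IsMinimalCom G m p)
  exact hP.a_Ω_eq_zero_or

end GaugeChain

end

end FermionChain

namespace FermionChain

noncomputable section

/-! ### The GNS representation of a state -/

section GNS

variable {A : Type} [CStarAlgebra A]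

attribute [local instance] CStarAlgebra.spectralOrder CStarAlgebra.spectralOrderedRing

namespace IsState

variable {φ : A →ₗ[ℂ] ℂ} (h : IsState φ)

/-- The vector `π(a) Ω` of the GNS space. -/
def vec : A →ₗ[ℂ] h.GNS where
  toFun a := ((h.toPositive.toPreGNS a : h.toPositive.PreGNS) : h.GNS)
  map_add' a b := by rw [map_add, UniformSpace.Completion.coe_add]
  map_smul' s a := by rw [map_smul, UniformSpace.Completion.coe_smul]; rfl

lemma inner_vec (a b : A) : ⟪h.vec a, h.vec b⟫_ℂ = φ (star a * b) :=
  UniformSpace.Completion.inner_coe _ _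

lemma gnsRep_vec (a b : A) : h.gnsRep a (h.vec b) = h.vec (a * b) :=
  h.toPositive.gnsNonUnitalStarAlgHom_apply_coe

lemma denseRange_vec : DenseRange h.vec :=
  UniformSpace.Completion.denseRange_coe (α := h.toPositive.PreGNS)

lemma norm_vec_sq (a : A) : ‖h.vec a‖ ^ 2 = (φ (star a * a)).re := by
  rw [← h.inner_vec]; exact norm_sq_eq_re_inner (𝕜 := ℂ) _

lemma ofReal_norm_vec_sq (a : A) : ((‖h.vec a‖ ^ 2 : ℝ) : ℂ) = φ (star a * a) := by
  rw [← h.inner_vec, inner_self_eq_norm_sq_to_K]; simp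

lemma gnsRep_vec_one (a : A) : h.gnsRep a (h.vec 1) = h.vec a := by rw [gnsRep_vec, mul_one]

lemma norm_vec_one : ‖h.vec 1‖ = 1 := by
  have := h.norm_vec_sq 1
  rw [star_one, one_mul, h.2, Complex.one_re] at this
  exact (pow_eq_one_iff_of_nonneg (norm_nonneg _) two_ne_zero).1 this

lemma apply_eq_inner (a : A) : φ a = ⟪h.vec 1, h.gnsRep a (h.vec 1)⟫_ℂ := by
  rw [gnsRep_vec_one, inner_vec, star_one, one_mul]

lemma continuous_gnsRep : Continuous h.gnsRep := map_continuous h.gnsRep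

lemma continuous (h : IsState φ) : Continuous φ := by
  have h1 : (φ : A → ℂ) = fun a => ⟪h.vec 1, h.gnsRep a (h.vec 1)⟫_ℂ := funext h.apply_eq_inner
  rw [h1]
  have := h.continuous_gnsRep
  fun_prop

variable {K : Type*} [NormedAddCommGroup K] [InnerProductSpace ℂ K]

lemma ext_vec {x y : h.GNS →L[ℂ] K} (hxy : ∀ a, x (h.vec a) = y (h.vec a)) : x = y :=
  ContinuousLinearMap.ext fun v =>
    congrFun (h.denseRange_vec.equalizer x.continuous y.continuous (funext hxy)) v

lemma ext_inner {x y : h.GNS →L[ℂ] h.GNS}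
    (hxy : ∀ a b, ⟪h.vec a, x (h.vec b)⟫_ℂ = ⟪h.vec a, y (h.vec b)⟫_ℂ) : x = y := by
  refine h.ext_vec fun b => h.denseRange_vec.eq_of_inner_right ℂ fun a => hxy a b

/-- A linear map dominated by the GNS seminorm defines a bounded operator on the GNS space. -/
lemma exists_extend [CompleteSpace K] (f : A →ₗ[ℂ] K) (hf : ∀ a, ‖f a‖ ≤ ‖h.vec a‖) :
    ∃ J : h.GNS →L[ℂ] K, ∀ a, J (h.vec a) = f a := by
  let g : h.toPositive.PreGNS →L[ℂ] K :=
    (f ∘ₗ h.toPositive.ofPreGNS.toLinearMap).mkContinuous 1 fun x => by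
      rw [one_mul, ← UniformSpace.Completion.norm_coe x]
      exact hf (h.toPositive.ofPreGNS x)
  refine ⟨g.extend (UniformSpace.Completion.toComplL (𝕜 := ℂ)), fun a => ?_⟩
  exact g.extend_eq UniformSpace.Completion.denseRange_coe
    (UniformSpace.Completion.isUniformInducing_coe _) (h.toPositive.toPreGNS a)

/-- An automorphism that preserves a state is implemented by a unitary. -/
lemma exists_implementer (β β' : A →⋆ₐ[ℂ] A) (h1 : ∀ a, β (β' a) = a) (h2 : ∀ a, β' (β a) = a)
    (hβ : ∀ a, φ (β a) = φ a) : ∃ u : unitary (h.GNS →L[ℂ] h.GNS),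
      ∀ a, (u : h.GNS →L[ℂ] h.GNS) (h.vec a) = h.vec (β a) := by
  have hβ' : ∀ a, φ (β' a) = φ a := fun a => by rw [← hβ, h1]
  have key : ∀ β : A →⋆ₐ[ℂ] A, (∀ a, φ (β a) = φ a) → ∃ J : h.GNS →L[ℂ] h.GNS,
      ∀ a, J (h.vec a) = h.vec (β a) := fun β hβ =>
    h.exists_extend (h.vec ∘ₗ (β : A →ₗ[ℂ] A)) fun a => by
      have e : ‖h.vec (β a)‖ ^ 2 = ‖h.vec a‖ ^ 2 := by
        rw [norm_vec_sq, norm_vec_sq, ← map_star β, ← map_mul β, hβ]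
      exact ((pow_left_inj₀ (norm_nonneg _) (norm_nonneg _) two_ne_zero).1 e).le
  obtain ⟨J, hJ⟩ := key β hβ
  obtain ⟨J', hJ'⟩ := key β' hβ'
  have hs : star J = J' := h.ext_inner fun a b => by
    rw [ContinuousLinearMap.star_eq_adjoint, ContinuousLinearMap.adjoint_inner_right, hJ, hJ',
      inner_vec, inner_vec, ← hβ (star a * β' b), map_mul β, map_star β, h1]
  refine ⟨⟨J, Unitary.mem_iff.2 ⟨?_, ?_⟩⟩, hJ⟩
  · rw [hs]; exact h.ext_vec fun a => by rw [mul_apply_eq_comp, hJ, hJ', h2]; rfl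
  · rw [hs]; exact h.ext_vec fun a => by rw [mul_apply_eq_comp, hJ', hJ, h1]; rfl

lemma implementer_mul {β : A →⋆ₐ[ℂ] A} {u : h.GNS →L[ℂ] h.GNS}
    (hu : ∀ a, u (h.vec a) = h.vec (β a)) (a : A) :
    u * h.gnsRep a = h.gnsRep (β a) * u := h.ext_vec fun b => by
  rw [mul_apply_eq_comp, mul_apply_eq_comp, gnsRep_vec, hu, hu, gnsRep_vec, map_mul]

end IsState

namespace IsPureState

variable {φ : A →ₗ[ℂ] ℂ}

lemma eq_of_convex (h : IsPureState φ) {ω₁ ω₂ : A →ₗ[ℂ] ℂ} (h₁ : IsState ω₁) (h₂ : IsState ω₂)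
    {t : ℝ} (h0 : 0 < t) (h1 : t < 1) (hφ : t • ω₁ + (1 - t) • ω₂ = φ) : ω₁ = φ :=
  (mem_extremePoints.1 h).2 _ h₁ _ h₂ ⟨t, 1 - t, h0, by linarith, by ring, hφ⟩ |>.1

/-- The functional `ω a = ⟪Ω, S a Ω⟫` and its complement `φ - ω` are positive because `S` and `1 -
S` are positive and commute with the representation. The bounds make both nonzero, so `φ` is a
proper convex combination of their normalizations. Purity gives `ω = t φ`, which means that `S` is
the scalar `t`. -/
lemma scalar_of_bounds (h : IsPureState φ) (hs : IsState φ) {S : hs.GNS →L[ℂ] hs.GNS}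
    (hS : IsSelfAdjoint S) (hc : ∀ a, Commute S (hs.gnsRep a))
    (hb : ∀ v, (1 / 4 : ℝ) * ‖v‖ ^ 2 ≤ (⟪v, S v⟫_ℂ).re ∧ (⟪v, S v⟫_ℂ).re ≤ (3 / 4 : ℝ) * ‖v‖ ^ 2) :
    ∃ s : ℂ, S = s • 1 := by
  have him : ∀ v, (⟪v, S v⟫_ℂ).im = 0 := hS.isSymmetric.im_inner_self_apply
  let ω : A →ₗ[ℂ] ℂ := ((innerSL ℂ (hs.vec 1)).comp S).toLinearMap ∘ₗ hs.vec
  have hω : ∀ a b, ω (star a * b) = ⟪hs.vec a, S (hs.vec b)⟫_ℂ := fun a b => by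
    change ⟪hs.vec 1, S (hs.vec (star a * b))⟫_ℂ = _
    rw [← hs.gnsRep_vec, ← mul_apply_eq_comp, (hc (star a)).eq, mul_apply_eq_comp, map_star,
      ContinuousLinearMap.star_eq_adjoint, ContinuousLinearMap.adjoint_inner_right,
      hs.gnsRep_vec_one]
  set t : ℝ := (⟪hs.vec 1, S (hs.vec 1)⟫_ℂ).re with ht
  have hω1 : ω 1 = (t : ℂ) := Complex.ext rfl (him _)
  have hb1 := hb (hs.vec 1)
  rw [hs.norm_vec_one, ← ht] at hb1
  have ht0 : 0 < t := by linarith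
  have ht1 : t < 1 := by linarith
  have hp : ∀ a, 0 ≤ ω (star a * a) := fun a => by
    rw [hω, Complex.nonneg_iff]
    exact ⟨by nlinarith [hb (hs.vec a), sq_nonneg ‖hs.vec a‖], (him _).symm⟩
  have hp' : ∀ a, 0 ≤ φ (star a * a) - ω (star a * a) := fun a => by
    rw [hω, ← hs.ofReal_norm_vec_sq, Complex.nonneg_iff]
    refine ⟨?_, by rw [Complex.sub_im, him, Complex.ofReal_im, sub_zero]⟩
    rw [Complex.sub_re, Complex.ofReal_re]
    nlinarith [hb (hs.vec a), sq_nonneg ‖hs.vec a‖]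
  have hne : (t : ℂ) ≠ 0 := by exact_mod_cast ht0.ne'
  have hne' : (1 - t : ℂ) ≠ 0 := by exact_mod_cast (sub_pos.2 ht1).ne'
  have key := h.eq_of_convex (ω₁ := (t : ℂ)⁻¹ • ω) (ω₂ := (1 - t : ℂ)⁻¹ • (φ - ω)) (t := t)
    ⟨fun a => by
      rw [LinearMap.smul_apply, smul_eq_mul]
      refine mul_nonneg ?_ (hp a)
      rw [← Complex.ofReal_inv]
      exact Complex.zero_le_real.2 (by positivity),
      by rw [LinearMap.smul_apply, hω1, smul_eq_mul, inv_mul_cancel₀ hne]⟩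
    ⟨fun a => by
      rw [LinearMap.smul_apply, smul_eq_mul]
      refine mul_nonneg ?_ (hp' a)
      rw [← Complex.ofReal_one, ← Complex.ofReal_sub, ← Complex.ofReal_inv]
      exact Complex.zero_le_real.2 (inv_nonneg.2 (by linarith)),
      by rw [LinearMap.smul_apply, LinearMap.sub_apply, hω1, hs.2, smul_eq_mul,
        inv_mul_cancel₀ hne']⟩ ht0 ht1 (by
      refine LinearMap.ext fun a => ?_
      simp only [LinearMap.add_apply, LinearMap.smul_apply, LinearMap.sub_apply, smul_eq_mul,
        Complex.real_smul, Complex.ofReal_sub, Complex.ofReal_one]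
      field_simp
      ring)
  refine ⟨t, hs.ext_inner fun a b => ?_⟩
  rw [← hω, smul_apply, inner_smul_right, one_apply_eq_self, hs.inner_vec, ← key,
    LinearMap.smul_apply, smul_eq_mul, mul_inv_cancel_left₀ hne]

/-- The GNS representation of a pure state is irreducible. -/
theorem scalar_of_commute (h : IsPureState φ) {x : h.isState.GNS →L[ℂ] h.isState.GNS}
    (hc : ∀ a, Commute x (h.isState.gnsRep a)) : ∃ s : ℂ, x = s • 1 := by
  have sa : ∀ y : h.isState.GNS →L[ℂ] h.isState.GNS, IsSelfAdjoint y →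
      (∀ a, Commute y (h.isState.gnsRep a)) → ∃ s : ℂ, y = s • 1 := by
    intro y hy hyc
    -- Scaled so that `1/2 + r y` lies between `1/4` and `3/4`.
    set r : ℝ := (4 * (‖y‖ + 1))⁻¹ with hr
    have hn := norm_nonneg y
    have hr0 : 0 < r := by positivity
    have hrb : r * ‖y‖ ≤ 1 / 4 := by
      rw [hr, inv_mul_le_iff₀ (by positivity)]; linarith
    obtain ⟨s, hs⟩ := h.scalar_of_bounds h.isState (S := (1 / 2 : ℂ) • 1 + (r : ℂ) • y)
      (by
        rw [IsSelfAdjoint, star_add, star_smul, star_smul, star_one, hy.star_eq]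
        simp)
      (fun a => ((Commute.one_left _).smul_left _).add_left ((hyc a).smul_left _))
      (fun v => by
        have h1 : |(⟪v, y v⟫_ℂ).re| ≤ ‖y‖ * ‖v‖ ^ 2 := by
          refine (Complex.abs_re_le_norm _).trans ((norm_inner_le_norm _ _).trans ?_)
          nlinarith [y.le_opNorm v, norm_nonneg v]
        have h2 : (⟪v, ((1 / 2 : ℂ) • 1 + (r : ℂ) • y : h.isState.GNS →L[ℂ] h.isState.GNS) v⟫_ℂ).re
            = 1 / 2 * ‖v‖ ^ 2 + r * (⟪v, y v⟫_ℂ).re := by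
          rw [add_apply, smul_apply, smul_apply, inner_add_right, inner_smul_right,
            inner_smul_right, one_apply_eq_self, inner_self_eq_norm_sq_to_K, Complex.add_re,
            Complex.re_ofReal_mul]
          congr 1
          change ((1 / 2 : ℂ) * ((‖v‖ : ℝ) : ℂ) ^ 2).re = _
          rw [show ((‖v‖ : ℂ) ^ 2) = ((‖v‖ ^ 2 : ℝ) : ℂ) by push_cast; rfl,
            show (1 / 2 : ℂ) = ((1 / 2 : ℝ) : ℂ) by push_cast; rfl, Complex.re_ofReal_mul,
            Complex.ofReal_re]
        rw [h2]
        have h3 := abs_le.1 h1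
        have h4 := mul_le_mul_of_nonneg_right hrb (sq_nonneg ‖v‖)
        constructor <;> nlinarith)
    refine ⟨(r : ℂ)⁻¹ * (s - 1 / 2), ?_⟩
    have hne : (r : ℂ) ≠ 0 := by exact_mod_cast hr0.ne'
    rw [mul_smul, sub_smul, ← hs, add_sub_cancel_left, smul_smul, inv_mul_cancel₀ hne, one_smul]
  have hc' : ∀ a, Commute (star x) (h.isState.gnsRep a) := fun a => by
    have := (hc (star a)).star_star
    rwa [← map_star, star_star] at this
  obtain ⟨s₁, hs₁⟩ := sa (x + star x) (IsSelfAdjoint.add_star_self x)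
    fun a => (hc a).add_left (hc' a)
  obtain ⟨s₂, hs₂⟩ := sa (Complex.I • (x - star x))
    (by
      rw [IsSelfAdjoint, star_smul, star_sub, star_star, Complex.star_def, Complex.conj_I, neg_smul,
        ← smul_neg, neg_sub])
    fun a => ((hc a).sub_left (hc' a)).smul_left _
  refine ⟨(1 / 2 : ℂ) * (s₁ - Complex.I * s₂), ?_⟩
  rw [mul_smul, sub_smul, mul_smul, ← hs₁, ← hs₂, smul_smul, Complex.I_mul_I]
  module

end IsPureState

end GNS

end

end FermionChain

namespace FermionChain

noncomputable section

/-! ### The CAR algebra in the GNS representation of an invariant pure state -/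

section Bridge

/-- A closed *-subalgebra that contains all `c_j` is everything. -/
lemma mem_of_forall_c_mem {B : StarSubalgebra ℂ carAlgebra} (hB : IsClosed (B : Set carAlgebra))
    (h : ∀ j, c j ∈ B) (a : carAlgebra) : a ∈ B := by
  -- The CAR algebra is a closure taken in `Op`. As it is closed there, so is the image of `B`, and
  -- minimality of the closure applies.
  have h1 : carAlgebra ≤ B.map carAlgebra.subtype := by
    refine StarSubalgebra.topologicalClosure_minimal (StarAlgebra.adjoin_le ?_) ?_
    · rintro _ ⟨j, rfl⟩
      exact ⟨c j, h j, rfl⟩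
    · exact (Topology.IsClosedEmbedding.isClosedMap
        (IsClosed.isClosedEmbedding_subtypeVal carAlgebra_isClosed)) _ hB
  obtain ⟨b, hb, hba⟩ := h1 a.2
  rwa [← Subtype.ext hba]

lemma topologicalClosure_adjoin_c :
    (StarAlgebra.adjoin ℂ (Set.range c)).topologicalClosure = ⊤ :=
  top_unique fun a _ => mem_of_forall_c_mem (StarSubalgebra.isClosed_topologicalClosure _)
    (fun j => StarSubalgebra.le_topologicalClosure _ (StarAlgebra.subset_adjoin ℂ _ (Set.mem_range_self j))) a

lemma c_anticomm (j k : ℤ) : c j * c k + c k * c j = 0 := Subtype.ext (annih_anticomm j k)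

lemma c_anticomm_star (j k : ℤ) :
    c j * star (c k) + star (c k) * c j = if j = k then 1 else 0 := by
  refine Subtype.ext ((annih_anticomm_star j k).trans ?_)
  split_ifs <;> rfl

lemma shiftU_mul_shiftU_neg (n : ℤ) : shiftU n * shiftU (-n) = 1 := by
  refine Subtype.ext (op_ext fun f S => ?_)
  change (1 : ℂ) * (1 * f (translate (- -n) (translate (-n) S))) = f S
  rw [one_mul, one_mul]
  rw [show translate (- -n) (translate (-n) S) = S by ext i; simp [mem_translate]]

lemma gaugeU_mul_gaugeU_neg (θ : ℝ) : gaugeU θ * gaugeU (-θ) = 1 := by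
  refine Subtype.ext (op_ext fun f S => ?_)
  change Complex.exp (θ * Complex.I) ^ S.card * (Complex.exp ((-θ : ℝ) * Complex.I) ^ S.card * f S)
    = f S
  rw [← mul_assoc, ← mul_pow, ← Complex.exp_add]
  simp

lemma restrictAd_restrictAd {B : StarSubalgebra ℂ Op} {u v : unitary Op} (huv : u * v = 1)
    (hu : ∀ Q ∈ B, Ad u Q ∈ B) (hv : ∀ Q ∈ B, Ad v Q ∈ B) (Q : B) :
    restrictAd B u hu (restrictAd B v hv Q) = Q := by
  refine Subtype.ext ?_
  change Ad u (Ad v (Q : Op)) = Q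
  rw [← Unitary.conjStarAlgAut_mul_apply, huv, map_one]
  rfl

lemma carShift_carShift_neg (n : ℤ) (a : carAlgebra) : carShift n (carShift (-n) a) = a :=
  restrictAd_restrictAd (shiftU_mul_shiftU_neg n) _ _ a

lemma carShift_neg_carShift (n : ℤ) (a : carAlgebra) : carShift (-n) (carShift n a) = a := by
  simpa using carShift_carShift_neg (-n) a

lemma carGauge_carGauge_neg (θ : ℝ) (a : carAlgebra) : carGauge θ (carGauge (-θ) a) = a :=
  restrictAd_restrictAd (gaugeU_mul_gaugeU_neg θ) _ _ a

lemma carGauge_neg_carGauge (θ : ℝ) (a : carAlgebra) : carGauge (-θ) (carGauge θ a) = a := by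
  simpa using carGauge_carGauge_neg (-θ) a

/-- A family with canonical anticommutation relations that generates a C*-algebra, with gauge
automorphisms and a translation. -/
structure FermionSystem (A : Type) [CStarAlgebra A] where
  /-- The annihilation operators. -/
  b : ℤ → A
  anti : ∀ j k, b j * b k + b k * b j = 0
  anti_star : ∀ j k, b j * star (b k) + star (b k) * b j = if j = k then 1 else 0
  gen : (StarAlgebra.adjoin ℂ (Set.range b)).topologicalClosure = ⊤
  /-- The gauge automorphisms. -/
  γ : ℝ → A →⋆ₐ[ℂ] A
  γ_γ_neg : ∀ θ a, γ θ (γ (-θ) a) = a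
  γ_neg_γ : ∀ θ a, γ (-θ) (γ θ a) = a
  γ_b : ∀ θ j, γ θ (b j) = Complex.exp (-(θ * Complex.I)) • b j
  /-- The translations. -/
  τ : ℤ → A →⋆ₐ[ℂ] A
  τ_τ_neg : ∀ n a, τ n (τ (-n) a) = a
  τ_neg_τ : ∀ n a, τ (-n) (τ n a) = a
  τ_b : ∀ n j, τ n (b j) = b (j + n)

/-- The CAR algebra. -/
def carSystem : FermionSystem carAlgebra where
  b := c
  anti := c_anticomm
  anti_star := c_anticomm_star
  gen := topologicalClosure_adjoin_c
  γ := carGauge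
  γ_γ_neg := carGauge_carGauge_neg
  γ_neg_γ := carGauge_neg_carGauge
  γ_b := carGauge_c
  τ := carShift
  τ_τ_neg := carShift_carShift_neg
  τ_neg_τ := carShift_neg_carShift
  τ_b := carShift_c

end Bridge

/-! ### Gauge chains of invariant pure states. -/

section FermionSystem

variable {A : Type} [CStarAlgebra A]

/-- An operator that commutes with the represented generators and their adjoints commutes with the
closed *-algebra they generate. -/
lemma IsState.commute_gnsRep_of_mem {ψ : A →ₗ[ℂ] ℂ} (h : IsState ψ) {s : Set A}
    {x : h.GNS →L[ℂ] h.GNS} (h1 : ∀ b ∈ s, Commute x (h.gnsRep b))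
    (h2 : ∀ b ∈ s, Commute x (star (h.gnsRep b))) {a : A}
    (ha : a ∈ (StarAlgebra.adjoin ℂ s).topologicalClosure) : Commute x (h.gnsRep a) := by
  have hle : (StarAlgebra.adjoin ℂ s).topologicalClosure ≤
      (StarSubalgebra.centralizer ℂ {x}).comap h.gnsRep := by
    refine StarSubalgebra.topologicalClosure_minimal (StarAlgebra.adjoin_le fun b hb => ?_) ?_
    · refine (StarSubalgebra.mem_centralizer_iff ℂ).2 ?_
      rintro _ rfl
      refine ⟨h1 b hb, ?_⟩
      have := congrArg star (h2 b hb).eq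
      rw [star_mul, star_mul, star_star] at this
      exact this.symm
    · have e : ((StarSubalgebra.centralizer ℂ {x}).comap h.gnsRep : Set A)
          = h.gnsRep ⁻¹' ({y | x * y = y * x} ∩ {y | star x * y = y * star x}) := by
        ext a
        change (h.gnsRep a ∈ StarSubalgebra.centralizer ℂ {x}) ↔ _
        rw [StarSubalgebra.mem_centralizer_iff]
        simp
      rw [e]
      refine IsClosed.preimage h.continuous_gnsRep (IsClosed.inter ?_ ?_)
      · exact isClosed_eq (continuous_const_mul x) (continuous_mul_const x)
      · exact isClosed_eq (continuous_const_mul _) (continuous_mul_const _)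
  exact ((StarSubalgebra.mem_centralizer_iff ℂ).1 (hle ha) x rfl).1

namespace FermionSystem

variable {F : FermionSystem A} {ψ : A →ₗ[ℂ] ℂ}

/-- The gauge chain of the GNS representation of an invariant pure state. -/
def gaugeChain (F : FermionSystem A) (hψ : IsPureState ψ) (hτ : ∀ n a, ψ (F.τ n a) = ψ a)
    (hγ : ∀ θ a, ψ (F.γ θ a) = ψ a) : GaugeChain hψ.isState.GNS :=
  have hU := fun θ => hψ.isState.exists_implementer (F.γ θ) (F.γ (-θ))
    (F.γ_γ_neg θ) (F.γ_neg_γ θ) (hγ θ)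
  have hS := hψ.isState.exists_implementer (F.τ 1) (F.τ (-1)) (F.τ_τ_neg 1) (F.τ_neg_τ 1) (hτ 1)
  { a := fun j => hψ.isState.gnsRep (F.b j)
    anti := fun j k => by rw [← map_mul, ← map_mul, ← map_add, F.anti, map_zero]
    anti_star := fun j k => by
      rw [← map_star, ← map_mul, ← map_mul, ← map_add, F.anti_star]
      split_ifs
      · rw [map_one]
      · rw [map_zero]
    U := fun θ => (hU θ).choose
    U_mul_a := fun θ j => by
      rw [hψ.isState.implementer_mul (hU θ).choose_spec, F.γ_b, map_smul, smul_mul_assoc]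
    shift := hS.choose
    shift_mul_a := fun j => by
      rw [hψ.isState.implementer_mul hS.choose_spec, F.τ_b]
    Ω := hψ.isState.vec 1
    norm_Ω := hψ.isState.norm_vec_one
    U_Ω := fun θ => by rw [(hU θ).choose_spec, map_one]
    shift_Ω := by rw [hS.choose_spec, map_one]
    irreducible := fun x h1 h2 => hψ.scalar_of_commute fun a =>
      hψ.isState.commute_gnsRep_of_mem (s := Set.range F.b)
        (by rintro _ ⟨j, rfl⟩; exact h1 j) (by rintro _ ⟨j, rfl⟩; exact h2 j)
        (by rw [F.gen]; trivial) }

variable (hψ : IsPureState ψ) (hτ : ∀ n a, ψ (F.τ n a) = ψ a) (hγ : ∀ θ a, ψ (F.γ θ a) = ψ a)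

lemma gaugeChain_a (j : ℤ) : (F.gaugeChain hψ hτ hγ).a j = hψ.isState.gnsRep (F.b j) := rfl

lemma gaugeChain_U_vec (θ : ℝ) (a : A) :
    ((F.gaugeChain hψ hτ hγ).U θ : hψ.isState.GNS →L[ℂ] hψ.isState.GNS) (hψ.isState.vec a)
      = hψ.isState.vec (F.γ θ a) :=
  (hψ.isState.exists_implementer (F.γ θ) (F.γ (-θ))
    (F.γ_γ_neg θ) (F.γ_neg_γ θ) (hγ θ)).choose_spec a

/-- The C*-subalgebra of a half line. -/
def halfLine (F : FermionSystem A) (m : ℤ) : StarSubalgebra ℂ A :=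
  (StarAlgebra.adjoin ℂ (F.b '' Set.Iic m)).topologicalClosure

/-- Commuting with the generators and their adjoints extends to the closed algebra by continuity.
This identifies the von Neumann algebra of the type I hypothesis with the half-line algebra of the
gauge chain. -/
lemma centralizer_halfLine (m : ℤ) :
    Set.centralizer (((F.halfLine m).map hψ.isState.gnsRep :
      StarSubalgebra ℂ (hψ.isState.GNS →L[ℂ] hψ.isState.GNS)) :
        Set (hψ.isState.GNS →L[ℂ] hψ.isState.GNS)) = (F.gaugeChain hψ hτ hγ).com m := by
  ext x
  constructor
  · intro hx
    have hmem : ∀ j ≤ m, F.b j ∈ F.halfLine m := fun j hj =>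
      StarSubalgebra.le_topologicalClosure _ (StarAlgebra.subset_adjoin ℂ _ ⟨j, hj, rfl⟩)
    refine GaugeChain.mem_com (fun j hj => hx _ ⟨F.b j, hmem j hj, rfl⟩) fun j hj => ?_
    rw [gaugeChain_a, ← map_star]
    exact hx _ ⟨star (F.b j), (F.halfLine m).star_mem' (hmem j hj), rfl⟩
  · rintro hx _ ⟨a, ha, rfl⟩
    refine (hψ.isState.commute_gnsRep_of_mem (s := F.b '' Set.Iic m) ?_ ?_ ha).eq.symm
    · rintro _ ⟨j, hj, rfl⟩
      exact (hx _ (GaugeChain.a_mem_gens hj)).symm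
    · rintro _ ⟨j, hj, rfl⟩
      exact (hx _ (GaugeChain.star_a_mem_gens hj)).symm

lemma mem_bicommutant_iff (m : ℤ) (x : hψ.isState.GNS →L[ℂ] hψ.isState.GNS) :
    x ∈ bicommutant ((F.halfLine m).map hψ.isState.gnsRep) ↔
      x ∈ (F.gaugeChain hψ hτ hγ).bicom m := by
  rw [← SetLike.mem_coe, coe_bicommutant, centralizer_halfLine hψ hτ hγ]
  rfl

/-- If the von Neumann algebra of a half line is of type I, the state is annihilated by all
annihilation operators or by all creation operators. -/
theorem vanishing_of_typeI (hτ : ∀ n a, ψ (F.τ n a) = ψ a) (hγ : ∀ θ a, ψ (F.γ θ a) = ψ a)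
    (hI : IsTypeI (bicommutant ((F.halfLine 0).map hψ.isState.gnsRep))) :
    (∀ j, ψ (star (F.b j) * F.b j) = 0) ∨ ∀ j, ψ (F.b j * star (F.b j)) = 0 := by
  have : Nontrivial hψ.isState.GNS := ⟨_, 0, (F.gaugeChain hψ hτ hγ).Ω_ne_zero⟩
  -- Only the central projection `1` is needed: any nonzero abelian projection will do.
  obtain ⟨e, ⟨he1, he2, he3⟩, he0, -⟩ := hI 1 (one_mem _) (one_mem _) (IsStarProjection.one _)
    one_ne_zero
  -- The alternative is obtained at the site `0 + 1` next to the half line, and translation carries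
  -- it to every site.
  have hj : ∀ j, (1 : ℤ) + (j - 1) = j := fun j => by ring
  rcases GaugeChain.a_Ω_eq_zero_or_of_abelian (G := F.gaugeChain hψ hτ hγ)
    ((mem_bicommutant_iff hψ hτ hγ 0 e).1 he1) he2
    (fun x hx y hy => he3 x ((mem_bicommutant_iff hψ hτ hγ 0 x).2 hx) y
      ((mem_bicommutant_iff hψ hτ hγ 0 y).2 hy)) he0 with h | h
  · refine Or.inl fun j => ?_
    rw [← hj j, ← F.τ_b, ← map_star, ← map_mul, hτ, ← hψ.isState.inner_vec]
    have h' : hψ.isState.vec (F.b 1) = 0 := by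
      rw [← hψ.isState.gnsRep_vec_one]; exact h
    rw [h', inner_zero_left]
  · refine Or.inr fun j => ?_
    have h' : hψ.isState.vec (star (F.b 1)) = 0 := by
      rw [← hψ.isState.gnsRep_vec_one, map_star]; exact h
    have := hψ.isState.inner_vec (star (F.b 1)) (star (F.b 1))
    rw [h', inner_zero_left, star_star] at this
    rw [← hj j, ← F.τ_b, ← map_star, ← map_mul, hτ, ← this]

end FermionSystem

end FermionSystem

/-! ### Uniqueness of the Fock states -/

section Uniqueness

variable {A : Type} [CStarAlgebra A] {b : ℤ → A}

/-- The span of the normal ordered words. -/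
def normalOrdered (b : ℤ → A) : Submodule ℂ A :=
  Submodule.span ℂ (Set.range fun p : List ℤ × List ℤ =>
    (p.1.map fun j => star (b j)).prod * (p.2.map b).prod)

lemma word_mem_normalOrdered (I J : List ℤ) :
    (I.map fun j => star (b j)).prod * (J.map b).prod ∈ normalOrdered b :=
  Submodule.subset_span ⟨(I, J), rfl⟩

lemma mul_mem_of_word {x : A} (hx : ∀ I J : List ℤ,
    x * ((I.map fun j => star (b j)).prod * (J.map b).prod) ∈ normalOrdered b) :
    ∀ w ∈ normalOrdered b, x * w ∈ normalOrdered b := by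
  have : normalOrdered b ≤ (normalOrdered b).comap (LinearMap.mulLeft ℂ x) := by
    refine Submodule.span_le.2 ?_
    rintro _ ⟨p, rfl⟩
    exact hx p.1 p.2
  exact fun w hw => this hw

lemma star_mul_mem_normalOrdered (j : ℤ) :
    ∀ w ∈ normalOrdered b, star (b j) * w ∈ normalOrdered b :=
  mul_mem_of_word fun I J => by
    rw [← mul_assoc]
    exact word_mem_normalOrdered (j :: I) J

lemma mul_mem_normalOrdered (hb : ∀ j k, b j * star (b k) + star (b k) * b j = if j = k then 1 else 0)
    (j : ℤ) : ∀ w ∈ normalOrdered b, b j * w ∈ normalOrdered b :=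
  mul_mem_of_word fun I J => by
    induction I with
    | nil => simpa using word_mem_normalOrdered (b := b) [] (j :: J)
    | cons k I ih =>
      rw [List.map_cons, List.prod_cons, mul_assoc, ← mul_assoc, eq_sub_of_add_eq (hb j k), sub_mul,
        mul_assoc]
      refine sub_mem ?_ (star_mul_mem_normalOrdered k _ ih)
      split_ifs
      · rw [one_mul]; exact word_mem_normalOrdered I J
      · rw [zero_mul]; exact zero_mem _

/-- The span of the normal ordered words contains `1` and is stable under left multiplication by the
generators and their adjoints, since moving `b_j` past `b_k*` costs only a shorter word. -/
lemma adjoin_le_normalOrdered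
    (hb : ∀ j k, b j * star (b k) + star (b k) * b j = if j = k then 1 else 0) {x : A}
    (hx : x ∈ StarAlgebra.adjoin ℂ (Set.range b)) : x ∈ normalOrdered b := by
  have key : ∀ w ∈ normalOrdered b, x * w ∈ normalOrdered b ∧ star x * w ∈ normalOrdered b := by
    induction hx using StarAlgebra.adjoin_induction with
    | mem x hx =>
      obtain ⟨j, rfl⟩ := hx
      exact fun w hw => ⟨mul_mem_normalOrdered hb j w hw, star_mul_mem_normalOrdered j w hw⟩
    | algebraMap r =>
      intro w hw
      rw [Algebra.algebraMap_eq_smul_one, star_smul, star_one, smul_one_mul, smul_one_mul]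
      exact ⟨Submodule.smul_mem _ _ hw, Submodule.smul_mem _ _ hw⟩
    | add x y _ _ hx hy =>
      intro w hw
      rw [star_add, add_mul, add_mul]
      exact ⟨add_mem (hx w hw).1 (hy w hw).1, add_mem (hx w hw).2 (hy w hw).2⟩
    | mul x y _ _ hx hy =>
      intro w hw
      rw [star_mul, mul_assoc, mul_assoc]
      exact ⟨(hx _ (hy w hw).1).1, (hy _ (hx w hw).2).2⟩
    | star x _ hx =>
      intro w hw
      rw [star_star]
      exact ⟨(hx w hw).2, (hx w hw).1⟩
  simpa using (key 1 (by simpa using word_mem_normalOrdered (b := b) [] [])).1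

/-- The hypothesis means `b_j Ω = 0`. A final `b_j` kills `Ω` on the right and an initial `b_j*`
kills it on the left, so only the empty word has a nonzero value. -/
lemma apply_word_eq {ω : A →ₗ[ℂ] ℂ} (h : IsState ω) (hω : ∀ j, ω (star (b j) * b j) = 0)
    (I J : List ℤ) : ω ((I.map fun j => star (b j)).prod * (J.map b).prod)
      = if I = [] ∧ J = [] then 1 else 0 := by
  have hv : ∀ j, h.vec (b j) = 0 := fun j => by
    have := h.norm_vec_sq (b j)
    rw [hω, Complex.zero_re] at this
    exact norm_eq_zero.1 (pow_eq_zero_iff two_ne_zero |>.1 this)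
  rcases List.eq_nil_or_concat J with rfl | ⟨J', j, rfl⟩
  · cases I with
    | nil => simpa using h.2
    | cons k I =>
      rw [List.map_cons, List.prod_cons, mul_assoc, ← h.inner_vec, hv, inner_zero_left]
      simp
  · rw [List.concat_eq_append, List.map_append, List.prod_append, List.map_singleton, List.prod_singleton, ← mul_assoc,
      h.apply_eq_inner, map_mul, mul_apply_eq_comp, h.gnsRep_vec_one, hv, map_zero,
      inner_zero_right]
    simp

/-- A state annihilated by a family with canonical anticommutation relations is determined by
this property on the generated C*-algebra. -/
theorem IsState.eq_of_vanishing
    (hb : ∀ j k, b j * star (b k) + star (b k) * b j = if j = k then 1 else 0)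
    (hgen : (StarAlgebra.adjoin ℂ (Set.range b)).topologicalClosure = ⊤)
    {ω ω' : A →ₗ[ℂ] ℂ} (h : IsState ω) (h' : IsState ω') (hω : ∀ j, ω (star (b j) * b j) = 0)
    (hω' : ∀ j, ω' (star (b j) * b j) = 0) : ω = ω' := by
  have h1 : normalOrdered b ≤ LinearMap.eqLocus ω ω' := by
    refine Submodule.span_le.2 ?_
    rintro _ ⟨p, rfl⟩
    exact (apply_word_eq h hω _ _).trans (apply_word_eq h' hω' _ _).symm
  refine LinearMap.ext fun a => ?_
  have ha : a ∈ closure (StarAlgebra.adjoin ℂ (Set.range b) : Set A) := by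
    rw [← StarSubalgebra.topologicalClosure_coe, hgen]; trivial
  exact closure_minimal (fun x hx => h1 (adjoin_le_normalOrdered hb hx))
    (isClosed_eq h.continuous h'.continuous) ha

end Uniqueness

lemma isFockState_of_vanishing {ψ : carAlgebra →ₗ[ℂ] ℂ} (h : IsState ψ)
    (h0 : ∀ j, ψ (star (c j) * c j) = 0) : IsFockState ψ :=
  ⟨⟨h, h0⟩, fun _ hω hω0 =>
    hω.eq_of_vanishing c_anticomm_star topologicalClosure_adjoin_c h hω0 h0⟩

lemma isAntiFockState_of_vanishing {ψ : carAlgebra →ₗ[ℂ] ℂ} (h : IsState ψ)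
    (h0 : ∀ j, ψ (c j * star (c j)) = 0) : IsAntiFockState ψ := by
  -- Particle-hole symmetry: the `c_j*` satisfy the same relations and generate the same algebra.
  refine ⟨⟨h, h0⟩, fun ω hω hω0 => hω.eq_of_vanishing (b := fun j => star (c j)) (fun j k => ?_) ?_ h
    (fun j => by rw [star_star]; exact hω0 j) (fun j => by rw [star_star]; exact h0 j)⟩
  · rw [star_star, add_comm, c_anticomm_star]
    simp only [eq_comm]
  · refine top_unique fun a _ => mem_of_forall_c_mem
      (StarSubalgebra.isClosed_topologicalClosure _) (fun j => ?_) a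
    refine StarSubalgebra.le_topologicalClosure _ ?_
    rw [← star_star (c j)]
    exact star_mem (StarAlgebra.subset_adjoin ℂ _ ⟨j, rfl⟩)

theorem isFockState_or_isAntiFockState {ψ : carAlgebra →ₗ[ℂ] ℂ} (hψ : IsPureState ψ)
    (hτ : ∀ (n : ℤ) (a : carAlgebra), ψ (carShift n a) = ψ a)
    (hγ : ∀ (θ : ℝ) (a : carAlgebra), ψ (carGauge θ a) = ψ a)
    (hI : IsTypeI (bicommutant ((carLocal (Set.Iic 0)).map hψ.isState.gnsRep))) :
    IsFockState ψ ∨ IsAntiFockState ψ :=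
  (FermionSystem.vanishing_of_typeI (F := carSystem) hψ hτ hγ hI).imp
    (isFockState_of_vanishing hψ.isState) (isAntiFockState_of_vanishing hψ.isState)

end

end FermionChain

namespace FermionChain

noncomputable section

/-! ### Vanishing of parity-odd intertwiners -/

namespace FermionSystem

variable {A : Type} [CStarAlgebra A] {F : FermionSystem A} {ψ : A →ₗ[ℂ] ℂ}

lemma parity_b (j : ℤ) : F.γ Real.pi (F.b j) = -F.b j := by
  rw [F.γ_b, Complex.exp_neg, Complex.exp_pi_mul_I]
  simp

/-- The self-adjoint unitary `b_1 + b_1*`. -/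
def flipOne (F : FermionSystem A) : A := F.b 1 + star (F.b 1)

lemma flipOne_mul_flipOne : F.flipOne * F.flipOne = 1 := by
  have h1 := F.anti 1 1
  have h1' : F.b 1 * F.b 1 = 0 := by
    rw [← two_smul ℂ] at h1
    exact (smul_eq_zero.1 h1).resolve_left two_ne_zero
  have h2 := congrArg star h1'
  rw [star_mul, star_zero] at h2
  have h3 := F.anti_star 1 1
  rw [if_pos rfl] at h3
  rw [flipOne, add_mul, mul_add, mul_add, h1', h2, zero_add, add_zero, h3]

lemma parity_flipOne : F.γ Real.pi F.flipOne = -F.flipOne := by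
  rw [flipOne, map_add, map_star, parity_b, star_neg]; abel

/-- An operator of odd type that intertwines the even part of the algebra with its image under the
automorphism that changes the sign of the `b_j`, `j ≤ 0`, vanishes. -/
theorem intertwiner_eq_zero (hψ : IsPureState ψ) (hτ : ∀ n a, ψ (F.τ n a) = ψ a)
    (hγ : ∀ θ a, ψ (F.γ θ a) = ψ a) {κ : A →⋆ₐ[ℂ] A}
    (hκ : ∀ j, κ (F.b j) = (if j ≤ 0 then (-1 : ℂ) else 1) • F.b j)
    {V : hψ.isState.GNS →L[ℂ] hψ.isState.GNS}
    (hV : ∀ x, F.γ Real.pi x = x →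
      V * hψ.isState.gnsRep (κ x) = hψ.isState.gnsRep x * V)
    (h1 : (F.gaugeChain hψ hτ hγ).Γ * V = V) (h2 : V * (F.gaugeChain hψ hτ hγ).Γ = -V) : V = 0 := by
  set G := F.gaugeChain hψ hτ hγ with hG
  set π := hψ.isState.gnsRep with hπ
  have hκ1 : κ F.flipOne = F.flipOne := by
    rw [flipOne, map_add, map_star, hκ, if_neg (by norm_num), one_smul]
  have hCC : π F.flipOne * π F.flipOne = 1 := by
    rw [← map_mul, flipOne_mul_flipOne, map_one]
  have hΓC : G.Γ * π F.flipOne = -(π F.flipOne * G.Γ) := by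
    rw [flipOne, map_add, map_star, mul_add, add_mul]
    have e1 := G.Γ_mul_a 1
    have e2 := G.Γ_mul_star_a 1
    rw [hG, gaugeChain_a, ← hG] at e1 e2
    rw [e1, e2]; abel
  set C := π F.flipOne with hC
  have hCΓ : C * G.Γ = -(G.Γ * C) := by rw [hΓC, neg_neg]
  have hΓW : G.Γ * (C * V * C) = -(C * V * C) := by
    rw [← mul_assoc, ← mul_assoc, hΓC, neg_mul, mul_assoc C, h1, neg_mul]
  have hWΓ : C * V * C * G.Γ = C * V * C := by
    rw [mul_assoc, hCΓ, mul_neg, ← mul_assoc, mul_assoc C V, h2, mul_neg, neg_mul, neg_neg]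
  -- `C` represents an odd element at a site outside the half line, so `κ` fixes that element.
  -- Adding the conjugate `C V C` gives an operator commuting with `C`; writing an odd `x` as `(x C)
  -- C` then extends the intertwining relation from even elements to odd ones.
  have hWC : (V + C * V * C) * C = C * (V + C * V * C) := by
    rw [add_mul, mul_add, mul_assoc (C * V), hCC, mul_one, ← mul_assoc C, ← mul_assoc C, hCC, one_mul,
      add_comm]
  have even : ∀ x, F.γ Real.pi x = x →
      (V + C * V * C) * π (κ x) = π x * (V + C * V * C) := by
    intro x hx
    have e1 := hV (F.flipOne * x * F.flipOne) (by
      rw [map_mul, map_mul, hx, parity_flipOne, neg_mul, neg_mul, mul_neg, neg_neg])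
    rw [map_mul κ, map_mul κ, hκ1, map_mul π, map_mul π, map_mul π, map_mul π, ← hC] at e1
    have e2 : C * V * C * π (κ x) = π x * (C * V * C) := by
      calc C * V * C * π (κ x) = C * (V * (C * π (κ x) * C)) * C := by
            simp only [mul_assoc, hCC, mul_one]
        _ = (C * C) * π x * (C * V * C) := by rw [e1]; simp only [mul_assoc]
        _ = _ := by rw [hCC, one_mul]
    rw [add_mul, mul_add, hV x hx, e2]
  have odd : ∀ x, F.γ Real.pi x = -x →
      (V + C * V * C) * π (κ x) = π x * (V + C * V * C) := by
    intro x hx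
    have e1 := even (x * F.flipOne) (by rw [map_mul, hx, parity_flipOne, neg_mul_neg])
    rw [map_mul κ, hκ1, map_mul π, map_mul π, ← hC] at e1
    calc (V + C * V * C) * π (κ x) = (V + C * V * C) * (π (κ x) * C) * C := by
          rw [mul_assoc _ (π (κ x) * C) C, mul_assoc (π (κ x)) C C, hCC, mul_one]
      _ = π x * (C * ((V + C * V * C) * C)) := by rw [e1]; simp only [mul_assoc]
      _ = _ := by rw [hWC, ← mul_assoc C, hCC, one_mul]
  have hε : ∀ j : ℤ, (if j ≤ 0 then (-1 : ℂ) else 1) * (if j ≤ 0 then (-1 : ℂ) else 1) = 1 := by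
    intro j; split_ifs <;> norm_num
  have hW : V + C * V * C = 0 := by
    refine GaugeChain.odd_implementer_eq_zero (G := G) (m := 0) (fun j => ?_) (fun j => ?_) ?_
    · have := odd (F.b j) (parity_b j)
      rw [hκ, map_smul, mul_smul_comm] at this
      change _ * π (F.b j) = _ • (π (F.b j) * _)
      rw [← this, smul_smul, hε, one_smul]
    · have := odd (star (F.b j)) (by rw [map_star, parity_b, star_neg])
      rw [map_star, hκ, star_smul, map_smul, mul_smul_comm, map_star] at this
      have hs : star (if j ≤ 0 then (-1 : ℂ) else 1) = if j ≤ 0 then (-1 : ℂ) else 1 := by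
        split_ifs <;> simp
      rw [hs] at this
      change _ * star (π (F.b j)) = _ • (star (π (F.b j)) * _)
      rw [← this, smul_smul, hε, one_smul]
    · rw [mul_add, add_mul, h1, h2, hΓW, hWΓ]; abel
  -- `V` maps into the even vectors and `C V C` into the odd ones, so both vanish with their sum.
  have h3 : C * V * C = -V := by rw [eq_neg_iff_add_eq_zero, add_comm, hW]
  rw [h3, mul_neg, h1, neg_neg] at hΓW
  have h4 : (2 : ℂ) • V = 0 := by
    rw [two_smul]
    nth_rewrite 1 [← hΓW]
    rw [neg_add_cancel]
  exact (smul_eq_zero.1 h4).resolve_left two_ne_zero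

lemma gaugeChain_Γ_vec (hψ : IsPureState ψ) (hτ : ∀ n a, ψ (F.τ n a) = ψ a)
    (hγ : ∀ θ a, ψ (F.γ θ a) = ψ a) (a : A) :
    (F.gaugeChain hψ hτ hγ).Γ (hψ.isState.vec a) = hψ.isState.vec (F.γ Real.pi a) :=
  gaugeChain_U_vec hψ hτ hγ Real.pi a

/-- A state of another C*-algebra cannot couple the even and the odd vectors of an invariant pure
state in a way compatible with the sign change of the `b_j`, `j ≤ 0`. -/
theorem coupling_eq_zero (hψ : IsPureState ψ) (hτ : ∀ n a, ψ (F.τ n a) = ψ a)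
    (hγ : ∀ θ a, ψ (F.γ θ a) = ψ a) {κ : A →⋆ₐ[ℂ] A}
    (hκ : ∀ j, κ (F.b j) = (if j ≤ 0 then (-1 : ℂ) else 1) • F.b j)
    {D : Type} [CStarAlgebra D] {ω : D →ₗ[ℂ] ℂ} (hω : IsState ω) (p q : A →ₗ[ℂ] D)
    (hp : ∀ a, ‖hω.vec (p a)‖ ≤ ‖hψ.isState.vec a‖) (hq : ∀ a, ‖hω.vec (q a)‖ ≤ ‖hψ.isState.vec a‖)
    (hpq : ∀ x a b, F.γ Real.pi x = x → star (p (star x * a)) * q b = star (p a) * q (κ x * b))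
    (hpγ : ∀ a, p (F.γ Real.pi a) = p a) (hqγ : ∀ a, q (F.γ Real.pi a) = -q a) (a b : A) :
    ω (star (p a) * q b) = 0 := by
  -- `p` and `q` become contractions between the GNS spaces. The operator `P* Q` maps odd to even
  -- vectors, and `hpq` is its intertwining relation.
  obtain ⟨P, hP⟩ := hψ.isState.exists_extend (hω.vec ∘ₗ p) hp
  obtain ⟨Q, hQ⟩ := hψ.isState.exists_extend (hω.vec ∘ₗ q) hq
  have key : ∀ a b, ⟪hψ.isState.vec a, (P.adjoint ∘L Q) (hψ.isState.vec b)⟫_ℂ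
      = ω (star (p a) * q b) := by
    intro a b
    rw [ContinuousLinearMap.comp_apply, ContinuousLinearMap.adjoint_inner_right, hP, hQ]
    exact hω.inner_vec _ _
  have h0 : P.adjoint ∘L Q = 0 := by
    refine intertwiner_eq_zero hψ hτ hγ hκ (fun x hx => hψ.isState.ext_inner fun a b => ?_)
      (hψ.isState.ext_inner fun a b => ?_) (hψ.isState.ext_inner fun a b => ?_)
    · rw [mul_apply_eq_comp, mul_apply_eq_comp, hψ.isState.gnsRep_vec, key, ← hpq x a b hx, ← key,
        ← hψ.isState.gnsRep_vec, map_star, ContinuousLinearMap.star_eq_adjoint,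
        ContinuousLinearMap.adjoint_inner_left]
    · rw [mul_apply_eq_comp, ← GaugeChain.star_Γ, ContinuousLinearMap.star_eq_adjoint,
        ContinuousLinearMap.adjoint_inner_right, gaugeChain_Γ_vec, key, key, hpγ]
    · rw [mul_apply_eq_comp, gaugeChain_Γ_vec, key, neg_apply, inner_neg_right, key, hqγ, mul_neg,
        map_neg]
  rw [← key, h0, zero_apply, inner_zero_right]

/-- The parity acts isometrically on the GNS space. The bounds make the even and odd parts extend to
bounded operators on that space. -/
lemma norm_vec_half_le (hψ : IsState ψ) (hγ : ∀ θ a, ψ (F.γ θ a) = ψ a) (a : A) :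
    ‖hψ.vec ((2⁻¹ : ℂ) • (a + F.γ Real.pi a))‖ ≤ ‖hψ.vec a‖ ∧
      ‖hψ.vec ((2⁻¹ : ℂ) • (a - F.γ Real.pi a))‖ ≤ ‖hψ.vec a‖ := by
  have h1 : ‖hψ.vec (F.γ Real.pi a)‖ = ‖hψ.vec a‖ := by
    refine (pow_left_inj₀ (norm_nonneg _) (norm_nonneg _) two_ne_zero).1 ?_
    rw [hψ.norm_vec_sq, hψ.norm_vec_sq, ← map_star (F.γ Real.pi), ← map_mul (F.γ Real.pi), hγ]
  have h2 := norm_add_le (hψ.vec a) (hψ.vec (F.γ Real.pi a))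
  have h3 := norm_sub_le (hψ.vec a) (hψ.vec (F.γ Real.pi a))
  rw [h1] at h2 h3
  rw [map_smul, map_smul, norm_smul, norm_smul, map_add, map_sub, norm_inv, Complex.norm_ofNat]
  constructor <;> linarith

end FermionSystem

/-! ### The even and odd parts of the two algebras -/

section EvenOdd

lemma parity_parity (Q : Op) : parity (parity Q) = Q := by
  have h := parity_evenPart Q
  simp only [evenPart, map_smul, map_add] at h
  have h2 := smul_right_injective Op (show (2⁻¹ : ℂ) ≠ 0 by norm_num) h
  rw [add_comm] at h2
  exact add_right_cancel h2

lemma parity_oddPart (Q : Op) : parity (oddPart Q) = -oddPart Q := by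
  rw [oddPart, map_smul, map_sub, parity_parity, ← smul_neg, neg_sub]

lemma gaugeU_pi : gaugeU Real.pi = parityU := by
  refine Subtype.ext (op_ext fun f S => ?_)
  change Complex.exp (Real.pi * Complex.I) ^ S.card * f S = (-1) ^ S.card * f S
  rw [Complex.exp_pi_mul_I]

lemma coe_carGauge_pi (a : carAlgebra) : (carGauge Real.pi a : Op) = parity a := by
  change Ad (gaugeU Real.pi) (a : Op) = Ad parityU a
  rw [gaugeU_pi]

/-- The cross terms of `Q* Q` are odd, and `T` cancels in the square of `T Q_-`. The even part is
thus a sum of squares from the other algebra, which makes the extensions in both directions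
positive. -/
lemma evenPart_star_mul_self (Q : Op) : evenPart (star Q * Q)
    = star (evenPart Q) * evenPart Q + star (tU * oddPart Q) * (tU * oddPart Q) := by
  have h : star (tU * oddPart Q) * (tU * oddPart Q) = star (oddPart Q) * oddPart Q := by
    rw [star_mul, star_T, mul_assoc, ← mul_assoc (tU : Op), T_mul_T, one_mul]
  rw [h]
  simp only [evenPart, oddPart, map_mul, map_star, star_smul, star_add, star_sub,
    smul_mul_smul_comm]
  rw [add_mul, sub_mul, mul_add, mul_add, mul_sub, mul_sub]
  simp only [Complex.star_def, map_inv₀, Complex.conj_ofNat]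
  match_scalars <;> norm_num

/-- The even part, as a linear map. -/
def evenPartₗ {B B' : StarSubalgebra ℂ Op} (h : ∀ Q ∈ B, evenPart Q ∈ B') : B →ₗ[ℂ] B' where
  toFun Q := ⟨evenPart Q, h Q Q.2⟩
  map_add' P Q := Subtype.ext <| by
    change evenPart ((P : Op) + Q) = evenPart P + evenPart Q
    simp only [evenPart, map_add]; module
  map_smul' s Q := Subtype.ext <| by
    change evenPart (s • (Q : Op)) = s • evenPart Q
    simp only [evenPart, map_smul]; module

/-- The map `Q ↦ T Q_-`. -/
def oddPartₗ {B B' : StarSubalgebra ℂ Op} (h : ∀ Q ∈ B, (tU : Op) * oddPart Q ∈ B') :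
    B →ₗ[ℂ] B' where
  toFun Q := ⟨tU * oddPart Q, h Q Q.2⟩
  map_add' P Q := Subtype.ext <| by
    change tU * oddPart ((P : Op) + Q) = tU * oddPart P + tU * oddPart Q
    rw [← mul_add]
    simp only [oddPart, map_add]
    congr 1; module
  map_smul' s Q := Subtype.ext <| by
    change tU * oddPart (s • (Q : Op)) = s • (tU * oddPart Q)
    rw [← mul_smul_comm]
    simp only [oddPart, map_smul]
    congr 1; module

lemma isState_comp_evenPart {B B' : StarSubalgebra ℂ Op} [IsClosed (B : Set Op)]
    [IsClosed (B' : Set Op)] (h : ∀ Q ∈ B, evenPart Q ∈ B')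
    (h' : ∀ Q ∈ B, (tU : Op) * oddPart Q ∈ B') {ω : B' →ₗ[ℂ] ℂ} (hω : IsState ω) :
    IsState (ω ∘ₗ evenPartₗ h) := by
  refine ⟨fun Q => ?_, ?_⟩
  · have e : evenPartₗ h (star Q * Q) = star (evenPartₗ h Q) * evenPartₗ h Q
        + star (oddPartₗ h' Q) * oddPartₗ h' Q := Subtype.ext (evenPart_star_mul_self Q)
    rw [LinearMap.comp_apply, e, map_add]
    exact add_nonneg (hω.1 _) (hω.1 _)
  · have e : evenPartₗ h 1 = 1 := Subtype.ext (even_of_parity_eq (map_one parity)).1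
    rw [LinearMap.comp_apply, e, hω.2]

end EvenOdd

end

end FermionChain

namespace FermionChain

noncomputable section

/-! ### Purity and invariance of the extension to the spin algebra -/

section SpinExtension

lemma evenPart_mem_spin : ∀ Q ∈ carAlgebra, evenPart Q ∈ spinAlgebra :=
  fun _ hQ => (car_le_mixed hQ).1

lemma oddPart_mem_spin : ∀ Q ∈ carAlgebra, (tU : Op) * oddPart Q ∈ spinAlgebra :=
  fun _ hQ => (car_le_mixed hQ).2

lemma oddPart_mem_car : ∀ Q ∈ spinAlgebra, (tU : Op) * oddPart Q ∈ carAlgebra :=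
  fun _ hQ => (spin_le_mixed hQ).2

/-- Conjugation by `T` on the CAR algebra. -/
def carT : carAlgebra →⋆ₐ[ℂ] carAlgebra := restrictAd carAlgebra tU Ad_T_car

lemma carT_c (j : ℤ) : carT (c j) = (if j ≤ 0 then (-1 : ℂ) else 1) • c j :=
  Subtype.ext (Ad_tU_annih j)

lemma parity_Ad_T {Q : Op} (h : parity Q = Q) : parity (Ad tU Q) = Ad tU Q := by
  rw [Ad_T, map_mul, map_mul, h, parity_T]

lemma evenPart_mul {P : Op} (h : parity P = P) (Q : Op) : evenPart (P * Q) = P * evenPart Q := by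
  rw [evenPart, evenPart, map_mul, h, ← mul_add, mul_smul_comm]

lemma oddPart_mul {P : Op} (h : parity P = P) (Q : Op) : oddPart (P * Q) = P * oddPart Q := by
  rw [oddPart, oddPart, map_mul, h, ← mul_sub, mul_smul_comm]

lemma T_mul_Ad_T_mul (P Q : Op) : (tU : Op) * (Ad tU P * Q) = P * (tU * Q) := by
  rw [Ad_T]
  simp only [mul_assoc]
  rw [← mul_assoc (tU : Op) (tU : Op), T_mul_T, one_mul]

lemma coe_half_add (a : carAlgebra) :
    (((2⁻¹ : ℂ) • (a + carGauge Real.pi a) : carAlgebra) : Op) = evenPart a := by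
  change (2⁻¹ : ℂ) • ((a : Op) + (carGauge Real.pi a : Op)) = _
  rw [coe_carGauge_pi]; rfl

lemma coe_half_sub (a : carAlgebra) :
    (((2⁻¹ : ℂ) • (a - carGauge Real.pi a) : carAlgebra) : Op) = oddPart a := by
  change (2⁻¹ : ℂ) • ((a : Op) - (carGauge Real.pi a : Op)) = _
  rw [coe_carGauge_pi]; rfl

lemma IsState.thetaExtension {ψ : carAlgebra →ₗ[ℂ] ℂ} (hψ : IsState ψ) :
    IsState (thetaExtension ψ) :=
  isState_comp_evenPart (fun _ hQ => evenPart_mem_car hQ) oddPart_mem_car hψ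

variable {ψ : carAlgebra →ₗ[ℂ] ℂ}

lemma apply_half_add (hγ : ∀ (θ : ℝ) (a : carAlgebra), ψ (carGauge θ a) = ψ a) (a : carAlgebra) :
    ψ ((2⁻¹ : ℂ) • (a + carGauge Real.pi a)) = ψ a := by
  rw [map_smul, map_add, hγ, smul_eq_mul]; ring

/-- The functional `a ↦ ω(a_+)` on the CAR algebra, for a functional `ω` on the spin algebra. -/
def carExtension (ω : spinAlgebra →ₗ[ℂ] ℂ) : carAlgebra →ₗ[ℂ] ℂ := ω ∘ₗ evenPartₗ evenPart_mem_spin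

lemma carExtension_thetaExtension (hγ : ∀ (θ : ℝ) (a : carAlgebra), ψ (carGauge θ a) = ψ a) :
    carExtension (thetaExtension ψ) = ψ := by
  refine LinearMap.ext fun a => ?_
  rw [← apply_half_add hγ a]
  change ψ ⟨evenPart (evenPart (a : Op)), _⟩ = _
  congr 1
  refine Subtype.ext ?_
  rw [coe_half_add]
  exact (even_of_parity_eq (parity_evenPart _)).1

lemma apply_eq_of_even {ω : spinAlgebra →ₗ[ℂ] ℂ} (he : carExtension ω = ψ) {X : Op}
    (hX : parity X = X) {Q : spinAlgebra} {a : carAlgebra} (hQ : (Q : Op) = X) (ha : (a : Op) = X) :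
    ω Q = ψ a := by
  rw [← he]
  change ω Q = ω ⟨evenPart (a : Op), _⟩
  congr 1
  refine Subtype.ext ?_
  change (Q : Op) = evenPart (a : Op)
  rw [hQ, ha]
  exact (even_of_parity_eq hX).1.symm

lemma norm_vec_evenPart_le (hψ : IsState ψ)
    (hγ : ∀ (θ : ℝ) (a : carAlgebra), ψ (carGauge θ a) = ψ a) {ω : spinAlgebra →ₗ[ℂ] ℂ}
    (hω : IsState ω) (he : carExtension ω = ψ) (a : carAlgebra) :
    ‖hω.vec (evenPartₗ evenPart_mem_spin a)‖ ≤ ‖hψ.vec a‖ := by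
  refine le_trans (le_of_eq ?_) (FermionSystem.norm_vec_half_le (F := carSystem) hψ hγ a).1
  refine (pow_left_inj₀ (norm_nonneg _) (norm_nonneg _) two_ne_zero).1 ?_
  rw [hω.norm_vec_sq, hψ.norm_vec_sq]
  congr 1
  refine apply_eq_of_even he (X := star (evenPart a) * evenPart a) ?_ rfl ?_
  · rw [map_mul, map_star, parity_evenPart]
  · rw [← coe_half_add]; rfl

lemma norm_vec_oddPart_le (hψ : IsState ψ)
    (hγ : ∀ (θ : ℝ) (a : carAlgebra), ψ (carGauge θ a) = ψ a) {ω : spinAlgebra →ₗ[ℂ] ℂ}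
    (hω : IsState ω) (he : carExtension ω = ψ) (a : carAlgebra) :
    ‖hω.vec (oddPartₗ oddPart_mem_spin a)‖ ≤ ‖hψ.vec a‖ := by
  refine le_trans (le_of_eq ?_) (FermionSystem.norm_vec_half_le (F := carSystem) hψ hγ a).2
  refine (pow_left_inj₀ (norm_nonneg _) (norm_nonneg _) two_ne_zero).1 ?_
  rw [hω.norm_vec_sq, hψ.norm_vec_sq]
  congr 1
  refine apply_eq_of_even he (X := star (oddPart a) * oddPart a) ?_ ?_ ?_
  · rw [map_mul, map_star, parity_oddPart, star_neg, neg_mul_neg]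
  · change star (tU * oddPart a) * (tU * oddPart a) = _
    rw [star_mul, star_T, mul_assoc, ← mul_assoc (tU : Op), T_mul_T, one_mul]
  · rw [← coe_half_sub]; rfl

/-- A state of the spin algebra with the even part of `ψ` vanishes on the odd elements. -/
lemma apply_odd_eq_zero (hψ : IsPureState ψ)
    (hτ : ∀ (n : ℤ) (a : carAlgebra), ψ (carShift n a) = ψ a)
    (hγ : ∀ (θ : ℝ) (a : carAlgebra), ψ (carGauge θ a) = ψ a) {ω : spinAlgebra →ₗ[ℂ] ℂ}
    (hω : IsState ω) (he : carExtension ω = ψ) (b : carAlgebra) :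
    ω (oddPartₗ oddPart_mem_spin b) = 0 := by
  -- With `a = 1` the coupling is the value of `ω` at `T b_-`.
  have key := FermionSystem.coupling_eq_zero (F := carSystem) hψ hτ hγ carT_c hω
    (evenPartₗ evenPart_mem_spin) (oddPartₗ oddPart_mem_spin)
    (norm_vec_evenPart_le hψ.isState hγ hω he) (norm_vec_oddPart_le hψ.isState hγ hω he) ?_ ?_ ?_ 1 b
  · have e : evenPartₗ evenPart_mem_spin (1 : carAlgebra) = 1 :=
      Subtype.ext (even_of_parity_eq (map_one parity)).1
    rwa [e, star_one, one_mul] at key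
  · intro x a b hx
    have hx' : parity (x : Op) = x := by rw [← coe_carGauge_pi]; exact congrArg Subtype.val hx
    refine Subtype.ext ?_
    change star (evenPart (star (x : Op) * a)) * (tU * oddPart b)
      = star (evenPart a) * (tU * oddPart (Ad tU x * b))
    rw [evenPart_mul (by rw [map_star, hx']), oddPart_mul (parity_Ad_T hx'), T_mul_Ad_T_mul,
      star_mul, star_star, mul_assoc]
  · intro a
    refine Subtype.ext ?_
    change evenPart (carGauge Real.pi a : Op) = evenPart a
    rw [coe_carGauge_pi, evenPart, evenPart, parity_parity, add_comm]
  · intro a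
    refine Subtype.ext ?_
    change tU * oddPart (carGauge Real.pi a : Op) = -(tU * oddPart a)
    rw [coe_carGauge_pi, oddPart, oddPart, parity_parity, ← mul_neg, ← smul_neg, neg_sub]

/-- Every `Q` is `Q_+ + T b` with `b = T Q_-` an odd element of the CAR algebra, so the vanishing on
odd elements leaves only the values on even ones. This uniqueness is what makes the extension pure.
-/
lemma eq_thetaExtension (hψ : IsPureState ψ)
    (hτ : ∀ (n : ℤ) (a : carAlgebra), ψ (carShift n a) = ψ a)
    (hγ : ∀ (θ : ℝ) (a : carAlgebra), ψ (carGauge θ a) = ψ a) {ω : spinAlgebra →ₗ[ℂ] ℂ}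
    (hω : IsState ω) (he : carExtension ω = ψ) : ω = thetaExtension ψ := by
  refine LinearMap.ext fun Q => ?_
  have hb := apply_odd_eq_zero hψ hτ hγ hω he ⟨tU * oddPart Q, oddPart_mem_car Q Q.2⟩
  have hodd : oddPart (tU * oddPart (Q : Op)) = tU * oddPart Q :=
    (even_of_parity_neg (by rw [map_mul, parity_T, parity_oddPart, mul_neg])).2
  have hev : evenPart (evenPart (Q : Op)) = evenPart Q :=
    (even_of_parity_eq (parity_evenPart _)).1
  have hQ : Q = evenPartₗ evenPart_mem_spin ⟨evenPart Q, evenPart_mem_car Q.2⟩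
      + oddPartₗ oddPart_mem_spin ⟨tU * oddPart Q, oddPart_mem_car Q Q.2⟩ := by
    refine Subtype.ext ?_
    change (Q : Op) = evenPart (evenPart (Q : Op)) + tU * oddPart (tU * oddPart (Q : Op))
    rw [hev, hodd, ← mul_assoc, T_mul_T, one_mul, even_add_odd]
  conv_lhs => rw [hQ, map_add, hb, add_zero]
  exact LinearMap.congr_fun he ⟨evenPart Q, evenPart_mem_car Q.2⟩

/-- The `Θ`-invariant extension of an invariant pure state is pure. -/
theorem isPureState_thetaExtension (hψ : IsPureState ψ)
    (hτ : ∀ (n : ℤ) (a : carAlgebra), ψ (carShift n a) = ψ a)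
    (hγ : ∀ (θ : ℝ) (a : carAlgebra), ψ (carGauge θ a) = ψ a) :
    IsPureState (thetaExtension ψ) := by
  have left : ∀ ω₁ ω₂ : spinAlgebra →ₗ[ℂ] ℂ, IsState ω₁ → IsState ω₂ →
      ∀ t : ℝ, 0 < t → t < 1 → t • ω₁ + (1 - t) • ω₂ = thetaExtension ψ →
        ω₁ = thetaExtension ψ := by
    intro ω₁ ω₂ h₁ h₂ t h0 h1 h
    -- Passing to the CAR algebra through even parts turns a decomposition of the extension into a
    -- decomposition of `ψ`, which is trivial by purity.
    refine eq_thetaExtension hψ hτ hγ h₁ (hψ.eq_of_convex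
      (isState_comp_evenPart evenPart_mem_spin oddPart_mem_spin h₁)
      (isState_comp_evenPart evenPart_mem_spin oddPart_mem_spin h₂) h0 h1 ?_)
    rw [← carExtension_thetaExtension hγ, ← h]
    rfl
  refine ⟨hψ.isState.thetaExtension, fun ω₁ h₁ ω₂ h₂ h => ?_⟩
  obtain ⟨s, t, hs, ht, hst, h⟩ := h
  have ht' : t = 1 - s := by linarith
  rw [ht'] at h
  exact left ω₁ ω₂ h₁ h₂ s hs (by linarith) h

lemma parityU_comm_spinShiftU (n : ℤ) : parityU * spinShiftU n = spinShiftU n * parityU := by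
  refine Subtype.ext (op_ext fun f S => ?_)
  change (-1) ^ S.card * (((-1 : ℂ) ^ n) ^ S.card * f (translate (-n) S))
    = ((-1 : ℂ) ^ n) ^ S.card * ((-1) ^ (translate (-n) S).card * f (translate (-n) S))
  rw [show (translate (-n) S).card = S.card from Finset.card_map _]
  ring

lemma evenPart_Ad_spinShiftU (n : ℤ) (Q : Op) :
    evenPart (Ad (spinShiftU n) Q) = Ad (spinShiftU n) (evenPart Q) := by
  have h : parity (Ad (spinShiftU n) Q) = Ad (spinShiftU n) (parity Q) := by
    rw [parity, ← Unitary.conjStarAlgAut_mul_apply, ← Unitary.conjStarAlgAut_mul_apply,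
      parityU_comm_spinShiftU]
  rw [evenPart, evenPart, h, map_smul, map_add]

/-- The spin and fermion shifts differ by a power of the parity, which acts trivially on even
elements, and the extension sees only these. -/
lemma spinShiftU_eq (n : ℤ) : spinShiftU n = shiftU n ∨ spinShiftU n = shiftU n * parityU := by
  rcases Int.even_or_odd n with h | h
  · refine Or.inl (Subtype.ext (op_ext fun f S => ?_))
    change ((-1 : ℂ) ^ n) ^ S.card * f (translate (-n) S) = 1 * f (translate (-n) S)
    rw [h.neg_one_zpow, one_pow]
  · refine Or.inr (Subtype.ext (op_ext fun f S => ?_))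
    change ((-1 : ℂ) ^ n) ^ S.card * f (translate (-n) S)
      = 1 * ((-1) ^ (translate (-n) S).card * f (translate (-n) S))
    rw [h.neg_one_zpow, one_mul, show (translate (-n) S).card = S.card from Finset.card_map _]

lemma Ad_spinShiftU_of_even (n : ℤ) {Q : Op} (h : parity Q = Q) :
    Ad (spinShiftU n) Q = Ad (shiftU n) Q := by
  rcases spinShiftU_eq n with h' | h'
  · rw [h']
  · rw [h', Unitary.conjStarAlgAut_mul_apply]
    exact congrArg _ h

/-- The `Θ`-invariant extension of a translation invariant functional is translation invariant. -/
theorem thetaExtension_spinShift (hτ : ∀ (n : ℤ) (a : carAlgebra), ψ (carShift n a) = ψ a) (n : ℤ)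
    (Q : spinAlgebra) : thetaExtension ψ (spinShift n Q) = thetaExtension ψ Q := by
  refine Eq.trans ?_ (hτ n ⟨evenPart Q, evenPart_mem_car Q.2⟩)
  change ψ ⟨evenPart (Ad (spinShiftU n) (Q : Op)), _⟩ = _
  congr 1
  refine Subtype.ext ?_
  change evenPart (Ad (spinShiftU n) (Q : Op)) = Ad (shiftU n) (evenPart Q)
  rw [evenPart_Ad_spinShiftU, Ad_spinShiftU_of_even n (parity_evenPart _)]

end SpinExtension

end

end FermionChain

theorem mainTheorem5
    (ψ : carAlgebra →ₗ[ℂ] ℂ) (hψ : IsPureState ψ)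
    (hτ : ∀ (n : ℤ) (a : carAlgebra), ψ (carShift n a) = ψ a)
    (hγ : ∀ (θ : ℝ) (a : carAlgebra), ψ (carGauge θ a) = ψ a) :
    (IsPureState (thetaExtension ψ) ∧
      ∀ (n : ℤ) (Q : spinAlgebra), thetaExtension ψ (spinShift n Q) = thetaExtension ψ Q) ∧
    (IsTypeI (bicommutant ((carLocal (Set.Iic 0)).map hψ.isState.gnsRep)) →
      IsFockState ψ ∨ IsAntiFockState ψ) := by
  exact ⟨⟨isPureState_thetaExtension hψ hτ hγ, thetaExtension_spinShift hτ⟩,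
    isFockState_or_isAntiFockState hψ hτ hγ⟩
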